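/- **Setting.** Let $M,m\ge 1$, $d\ge 0$, and let $f_1,\dots,f_M:\mathbb{R}^{d}\times\mathbb{R}^m\to\mathbb{R}$ be differentiable and $L$-smooth (for the Euclidean norm of $z=(x,y)$), with $f_i(x,\cdot)$ $\mu$-strongly concave for all $i$ and $x$ ($L,\mu>0$). Put $f=\frac1M\sum_i f_i$, $\Phi(x)=\max_y f(x,y)$, $y^*(x)=\arg\max_y f(x,y)$, $\kappa=L/\mu$, and assume $\inf_x\Phi>-\infty$. Each agent $i$ has a stochastic oracle $\tilde\nabla f_i(z;\xi)$, measurable in $(z,\xi)$, where $\xi$ has a law $\mathcal D_i$, such that for all $z,z'$: $\mathbf E[\tilde\nabla f_i(z;\xi)]=\nabla f_i(z)$, $\mathbf E\|\tilde\nabla f_i(z;\xi)-\nabla f_i(z)\|^2\le\sigma^2$ with $\sigma>0$, and $\mathbf E\|\tilde\nabla f_i(z;\xi)-\tilde\nabla f_i(z';\xi)\|^2\le L^2\|z-z'\|^2$. Let $W\in\mathbb{R}^{M\times M}$ have non-negative entries, vanish off the edges of a connected directed network on the $M$ agents, be doubly stochastic, and satisfy $\rho=\|W-\frac1M\mathbf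 1\mathbf 1^\top\|_2<1$. **Algorithm (DGDA-VR).** For a deterministic $Z^0=(X^0,Y^0)\in\mathbb{R}^{M\times(d+m)}$, step sizes $\eta_x,\eta_y>0$, batch sizes $S_1,S_2$ and period $q$, iterate for $t\ge 0$ $$X^{t+1}=WX^t-\eta_xD_x^t,\qquad Y^{t+1}=WY^t+\eta_yD_y^t,\qquad D^{t+1}=W(D^t+V^{t+1}-V^t),$$ where row $i$ of $V^{t+1}$ is $\frac1{S_1}\sum_{\xi}\tilde\nabla f_i(z_i^{t+1};\xi)$ over $S_1$ samples if $q\mid t$, and otherwise $v_i^t+\frac1{S_2}\sum_\xi\big(\tilde\nabla f_i(z_i^{t+1};\xi)-\tilde\nabla f_i(z_i^{t};\xi)\big)$ over $S_2$ samples. All samples are independent, and those of agent $i$ have law $\mathcal D_i$. Initially $v_i^0=\frac1{S_1}\sum_\xi\tilde\nabla f_i(z_i^0;\xi)$ over $S_1$ samples, and $D^0$ is any square-integrable random matrix that is a measurable function of the initial samples and has the same row average as $V^0$. For $U\in\mathbb{R}^{M\times(d+m)}$ let $\bar u$ be the average of its rows and $U_\perp=U-\mathbf 1\bar u^\top$.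 Put $\bar z^t=(\bar x^t,\bar y^t)$ and $$\Delta_\Phi=\Phi(\bar x^0)-\inf\Phi,\qquad \delta_0=\|\bar y^0-y^*(\bar x^0)\|^2,\qquad \Lambda_0=\max\{\|Z^0_\perp\|_F^2,\ \mathbf E\|D^0_\perp\|_F^2\}.$$ **Theorem.** There are absolute constants $c_x,c_y,c_S,C_T,C_Z,C_\delta>0$ such that the following holds in every such setting. Let $\epsilon>0$ and $$0<\eta_y\le\frac{c_y}{L}\min\Big\{(1-\rho)^2,\frac1\kappa\Big\},\qquad 0<\eta_x\le c_x\frac{\eta_y}{\kappa^2},\qquad S_1\ge c_S\frac{\kappa^2\sigma^2}{\epsilon^2},\qquad S_2\ge q\ge 1.$$ Then there is an integer $T_\epsilon\ge1$ with $$T_\epsilon\le 1+\frac{C_T}{\epsilon^{2}}\max\Big\{\frac{\Delta_\Phi}{\eta_x},\ \frac{L\kappa\,\delta_0}{\eta_y},\ \frac{\max\{1,L\}^2\kappa^2\Lambda_0}{(1-\rho)M}\Big\}$$ such that for all $T\ge T_\epsilon$ (all random variables below being integrable) $$\frac1T\sum_{t=0}^{T-1}\mathbf E\|\nabla\Phi(\bar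 x^t)\|\le\epsilon,\qquad \frac1T\sum_{t=0}^{T-1}\mathbf E\|Z^t_\perp\|_F^2\le C_Z\frac{M\epsilon^2}{L^2\kappa^2},\qquad \frac1T\sum_{t=0}^{T-1}\mathbf E\|\bar y^t-y^*(\bar x^t)\|^2\le C_\delta\frac{\epsilon^2}{L^2}.$$ Moreover, if $\tau$ is uniformly distributed on $\{0,\dots,T-1\}$ and independent of the samples, then $$\mathbf E\|Z^\tau_\perp\|_F\le C_Z\frac{\sqrt M\,\epsilon}{L\kappa}=O(\epsilon),\qquad \mathbf E\|\bar y^\tau-y^*(\bar x^\tau)\|\le C_\delta\frac{\epsilon}{L}=O(\epsilon).$$ -/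

import Mathlib

open MeasureTheory ProbabilityTheory

noncomputable section

/-- The primal-dual space `ℝ^d × ℝ^m` with its Euclidean norm
`‖(x, y)‖² = ‖x‖² + ‖y‖²`. -/
abbrev PDPoint (d m : ℕ) : Type :=
  WithLp 2 (EuclideanSpace ℝ (Fin d) × EuclideanSpace ℝ (Fin m))

/-- The pair `z = (x, y)`. -/
def pdPoint {d m : ℕ} (x : EuclideanSpace ℝ (Fin d)) (y : EuclideanSpace ℝ (Fin m)) :
    PDPoint d m :=
  WithLp.toLp 2 (x, y)

/-! ### The minimax problem -/

/-- The global objective `f = (1/M) ∑ i, f_i`. -/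
def globalObj {M d m : ℕ} (f : Fin M → PDPoint d m → ℝ)
    (x : EuclideanSpace ℝ (Fin d)) (y : EuclideanSpace ℝ (Fin m)) : ℝ :=
  (M : ℝ)⁻¹ * ∑ i, f i (pdPoint x y)

/-- The primal function `Φ(x) = max_y f(x, y)`. -/
def primalFun {M d m : ℕ} (f : Fin M → PDPoint d m → ℝ) (x : EuclideanSpace ℝ (Fin d)) : ℝ :=
  ⨆ y, globalObj f x y

/-- The best response `y*(x) = argmax_y f(x, y)`: a maximizer of `f(x, ·)`, which exists and is
unique when the `f_i(x, ·)` are continuous and strongly concave. -/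
def bestResponse {M d m : ℕ} (f : Fin M → PDPoint d m → ℝ) (x : EuclideanSpace ℝ (Fin d)) :
    EuclideanSpace ℝ (Fin m) :=
  Classical.epsilon fun y => ∀ y', globalObj f x y' ≤ globalObj f x y

/-- Each `f_i` is `L`-smooth, each `f_i(x, ·)` is `μ`-strongly concave, and `Φ` is bounded
below. -/
structure IsNCSCProblem {M d m : ℕ} (L μ : ℝ) (f : Fin M → PDPoint d m → ℝ) : Prop where
  differentiable : ∀ i, Differentiable ℝ (f i)
  gradient_lipschitz : ∀ i z z', ‖gradient (f i) z - gradient (f i) z'‖ ≤ L * ‖z - z'‖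
  strongConcave : ∀ i x, StrongConcaveOn Set.univ μ fun y => f i (pdPoint x y)
  primal_bddBelow : BddBelow (Set.range (primalFun f))

/-! ### Stochastic oracles -/

/-- `g i z ξ` with `ξ ∼ 𝒟 i` is an unbiased estimator of `∇ f_i(z)` with variance at most `σ²`,
and it is mean-square `L`-Lipschitz in `z`. -/
structure IsStochasticOracle {M d m : ℕ} {Ξ : Type*} [MeasurableSpace Ξ] (L σ : ℝ)
    (f : Fin M → PDPoint d m → ℝ) (𝒟 : Fin M → Measure Ξ)
    (g : Fin M → PDPoint d m → Ξ → PDPoint d m) : Prop where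
  measurable : ∀ i, Measurable fun p : PDPoint d m × Ξ => g i p.1 p.2
  integrable : ∀ i z, Integrable (g i z) (𝒟 i)
  unbiased : ∀ i z, ∫ s, g i z s ∂(𝒟 i) = gradient (f i) z
  integrable_sq : ∀ i z, Integrable (fun s => ‖g i z s - gradient (f i) z‖ ^ 2) (𝒟 i)
  variance_le : ∀ i z, ∫ s, ‖g i z s - gradient (f i) z‖ ^ 2 ∂(𝒟 i) ≤ σ ^ 2
  meanSquare_lipschitz : ∀ i z z',
    ∫ s, ‖g i z s - g i z' s‖ ^ 2 ∂(𝒟 i) ≤ L ^ 2 * ‖z - z'‖ ^ 2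

/-- The random samples: `ξ t i k` is the `k`-th sample available to agent `i` for forming its
estimator at iterate `t`; all samples are independent and those of agent `i` have law `𝒟 i`. -/
structure IsSampling {M : ℕ} {Ω Ξ : Type*} [MeasurableSpace Ω] [MeasurableSpace Ξ]
    (P : Measure Ω) (𝒟 : Fin M → Measure Ξ) (ξ : ℕ → Fin M → ℕ → Ω → Ξ) : Prop where
  measurable : ∀ t i k, Measurable (ξ t i k)
  law : ∀ t i k, P.map (ξ t i k) = 𝒟 i
  indep : iIndepFun (fun p : ℕ × Fin M × ℕ => ξ p.1 p.2.1 p.2.2) P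

/-- The information carried by the samples used for the initialization. -/
abbrev initialSigma {M : ℕ} {Ω Ξ : Type*} [MeasurableSpace Ξ] (ξ : ℕ → Fin M → ℕ → Ω → Ξ) :
    MeasurableSpace Ω :=
  ⨆ i, ⨆ k, MeasurableSpace.comap (ξ 0 i k) inferInstance

/-- `(1/S) ∑ ∇̃f(z; ξ)` over the first `S` entries `ξ` of a sequence of samples. -/
def batchMean {d m : ℕ} {Ξ : Type*} (g : PDPoint d m → Ξ → PDPoint d m) (S : ℕ)
    (z : PDPoint d m) (s : ℕ → Ξ) : PDPoint d m :=
  (S : ℝ)⁻¹ • ∑ k ∈ Finset.range S, g z (s k)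

/-! ### The mixing matrix -/

/-- `ρ = ‖W - Π‖₂`, the spectral norm of the deviation from the averaging matrix
`Π = (1/M) 1 1ᵀ`. -/
def mixingRho {M : ℕ} (W : Matrix (Fin M) (Fin M) ℝ) : ℝ :=
  ‖Matrix.toEuclideanCLM (n := Fin M) (𝕜 := ℝ) (W - Matrix.of fun _ _ => (M : ℝ)⁻¹)‖

/-- `W` is a mixing matrix for the connected (directed) network with edge relation `Edge`. -/
structure IsMixingMatrix {M : ℕ} (Edge : Fin M → Fin M → Prop)
    (W : Matrix (Fin M) (Fin M) ℝ) : Prop where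
  connected : ∀ i j, Relation.ReflTransGen Edge i j
  nonneg : ∀ i j, 0 ≤ W i j
  decentralized : ∀ i j, ¬ Edge i j → W i j = 0
  row_sum : ∀ i, ∑ j, W i j = 1
  col_sum : ∀ j, ∑ i, W i j = 1
  rho_lt_one : mixingRho W < 1

/-! ### The algorithm DGDA-VR -/

/-- The iterates `Z = (X, Y)`, the stochastic gradient estimates `V` and the gradient trackers
`D`; row `i` belongs to agent `i`. -/
structure DGDAState (M d m : ℕ) where
  Z : Fin M → PDPoint d m
  V : Fin M → PDPoint d m
  D : Fin M → PDPoint d m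

/-- Step sizes, batch sizes and the period of the large batches. -/
structure DGDAParams where
  ηx : ℝ
  ηy : ℝ
  S₁ : ℕ
  S₂ : ℕ
  q : ℕ

/-- `X⁺ = W X - ηx D_x`, `Y⁺ = W Y + ηy D_y`. -/
def dgdaNextZ {M d m : ℕ} (W : Matrix (Fin M) (Fin M) ℝ) (p : DGDAParams)
    (st : DGDAState M d m) (i : Fin M) : PDPoint d m :=
  pdPoint (∑ j, W i j • (st.Z j).fst - p.ηx • (st.D i).fst)
    (∑ j, W i j • (st.Z j).snd + p.ηy • (st.D i).snd)

/-- The SPIDER-type estimate at iterate `t + 1` from the fresh samples `s i` of agent `i`. -/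
def dgdaNextV {M d m : ℕ} {Ξ : Type*} (W : Matrix (Fin M) (Fin M) ℝ)
    (g : Fin M → PDPoint d m → Ξ → PDPoint d m) (p : DGDAParams) (t : ℕ)
    (s : Fin M → ℕ → Ξ) (st : DGDAState M d m) (i : Fin M) : PDPoint d m :=
  if t % p.q = 0 then batchMean (g i) p.S₁ (dgdaNextZ W p st i) (s i)
  else batchMean (g i) p.S₂ (dgdaNextZ W p st i) (s i)
    - batchMean (g i) p.S₂ (st.Z i) (s i) + st.V i

/-- One iteration, from iterate `t` to iterate `t + 1`, with `D⁺ = W (D + V⁺ - V)`. -/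
def dgdaStep {M d m : ℕ} {Ξ : Type*} (W : Matrix (Fin M) (Fin M) ℝ)
    (g : Fin M → PDPoint d m → Ξ → PDPoint d m) (p : DGDAParams) (t : ℕ)
    (s : Fin M → ℕ → Ξ) (st : DGDAState M d m) : DGDAState M d m where
  Z := dgdaNextZ W p st
  V := dgdaNextV W g p t s st
  D := fun i => ∑ j, W i j • (st.D j + dgdaNextV W g p t s st j - st.V j)

/-- The initial estimates: at the initial point each agent uses a batch of size `S₁`. -/
def dgdaInitV {M d m : ℕ} {Ξ : Type*} (g : Fin M → PDPoint d m → Ξ → PDPoint d m)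
    (p : DGDAParams) (Z₀ : Fin M → PDPoint d m) (s : Fin M → ℕ → Ξ) (i : Fin M) : PDPoint d m :=
  batchMean (g i) p.S₁ (Z₀ i) (s i)

/-- The state after `t` iterations along a realization `s` of the samples, started from the
points `Z₀` and the trackers `D₀`. -/
def dgdaIter {M d m : ℕ} {Ξ : Type*} (W : Matrix (Fin M) (Fin M) ℝ)
    (g : Fin M → PDPoint d m → Ξ → PDPoint d m) (p : DGDAParams)
    (Z₀ D₀ : Fin M → PDPoint d m) (s : ℕ → Fin M → ℕ → Ξ) : ℕ → DGDAState M d m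
  | 0 => ⟨Z₀, dgdaInitV g p Z₀ (s 0), D₀⟩
  | t + 1 => dgdaStep W g p t (s (t + 1)) (dgdaIter W g p Z₀ D₀ s t)

/-! ### Error measures -/

/-- The average of the rows of an `M`-row matrix. -/
def rowAvg {M d m : ℕ} (u : Fin M → PDPoint d m) : PDPoint d m :=
  (M : ℝ)⁻¹ • ∑ i, u i

/-- `‖U_⊥‖_F² = ∑ i, ‖u_i - ū‖²`. -/
def perpSq {M d m : ℕ} (u : Fin M → PDPoint d m) : ℝ :=
  ∑ i, ‖u i - rowAvg u‖ ^ 2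

/-- `‖ȳ - y*(x̄)‖²`. -/
def dualGapSq {M d m : ℕ} (f : Fin M → PDPoint d m → ℝ) (u : Fin M → PDPoint d m) : ℝ :=
  ‖(rowAvg u).snd - bestResponse f (rowAvg u).fst‖ ^ 2

/-- `‖∇Φ(x̄)‖`. -/
def primalGradNorm {M d m : ℕ} (f : Fin M → PDPoint d m → ℝ) (u : Fin M → PDPoint d m) : ℝ :=
  ‖gradient (primalFun f) (rowAvg u).fst‖

end

/-! ### The primal-dual space -/

section PrimalDualSpace

variable {d m : ℕ}

/-! Since `W` is doubly stochastic and the tracker update adds `V⁺ - V`, the row average of `D`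
always equals that of `V` (`rowAvg_dgdaRun_D`). Hence the averaged iterate performs descent-ascent
on `f` with the inexact gradient `v̄`, and everything else is an error to be controlled.

Five error inequalities hold at each iteration. The consensus errors of `Z` and `D` contract by the
factor `ρ` up to a forcing term (`perpSq_mixRows_add_le`). The dual gap contracts by `1 - μ ηy / 2`,
up to the gradient error and the drift of `y*`, which is `κ`-Lipschitz (`dualGapSq_step_le`). The
primal value decreases by `ηx / 2 ‖∇Φ‖² + ηx / 4 ‖v̄_x‖²`, up to the dual gap and the gradient error
(`primalFun_step_le`); this rests on Danskin's formula for `∇Φ`. Finally, the estimator error is a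
sum of conditionally centred increments: between refreshes its second moment grows by at most `L² /
S₂` times the squared displacement (`integral_gradErrSq_succ_le`), and since `S₂ ≥ q` the
accumulated growth over all periods is at most one copy of the total squared displacement
(`sum_le_of_periodic_refresh`).

No Lyapunov function is built. In expectation these inequalities form a `MeanRecursion`; summing
each over `t < T` gives a linear system in the sums of the errors (`MeanRecursion.sum_bounds`). The
step-size conditions make every feedback loop in that system have small gain, so it can be solved by
elimination (`bounds_of_coupled_sums`): each normalized sum is at most `2000 K + 100 κ² T σ² / S₁`,
where `K` is the maximum in the bound on `T_ε`. The choices of `T` and `S₁` make each of the two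
terms at most `T ε² / 2`. The bounds on unsquared quantities follow by Jensen's inequality, and
those at the random index by independence. -/

lemma norm_sq_pdPoint (x : EuclideanSpace ℝ (Fin d)) (y : EuclideanSpace ℝ (Fin m)) :
    ‖pdPoint x y‖ ^ 2 = ‖x‖ ^ 2 + ‖y‖ ^ 2 :=
  WithLp.prod_norm_sq_eq_of_L2 _

lemma norm_sq_eq_fst_snd (z : PDPoint d m) : ‖z‖ ^ 2 = ‖z.fst‖ ^ 2 + ‖z.snd‖ ^ 2 :=
  WithLp.prod_norm_sq_eq_of_L2 _

lemma norm_pd_fst_le (z : PDPoint d m) : ‖z.fst‖ ≤ ‖z‖ :=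
  le_of_sq_le_sq (by nlinarith [norm_sq_eq_fst_snd z, sq_nonneg ‖z.snd‖]) (norm_nonneg _)

lemma norm_pd_snd_le (z : PDPoint d m) : ‖z.snd‖ ≤ ‖z‖ :=
  le_of_sq_le_sq (by nlinarith [norm_sq_eq_fst_snd z, sq_nonneg ‖z.fst‖]) (norm_nonneg _)

lemma pdPoint_sub_left (x x' : EuclideanSpace ℝ (Fin d)) (y : EuclideanSpace ℝ (Fin m)) :
    pdPoint x y - pdPoint x' y = pdPoint (x - x') 0 := by
  rw [← sub_self y]; rfl

lemma pdPoint_sub_right (x : EuclideanSpace ℝ (Fin d)) (y y' : EuclideanSpace ℝ (Fin m)) :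
    pdPoint x y - pdPoint x y' = pdPoint 0 (y - y') := by
  rw [← sub_self x]; rfl

lemma norm_pdPoint_left (x : EuclideanSpace ℝ (Fin d)) :
    ‖pdPoint x (0 : EuclideanSpace ℝ (Fin m))‖ = ‖x‖ := by
  rw [← sq_eq_sq₀ (norm_nonneg _) (norm_nonneg _), norm_sq_pdPoint]; simp

lemma norm_pdPoint_right (y : EuclideanSpace ℝ (Fin m)) :
    ‖pdPoint (0 : EuclideanSpace ℝ (Fin d)) y‖ = ‖y‖ := by
  rw [← sq_eq_sq₀ (norm_nonneg _) (norm_nonneg _), norm_sq_pdPoint]; simp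

lemma inner_pdPoint_left (z : PDPoint d m) (x : EuclideanSpace ℝ (Fin d)) :
    inner ℝ z (pdPoint x 0) = inner ℝ z.fst x := by
  simp [pdPoint, WithLp.prod_inner_apply]

lemma inner_pdPoint_right (z : PDPoint d m) (y : EuclideanSpace ℝ (Fin m)) :
    inner ℝ z (pdPoint 0 y) = inner ℝ z.snd y := by
  simp [pdPoint, WithLp.prod_inner_apply]

lemma continuous_pdPoint :
    Continuous fun p : EuclideanSpace ℝ (Fin d) × EuclideanSpace ℝ (Fin m) => pdPoint p.1 p.2 :=
  WithLp.prod_continuous_toLp 2 _ _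

end PrimalDualSpace

/-! ### Smooth functions that are strongly concave in the second variable -/

section Smooth

variable {E : Type*} [NormedAddCommGroup E] [InnerProductSpace ℝ E] [CompleteSpace E]

/-- A function with an `L`-Lipschitz gradient is within `L ‖h‖²` of its linearization. -/
lemma abs_sub_sub_inner_gradient_le {F : E → ℝ} {L : ℝ} (hd : Differentiable ℝ F)
    (hl : ∀ z z', ‖gradient F z - gradient F z'‖ ≤ L * ‖z - z'‖) (hL : 0 ≤ L) (z z' : E) :
    |F z' - F z - inner ℝ (gradient F z) (z' - z)| ≤ L * ‖z' - z‖ ^ 2 := by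
  -- Mean value inequality for `F` minus its linear part on the ball centred at `z` through `z'`.
  -- The constant `L` in place of the sharp `L / 2` only affects absolute constants.
  have key := (convex_closedBall z ‖z' - z‖).norm_image_sub_le_of_norm_fderiv_le'
    (f := F) (C := L * ‖z' - z‖) (φ := fderiv ℝ F z) (x := z) (y := z') (𝕜 := ℝ)
    (fun w _ => hd w) ?_ (by simp) (by simp [dist_eq_norm])
  · rw [inner_gradient_left, ← Real.norm_eq_abs]
    calc _ ≤ _ := key
      _ = _ := by ring
  · intro w hw
    rw [← toDual_gradient, ← toDual_gradient, ← map_sub, LinearIsometryEquiv.norm_map]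
    refine (hl w z).trans (mul_le_mul_of_nonneg_left ?_ hL)
    simpa [dist_eq_norm] using hw

/-- Let `t` tend to `0` from the right. This removes the second-order term left after dividing a
concavity inequality by `t`. -/
lemma le_of_forall_small_mul {a b c : ℝ} (h : ∀ t : ℝ, 0 < t → t < 1 → a ≤ b + t * c) :
    a ≤ b := by
  have ht : Filter.Tendsto (fun t : ℝ => b + t * c) (nhdsWithin 0 (Set.Ioi 0)) (nhds b) := by
    have : Continuous fun t : ℝ => b + t * c := by fun_prop
    simpa using (this.tendsto 0).mono_left nhdsWithin_le_nhds
  refine ge_of_tendsto ht ?_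
  filter_upwards [Ioo_mem_nhdsGT (zero_lt_one' ℝ)] with t ht
  exact h t ht.1 ht.2

/-- The hypotheses on the averaged objective. -/
structure IsSmoothStronglyConcave {d m : ℕ} (L μ : ℝ) (F : PDPoint d m → ℝ) : Prop where
  differentiable : Differentiable ℝ F
  gradient_lipschitz : ∀ z z', ‖gradient F z - gradient F z'‖ ≤ L * ‖z - z'‖
  strongConcave : ∀ x, StrongConcaveOn Set.univ μ fun y => F (pdPoint x y)

namespace IsSmoothStronglyConcave

variable {d m : ℕ} {L μ : ℝ} {F : PDPoint d m → ℝ}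

lemma abs_sub_sub_fst (h : IsSmoothStronglyConcave L μ F) (hL : 0 ≤ L)
    (x x' : EuclideanSpace ℝ (Fin d)) (y : EuclideanSpace ℝ (Fin m)) :
    |F (pdPoint x' y) - F (pdPoint x y) - inner ℝ (gradient F (pdPoint x y)).fst (x' - x)|
      ≤ L * ‖x' - x‖ ^ 2 := by
  have := abs_sub_sub_inner_gradient_le h.differentiable h.gradient_lipschitz hL
    (pdPoint x y) (pdPoint x' y)
  rwa [pdPoint_sub_left, inner_pdPoint_left, norm_pdPoint_left] at this

lemma abs_sub_sub_snd (h : IsSmoothStronglyConcave L μ F) (hL : 0 ≤ L)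
    (x : EuclideanSpace ℝ (Fin d)) (y y' : EuclideanSpace ℝ (Fin m)) :
    |F (pdPoint x y') - F (pdPoint x y) - inner ℝ (gradient F (pdPoint x y)).snd (y' - y)|
      ≤ L * ‖y' - y‖ ^ 2 := by
  have := abs_sub_sub_inner_gradient_le h.differentiable h.gradient_lipschitz hL
    (pdPoint x y) (pdPoint x y')
  rwa [pdPoint_sub_right, inner_pdPoint_right, norm_pdPoint_right] at this

/-- Strong concavity at the point `t y' + (1 - t) y`, compared with the linearization there, has a
common factor `t`; cancel it and let `t → 0`. -/
lemma first_order (h : IsSmoothStronglyConcave L μ F) (hL : 0 ≤ L)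
    (x : EuclideanSpace ℝ (Fin d)) (y y' : EuclideanSpace ℝ (Fin m)) :
    F (pdPoint x y') ≤ F (pdPoint x y) + inner ℝ (gradient F (pdPoint x y)).snd (y' - y)
      - μ / 2 * ‖y' - y‖ ^ 2 := by
  have key : F (pdPoint x y') - F (pdPoint x y) + μ / 2 * ‖y' - y‖ ^ 2
      ≤ inner ℝ (gradient F (pdPoint x y)).snd (y' - y) := by
    refine le_of_forall_small_mul (c := L * ‖y' - y‖ ^ 2 + μ / 2 * ‖y' - y‖ ^ 2) fun t h0 h1 => ?_
    have hc := (h.strongConcave x).2 (Set.mem_univ y') (Set.mem_univ y) h0.le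
      (sub_nonneg.2 h1.le) (by ring)
    have hq := (abs_le.1 (h.abs_sub_sub_snd hL x y (t • y' + (1 - t) • y))).2
    have e : t • y' + (1 - t) • y - y = t • (y' - y) := by module
    rw [e, inner_smul_right, norm_smul, mul_pow, Real.norm_eq_abs, sq_abs] at hq
    simp only [smul_eq_mul] at hc
    have : t * (F (pdPoint x y') - F (pdPoint x y) + μ / 2 * ‖y' - y‖ ^ 2) ≤
        t * (inner ℝ (gradient F (pdPoint x y)).snd (y' - y) +
          t * (L * ‖y' - y‖ ^ 2 + μ / 2 * ‖y' - y‖ ^ 2)) := by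
      linarith
    exact le_of_mul_le_mul_left this h0
  linarith

lemma inner_gradient_snd_sub_le (h : IsSmoothStronglyConcave L μ F) (hL : 0 ≤ L)
    (x : EuclideanSpace ℝ (Fin d)) (y y' : EuclideanSpace ℝ (Fin m)) :
    inner ℝ ((gradient F (pdPoint x y)).snd - (gradient F (pdPoint x y')).snd) (y - y')
      ≤ -(μ * ‖y - y'‖ ^ 2) := by
  have h1 := h.first_order hL x y y'
  have h2 := h.first_order hL x y' y
  rw [← neg_sub y y', inner_neg_right, norm_neg] at h1
  rw [inner_sub_left]
  linarith

/-- Strong monotonicity of the `y`-gradient combined with Cauchy-Schwarz. It yields both `μ ≤ L` and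
the Lipschitz continuity of the maximizer. -/
lemma mul_norm_sub_le (h : IsSmoothStronglyConcave L μ F) (hL : 0 ≤ L)
    (x : EuclideanSpace ℝ (Fin d)) (y y' : EuclideanSpace ℝ (Fin m)) :
    μ * ‖y - y'‖ ≤ ‖(gradient F (pdPoint x y)).snd - (gradient F (pdPoint x y')).snd‖ := by
  have h1 := h.inner_gradient_snd_sub_le hL x y y'
  have h2 := neg_le_of_abs_le (abs_real_inner_le_norm
    ((gradient F (pdPoint x y)).snd - (gradient F (pdPoint x y')).snd) (y - y'))
  rcases (norm_nonneg (y - y')).eq_or_lt with h0 | h0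
  · rw [← h0]; simp
  · refine le_of_mul_le_mul_right ?_ h0
    linarith

lemma norm_gradient_snd_sub_le (h : IsSmoothStronglyConcave L μ F)
    (x : EuclideanSpace ℝ (Fin d)) (y y' : EuclideanSpace ℝ (Fin m)) :
    ‖(gradient F (pdPoint x y)).snd - (gradient F (pdPoint x y')).snd‖ ≤ L * ‖y - y'‖ := by
  have := h.gradient_lipschitz (pdPoint x y) (pdPoint x y')
  rw [pdPoint_sub_right, norm_pdPoint_right] at this
  exact (norm_pd_snd_le (_ - _)).trans this

lemma norm_gradient_fst_sub_le (h : IsSmoothStronglyConcave L μ F)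
    (x : EuclideanSpace ℝ (Fin d)) (y y' : EuclideanSpace ℝ (Fin m)) :
    ‖(gradient F (pdPoint x y)).fst - (gradient F (pdPoint x y')).fst‖ ≤ L * ‖y - y'‖ := by
  have := h.gradient_lipschitz (pdPoint x y) (pdPoint x y')
  rw [pdPoint_sub_right, norm_pdPoint_right] at this
  exact (norm_pd_fst_le (_ - _)).trans this

/-- Sandwiches a gradient difference between `μ ‖y‖` and `L ‖y‖`; a nonzero `y` exists because `0 <
m`. -/
lemma le_smoothness (h : IsSmoothStronglyConcave L μ F) (hL : 0 ≤ L) (hm : 0 < m) : μ ≤ L := by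
  have : Nonempty (Fin m) := ⟨⟨0, hm⟩⟩
  obtain ⟨y, hy⟩ := exists_ne (0 : EuclideanSpace ℝ (Fin m))
  have hy' : 0 < ‖y - 0‖ := by simpa using hy
  exact le_of_mul_le_mul_right
    ((h.mul_norm_sub_le hL 0 y 0).trans (h.norm_gradient_snd_sub_le 0 y 0)) hy'

lemma continuous (h : IsSmoothStronglyConcave L μ F) : Continuous F :=
  continuous_iff_continuousAt.2 fun z => (h.differentiable z).hasGradientAt.continuousAt

/-- Outside the ball of radius `2 ‖g‖ / μ` the quadratic term of `first_order` outweighs the linear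
one, so values there lie below `F (x, 0)`; the maximum over the compact ball is therefore global. -/
lemma exists_isMax (h : IsSmoothStronglyConcave L μ F) (hL : 0 ≤ L) (hμ : 0 < μ)
    (x : EuclideanSpace ℝ (Fin d)) : ∃ y, ∀ y', F (pdPoint x y') ≤ F (pdPoint x y) := by
  set g := (gradient F (pdPoint x (0 : EuclideanSpace ℝ (Fin m)))).snd
  have hc : Continuous fun y : EuclideanSpace ℝ (Fin m) => F (pdPoint x y) :=
    h.continuous.comp (continuous_pdPoint.comp (continuous_const.prodMk continuous_id))
  obtain ⟨y, -, hy⟩ := (isCompact_closedBall (0 : EuclideanSpace ℝ (Fin m))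
    (2 * ‖g‖ / μ)).exists_isMaxOn ⟨0, by simp; positivity⟩ hc.continuousOn
  refine ⟨y, fun y' => ?_⟩
  by_cases hy' : y' ∈ Metric.closedBall (0 : EuclideanSpace ℝ (Fin m)) (2 * ‖g‖ / μ)
  · exact hy hy'
  · have h0 : F (pdPoint x 0) ≤ F (pdPoint x y) :=
      hy (show (0 : EuclideanSpace ℝ (Fin m)) ∈ _ by simp; positivity)
    have h1 := h.first_order hL x 0 y'
    have h2 := real_inner_le_norm g (y' - 0)
    rw [sub_zero] at h1 h2
    have h3 : 2 * ‖g‖ < ‖y'‖ * μ := by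
      simpa [div_lt_iff₀ hμ] using hy'
    nlinarith [norm_nonneg y']

/-- A trial ascent step of size `1 / (2 L)` would raise the value by at least `‖g‖² / (4 L)`, which
maximality forbids unless `g = 0`. -/
lemma gradient_snd_eq_zero (h : IsSmoothStronglyConcave L μ F) (hL : 0 < L)
    {x : EuclideanSpace ℝ (Fin d)} {y : EuclideanSpace ℝ (Fin m)}
    (hy : ∀ y', F (pdPoint x y') ≤ F (pdPoint x y)) : (gradient F (pdPoint x y)).snd = 0 := by
  set g := (gradient F (pdPoint x y)).snd with hg
  have hq := (abs_le.1 (h.abs_sub_sub_snd hL.le x y (y + (2 * L)⁻¹ • g))).1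
  rw [add_sub_cancel_left, inner_smul_right, norm_smul, mul_pow, ← hg,
    real_inner_self_eq_norm_sq, Real.norm_eq_abs, sq_abs] at hq
  have h1 := hy (y + (2 * L)⁻¹ • g)
  have h2 : (2 * L)⁻¹ * ‖g‖ ^ 2 - L * ((2 * L)⁻¹ ^ 2 * ‖g‖ ^ 2) = (4 * L)⁻¹ * ‖g‖ ^ 2 := by
    field_simp; ring
  have h3 : (4 * L)⁻¹ * ‖g‖ ^ 2 ≤ 0 := by linarith
  have h4 : ‖g‖ ^ 2 ≤ 0 := nonpos_of_mul_nonpos_right h3 (by positivity)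
  simpa using h4

/-- The maximizer of `F(x, ·)` is `L / μ`-Lipschitz in `x`. -/
lemma norm_argmax_sub_le (h : IsSmoothStronglyConcave L μ F) (hL : 0 < L) (hμ : 0 < μ)
    {y : EuclideanSpace ℝ (Fin d) → EuclideanSpace ℝ (Fin m)}
    (hy : ∀ x y', F (pdPoint x y') ≤ F (pdPoint x (y x))) (x x' : EuclideanSpace ℝ (Fin d)) :
    ‖y x - y x'‖ ≤ L / μ * ‖x - x'‖ := by
  have h1 := h.mul_norm_sub_le hL.le x (y x) (y x')
  -- Both `y`-gradients vanish at their maximizers. Replacing one zero by the other leaves a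
  -- difference of gradients at the same `y`, in which only `x` varies.
  rw [h.gradient_snd_eq_zero hL (hy x), ← h.gradient_snd_eq_zero hL (hy x')] at h1
  have h2 := h.gradient_lipschitz (pdPoint x (y x')) (pdPoint x' (y x'))
  rw [pdPoint_sub_left, norm_pdPoint_left, ← norm_neg, neg_sub] at h2
  have h3 := h1.trans ((norm_pd_snd_le (gradient F (pdPoint x' (y x')) -
    gradient F (pdPoint x (y x')))).trans h2)
  rw [div_mul_eq_mul_div, le_div_iff₀ hμ]
  linarith

/-- One exact gradient ascent step in `y` contracts towards the maximizer. -/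
lemma norm_ascent_sub_sq_le (h : IsSmoothStronglyConcave L μ F) (hL : 0 < L)
    {η : ℝ} (hη : 0 ≤ η) (hη' : L ^ 2 * η ≤ μ)
    {x : EuclideanSpace ℝ (Fin d)} {ys : EuclideanSpace ℝ (Fin m)}
    (hy : ∀ y', F (pdPoint x y') ≤ F (pdPoint x ys)) (y : EuclideanSpace ℝ (Fin m)) :
    ‖y + η • (gradient F (pdPoint x y)).snd - ys‖ ^ 2 ≤ (1 - μ * η) * ‖y - ys‖ ^ 2 := by
  have h1 := h.inner_gradient_snd_sub_le hL.le x y ys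
  have h2 := h.norm_gradient_snd_sub_le x y ys
  rw [h.gradient_snd_eq_zero hL hy, sub_zero] at h1 h2
  set g := (gradient F (pdPoint x y)).snd
  have e : y + η • g - ys = (y - ys) + η • g := by abel
  rw [e, norm_add_sq_real, inner_smul_right, norm_smul, Real.norm_eq_abs, abs_of_nonneg hη,
    real_inner_comm]
  have h3 : ‖g‖ ^ 2 ≤ L ^ 2 * ‖y - ys‖ ^ 2 := by
    rw [← mul_pow]; exact pow_le_pow_left₀ (norm_nonneg _) h2 2
  -- Here `L² η ≤ μ` enters: the quadratic term uses up half of the cross term `-2 η μ ‖y - ys‖²`.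
  have h4 : (η * ‖g‖) ^ 2 ≤ η * (μ * ‖y - ys‖ ^ 2) := by
    calc (η * ‖g‖) ^ 2 = η * (η * ‖g‖ ^ 2) := by ring
      _ ≤ η * (η * (L ^ 2 * ‖y - ys‖ ^ 2)) := by gcongr
      _ = η * ((L ^ 2 * η) * ‖y - ys‖ ^ 2) := by ring
      _ ≤ _ := by gcongr
  nlinarith [mul_le_mul_of_nonneg_left h1 hη]

/-- Optimality sandwiches the increment: freezing `y` at `y x` bounds it from below, freezing it at
`y x'` from above. The upper bound involves the gradient at `y x'`, and moving that to `y x` costs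
`L (L / μ) ‖x' - x‖²`. No differentiability of the maximizer is needed. -/
lemma argmax_value_le (h : IsSmoothStronglyConcave L μ F) (hL : 0 < L) (hμ : 0 < μ) (hμL : μ ≤ L)
    {y : EuclideanSpace ℝ (Fin d) → EuclideanSpace ℝ (Fin m)}
    (hy : ∀ x y', F (pdPoint x y') ≤ F (pdPoint x (y x))) (x x' : EuclideanSpace ℝ (Fin d)) :
    |F (pdPoint x' (y x')) - F (pdPoint x (y x)) -
      inner ℝ (gradient F (pdPoint x (y x))).fst (x' - x)| ≤ 2 * L * (L / μ) * ‖x' - x‖ ^ 2 := by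
  have hκ : 1 ≤ L / μ := (one_le_div hμ).2 hμL
  have h1 := (abs_le.1 (h.abs_sub_sub_fst hL.le x x' (y x'))).2
  have h2 := (abs_le.1 (h.abs_sub_sub_fst hL.le x x' (y x))).1
  have h3 := hy x' (y x)
  have h4 := hy x (y x')
  have h5 := (real_inner_le_norm ((gradient F (pdPoint x (y x'))).fst -
    (gradient F (pdPoint x (y x))).fst) (x' - x)).trans (mul_le_mul_of_nonneg_right
      ((h.norm_gradient_fst_sub_le x (y x') (y x)).trans
      (mul_le_mul_of_nonneg_left (h.norm_argmax_sub_le hL hμ hy x' x) hL.le)) (norm_nonneg _))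
  rw [inner_sub_left] at h5
  have h6 : L * ‖x' - x‖ ^ 2 ≤ L * (L / μ) * ‖x' - x‖ ^ 2 := by
    rw [mul_assoc]
    gcongr
    nlinarith [sq_nonneg ‖x' - x‖]
  rw [abs_le]
  constructor <;> nlinarith

end IsSmoothStronglyConcave

lemma hasGradientAt_of_abs_sub_le {Φ : E → ℝ} {g x : E} {C : ℝ}
    (h : ∀ x', |Φ x' - Φ x - inner ℝ g (x' - x)| ≤ C * ‖x' - x‖ ^ 2) : HasGradientAt Φ g x := by
  rw [hasGradientAt_iff_isLittleO]
  refine Asymptotics.IsBigO.trans_isLittleO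
    (g := fun x' => ‖x' - x‖ ^ 2) (Asymptotics.IsBigO.of_bound C ?_) ?_
  · filter_upwards with x'
    simpa using h x'
  · have : Filter.Tendsto (fun x' => x' - x) (nhds x) (nhds 0) :=
      (continuous_sub_right x).tendsto' _ _ (sub_self x)
    simpa [Function.comp_def] using
      (Asymptotics.isLittleO_norm_pow_id (E' := E) one_lt_two).comp_tendsto this

end Smooth

/-! ### The averaged objective, the primal function and the best response -/

section Problem

variable {M d m : ℕ} {L μ : ℝ} {f : Fin M → PDPoint d m → ℝ}

/-- The averaged objective as a function of `z = (x, y)`. -/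
noncomputable def meanObj (f : Fin M → PDPoint d m → ℝ) (z : PDPoint d m) : ℝ :=
  (M : ℝ)⁻¹ * ∑ i, f i z

lemma norm_rowAvg_sub_sq_le (u v : Fin M → PDPoint d m) :
    ‖rowAvg u - rowAvg v‖ ^ 2 ≤ (M : ℝ)⁻¹ * ∑ i, ‖u i - v i‖ ^ 2 := by
  rw [rowAvg, rowAvg, ← smul_sub, ← Finset.sum_sub_distrib, norm_smul, mul_pow]
  rcases Nat.eq_zero_or_pos M with rfl | hM
  · simp
  have hM' : (0 : ℝ) < M := by exact_mod_cast hM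
  have h1 : ‖∑ i, (u i - v i)‖ ^ 2 ≤ M * ∑ i, ‖u i - v i‖ ^ 2 := by
    refine (pow_le_pow_left₀ (norm_nonneg _) (norm_sum_le _ _) 2).trans ?_
    simpa using sq_sum_le_card_mul_sum_sq (s := Finset.univ) (f := fun i => ‖u i - v i‖)
  rw [Real.norm_eq_abs, sq_abs]
  calc (M : ℝ)⁻¹ ^ 2 * ‖∑ i, (u i - v i)‖ ^ 2 ≤ (M : ℝ)⁻¹ ^ 2 * (M * ∑ i, ‖u i - v i‖ ^ 2) := by
        gcongr
    _ = _ := by field_simp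

namespace IsNCSCProblem

lemma gradient_meanObj (h : IsNCSCProblem L μ f) (z : PDPoint d m) :
    gradient (meanObj f) z = rowAvg fun i => gradient (f i) z := by
  apply HasGradientAt.gradient
  rw [hasGradientAt_iff_hasFDerivAt]
  have := (HasFDerivAt.fun_sum (u := Finset.univ) fun i _ =>
    (h.differentiable i z).hasFDerivAt).const_mul (M : ℝ)⁻¹
  convert! this using 1
  rw [rowAvg, map_smul, map_sum]
  simp only [toDual_gradient]

lemma isSmoothStronglyConcave (h : IsNCSCProblem L μ f) (hM : 0 < M) (hL : 0 ≤ L) :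
    IsSmoothStronglyConcave L μ (meanObj f) where
  differentiable := by
    unfold meanObj
    exact (Differentiable.fun_sum fun i _ => h.differentiable i).const_mul _
  gradient_lipschitz z z' := by
    have hM' : (0 : ℝ) < M := by exact_mod_cast hM
    rw [h.gradient_meanObj, h.gradient_meanObj]
    refine le_of_sq_le_sq ((norm_rowAvg_sub_sq_le _ _).trans ?_) (by positivity)
    calc (M : ℝ)⁻¹ * ∑ i, ‖gradient (f i) z - gradient (f i) z'‖ ^ 2
        ≤ (M : ℝ)⁻¹ * ∑ _i : Fin M, (L * ‖z - z'‖) ^ 2 := by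
          gcongr with i; exact h.gradient_lipschitz i z z'
      _ = _ := by simp; field_simp
  strongConcave x := by
    have hM' : (0 : ℝ) < M := by exact_mod_cast hM
    refine ⟨convex_univ, fun y _ y' _ a b ha hb hab => ?_⟩
    have := Finset.sum_le_sum fun i (_ : i ∈ Finset.univ) =>
      (h.strongConcave i x).2 (Set.mem_univ y) (Set.mem_univ y') ha hb hab
    simp only [smul_eq_mul, Finset.sum_add_distrib, ← Finset.mul_sum, Finset.sum_const,
      Finset.card_univ, Fintype.card_fin, nsmul_eq_mul] at this
    have := mul_le_mul_of_nonneg_left this (inv_nonneg.2 hM'.le)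
    simp only [meanObj, smul_eq_mul]
    refine le_trans (le_of_eq ?_) this
    field_simp

lemma le_bestResponse (h : IsNCSCProblem L μ f) (hM : 0 < M) (hL : 0 ≤ L) (hμ : 0 < μ)
    (x : EuclideanSpace ℝ (Fin d)) (y' : EuclideanSpace ℝ (Fin m)) :
    meanObj f (pdPoint x y') ≤ meanObj f (pdPoint x (bestResponse f x)) :=
  Classical.epsilon_spec (p := fun y => ∀ y', globalObj f x y' ≤ globalObj f x y)
    ((h.isSmoothStronglyConcave hM hL).exists_isMax hL hμ x) y'

lemma primalFun_eq (h : IsNCSCProblem L μ f) (hM : 0 < M) (hL : 0 ≤ L) (hμ : 0 < μ)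
    (x : EuclideanSpace ℝ (Fin d)) : primalFun f x = meanObj f (pdPoint x (bestResponse f x)) :=
  le_antisymm (ciSup_le fun y => h.le_bestResponse hM hL hμ x y)
    (le_ciSup (f := fun y => globalObj f x y)
      ⟨_, Set.forall_mem_range.2 fun y => h.le_bestResponse hM hL hμ x y⟩ (bestResponse f x))

lemma norm_bestResponse_sub_le (h : IsNCSCProblem L μ f) (hM : 0 < M) (hL : 0 < L) (hμ : 0 < μ)
    (x x' : EuclideanSpace ℝ (Fin d)) :
    ‖bestResponse f x - bestResponse f x'‖ ≤ L / μ * ‖x - x'‖ :=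
  (h.isSmoothStronglyConcave hM hL.le).norm_argmax_sub_le hL hμ
    (h.le_bestResponse hM hL.le hμ) x x'

lemma smoothness_ge (h : IsNCSCProblem L μ f) (hM : 0 < M) (hm : 0 < m) (hL : 0 ≤ L) : μ ≤ L :=
  (h.isSmoothStronglyConcave hM hL).le_smoothness hL hm

lemma abs_primalFun_sub_le (h : IsNCSCProblem L μ f) (hM : 0 < M) (hm : 0 < m) (hL : 0 < L)
    (hμ : 0 < μ) (x x' : EuclideanSpace ℝ (Fin d)) :
    |primalFun f x' - primalFun f x -
      inner ℝ (gradient (meanObj f) (pdPoint x (bestResponse f x))).fst (x' - x)|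
      ≤ 2 * L * (L / μ) * ‖x' - x‖ ^ 2 := by
  rw [h.primalFun_eq hM hL.le hμ, h.primalFun_eq hM hL.le hμ]
  exact (h.isSmoothStronglyConcave hM hL.le).argmax_value_le hL hμ
    (h.smoothness_ge hM hm hL.le) (h.le_bestResponse hM hL.le hμ) x x'

/-- Danskin's theorem: `∇Φ(x) = ∇ₓ f(x, y*(x))`. -/
lemma gradient_primalFun (h : IsNCSCProblem L μ f) (hM : 0 < M) (hm : 0 < m) (hL : 0 < L)
    (hμ : 0 < μ) (x : EuclideanSpace ℝ (Fin d)) :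
    gradient (primalFun f) x = (gradient (meanObj f) (pdPoint x (bestResponse f x))).fst :=
  (hasGradientAt_of_abs_sub_le (h.abs_primalFun_sub_le hM hm hL hμ x)).gradient

end IsNCSCProblem

end Problem

/-! ### Averaging and mixing of the rows -/

section Mixing

lemma norm_add_sq_le_two_mul {E : Type*} [SeminormedAddCommGroup E] (a b : E) :
    ‖a + b‖ ^ 2 ≤ 2 * (‖a‖ ^ 2 + ‖b‖ ^ 2) :=
  (pow_le_pow_left₀ (norm_nonneg _) (norm_add_le a b) 2).trans add_sq_le

lemma add_sq_le_weighted {s : ℝ} (hs : 0 < s) (a b : ℝ) :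
    (a + b) ^ 2 ≤ (1 + s) * a ^ 2 + (1 + 1 / s) * b ^ 2 := by
  have h : (1 + s) * a ^ 2 + (1 + 1 / s) * b ^ 2 - (a + b) ^ 2 = (s * a - b) ^ 2 / s := by
    field_simp; ring
  have : 0 ≤ (s * a - b) ^ 2 / s := by positivity
  linarith

lemma norm_add_sq_le_weighted {E : Type*} [SeminormedAddCommGroup E] {s : ℝ} (hs : 0 < s)
    (a b : E) : ‖a + b‖ ^ 2 ≤ (1 + s) * ‖a‖ ^ 2 + (1 + 1 / s) * ‖b‖ ^ 2 :=
  (pow_le_pow_left₀ (norm_nonneg _) (norm_add_le a b) 2).trans (add_sq_le_weighted hs _ _)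

variable {M d m : ℕ}

/-- `‖U‖_F² = ∑ i, ‖u_i‖²`. -/
noncomputable def frobSq (u : Fin M → PDPoint d m) : ℝ := ∑ i, ‖u i‖ ^ 2

/-- The product `W U` of a matrix with an array of rows. -/
noncomputable def mixRows (W : Matrix (Fin M) (Fin M) ℝ) (u : Fin M → PDPoint d m) (i : Fin M) :
    PDPoint d m := ∑ j, W i j • u j

lemma frobSq_nonneg (u : Fin M → PDPoint d m) : 0 ≤ frobSq u :=
  Finset.sum_nonneg fun _ _ => sq_nonneg _

lemma perpSq_nonneg (u : Fin M → PDPoint d m) : 0 ≤ perpSq u :=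
  Finset.sum_nonneg fun _ _ => sq_nonneg _

lemma perpSq_eq_frobSq (u : Fin M → PDPoint d m) :
    perpSq u = frobSq fun i => u i - rowAvg u := rfl

lemma sum_eq_smul_rowAvg (hM : 0 < M) (u : Fin M → PDPoint d m) :
    ∑ i, u i = (M : ℝ) • rowAvg u := by
  have hM' : (M : ℝ) ≠ 0 := by exact_mod_cast hM.ne'
  rw [rowAvg, smul_inv_smul₀ hM']

lemma rowAvg_add (u v : Fin M → PDPoint d m) :
    rowAvg (fun i => u i + v i) = rowAvg u + rowAvg v := by
  simp [rowAvg, Finset.sum_add_distrib]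

lemma rowAvg_sub (u v : Fin M → PDPoint d m) :
    rowAvg (fun i => u i - v i) = rowAvg u - rowAvg v := by
  simp [rowAvg, Finset.sum_sub_distrib, smul_sub]

lemma rowAvg_map (S : PDPoint d m →ₗ[ℝ] PDPoint d m) (u : Fin M → PDPoint d m) :
    rowAvg (fun i => S (u i)) = S (rowAvg u) := by
  simp [rowAvg]

lemma sum_sub_rowAvg (hM : 0 < M) (u : Fin M → PDPoint d m) : ∑ i, (u i - rowAvg u) = 0 := by
  rw [Finset.sum_sub_distrib, sum_eq_smul_rowAvg hM]
  simp [Nat.cast_smul_eq_nsmul]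

/-- Pythagoras: the centred rows are orthogonal to the constant ones. -/
lemma perpSq_le_frobSq (hM : 0 < M) (u : Fin M → PDPoint d m) : perpSq u ≤ frobSq u := by
  have h : frobSq u = perpSq u + M * ‖rowAvg u‖ ^ 2 := by
    have h1 : ∀ i, ‖u i‖ ^ 2 = ‖u i - rowAvg u‖ ^ 2 +
        2 * inner ℝ (u i - rowAvg u) (rowAvg u) + ‖rowAvg u‖ ^ 2 := fun i => by
      rw [← norm_add_sq_real, sub_add_cancel]
    simp only [frobSq, perpSq, h1, Finset.sum_add_distrib, ← Finset.mul_sum, ← sum_inner,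
      sum_sub_rowAvg hM]
    simp
  have : 0 ≤ (M : ℝ) * ‖rowAvg u‖ ^ 2 := by positivity
  linarith

/-- In an orthonormal basis of the point space the matrix acts on each coordinate column separately,
so the operator norm bound applies column by column. -/
lemma frobSq_mixRows_le (A : Matrix (Fin M) (Fin M) ℝ) (u : Fin M → PDPoint d m) :
    frobSq (mixRows A u) ≤
      ‖Matrix.toEuclideanCLM (n := Fin M) (𝕜 := ℝ) A‖ ^ 2 * frobSq u := by
  have hb : ∀ z : PDPoint d m, ‖z‖ ^ 2 = ∑ k, (stdOrthonormalBasis ℝ (PDPoint d m)).repr z k ^ 2 :=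
    fun z => by
      rw [← (stdOrthonormalBasis ℝ (PDPoint d m)).repr.norm_map z, EuclideanSpace.norm_sq_eq]
      simp
  simp only [frobSq, hb]
  rw [Finset.sum_comm, Finset.sum_comm (γ := Fin M), Finset.mul_sum]
  refine Finset.sum_le_sum fun k _ => ?_
  set w : EuclideanSpace ℝ (Fin M) :=
    WithLp.toLp 2 fun j => (stdOrthonormalBasis ℝ (PDPoint d m)).repr (u j) k
  have h1 := pow_le_pow_left₀ (norm_nonneg _)
    ((Matrix.toEuclideanCLM (n := Fin M) (𝕜 := ℝ) A).le_opNorm w) 2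
  rw [mul_pow, EuclideanSpace.norm_sq_eq, EuclideanSpace.norm_sq_eq] at h1
  simpa [w, Matrix.ofLp_toEuclideanCLM, Matrix.mulVec, dotProduct, mixRows] using h1

lemma mixingRho_nonneg (W : Matrix (Fin M) (Fin M) ℝ) : 0 ≤ mixingRho W := norm_nonneg _

namespace IsMixingMatrix

variable {Edge : Fin M → Fin M → Prop} {W : Matrix (Fin M) (Fin M) ℝ}

lemma rowAvg_mixRows (h : IsMixingMatrix Edge W) (u : Fin M → PDPoint d m) :
    rowAvg (mixRows W u) = rowAvg u := by
  simp only [rowAvg, mixRows]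
  rw [Finset.sum_comm]
  simp [← Finset.sum_smul, h.col_sum]

/-- The left side is `W - Π` applied to the centred rows: `Π` annihilates them, and `W` fixes
constant rows because its row sums are `1`. -/
lemma frobSq_mixRows_sub_le (h : IsMixingMatrix Edge W) (hM : 0 < M) (u : Fin M → PDPoint d m) :
    frobSq (fun i => mixRows W u i - rowAvg u) ≤ mixingRho W ^ 2 * perpSq u := by
  refine le_trans (le_of_eq ?_) (frobSq_mixRows_le
    (W - Matrix.of fun _ _ => (M : ℝ)⁻¹) (fun i => u i - rowAvg u))
  congr 1
  funext i
  have h0 : ∑ j, (M : ℝ)⁻¹ • (u j - rowAvg u) = 0 := by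
    rw [← Finset.smul_sum, sum_sub_rowAvg hM, smul_zero]
  symm
  calc ∑ j, (W i j - (M : ℝ)⁻¹) • (u j - rowAvg u)
      = ∑ j, (W i j • u j - W i j • rowAvg u - (M : ℝ)⁻¹ • (u j - rowAvg u)) :=
        Finset.sum_congr rfl fun j _ => by rw [sub_smul, smul_sub]
    _ = mixRows W u i - rowAvg u := by
      rw [Finset.sum_sub_distrib, h0, sub_zero, Finset.sum_sub_distrib, ← Finset.sum_smul,
        h.row_sum, one_smul, mixRows]

/-- Contraction of the consensus error under mixing with a perturbation. -/
lemma perpSq_mixRows_add_le (h : IsMixingMatrix Edge W) (hM : 0 < M) (u b : Fin M → PDPoint d m) :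
    perpSq (fun i => mixRows W u i + b i) ≤
      mixingRho W * perpSq u + 2 / (1 - mixingRho W) * perpSq b := by
  have hρ0 := mixingRho_nonneg W
  have hr : 0 < 1 - mixingRho W := sub_pos.2 h.rho_lt_one
  set r := 1 - mixingRho W with hr'
  have hρ : mixingRho W = 1 - r := by rw [hr']; ring
  -- Young's inequality with parameter `r = 1 - ρ`: then `(1 + r) ρ² = (1 - r²) ρ ≤ ρ`, and `1 + 1 /
  -- r ≤ 2 / r`.
  have h1 : perpSq (fun i => mixRows W u i + b i) ≤
      (1 + r) * frobSq (fun i => mixRows W u i - rowAvg u) + (1 + 1 / r) * perpSq b := by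
    rw [perpSq, rowAvg_add, h.rowAvg_mixRows, frobSq, perpSq, Finset.mul_sum, Finset.mul_sum,
      ← Finset.sum_add_distrib]
    refine Finset.sum_le_sum fun i _ => ?_
    rw [add_sub_add_comm]
    exact norm_add_sq_le_weighted hr _ _
  have h2 := h.frobSq_mixRows_sub_le hM u
  have h3 := perpSq_nonneg u
  have h4 := perpSq_nonneg b
  have h5 : (1 + r) * frobSq (fun i => mixRows W u i - rowAvg u) ≤ mixingRho W * perpSq u := by
    calc (1 + r) * frobSq (fun i => mixRows W u i - rowAvg u)
        ≤ (1 + r) * (mixingRho W ^ 2 * perpSq u) := by gcongr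
      _ = (1 - r ^ 2) * (mixingRho W * perpSq u) := by rw [hρ]; ring
      _ ≤ 1 * (mixingRho W * perpSq u) := by
        gcongr
        nlinarith [sq_nonneg r]
      _ = _ := one_mul _
  have h6 : (1 + 1 / r) * perpSq b ≤ 2 / r * perpSq b := by
    gcongr
    rw [show (2 : ℝ) / r = 1 / r + 1 / r by ring]
    gcongr
    rw [le_div_iff₀ hr]
    linarith
  linarith

end IsMixingMatrix

end Mixing

/-! ### One iteration of the algorithm -/

section Step

variable {M d m : ℕ}

/-- The scaled descent-ascent direction `(-ηx z_x, ηy z_y)`. -/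
noncomputable def descentAscent (ηx ηy : ℝ) : PDPoint d m →ₗ[ℝ] PDPoint d m where
  toFun z := pdPoint (-(ηx • z.fst)) (ηy • z.snd)
  map_add' a b := by
    simp only [WithLp.add_fst, WithLp.add_snd, smul_add, neg_add]; rfl
  map_smul' c a := by
    simp only [WithLp.smul_fst, WithLp.smul_snd, RingHom.id_apply, ← smul_neg]
    rw [smul_comm _ c, smul_comm _ c]; rfl

lemma norm_sq_descentAscent (ηx ηy : ℝ) (z : PDPoint d m) :
    ‖descentAscent ηx ηy z‖ ^ 2 = ηx ^ 2 * ‖z.fst‖ ^ 2 + ηy ^ 2 * ‖z.snd‖ ^ 2 := by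
  simp only [descentAscent, LinearMap.coe_mk, AddHom.coe_mk]
  rw [norm_sq_pdPoint, norm_neg, norm_smul, norm_smul, mul_pow, mul_pow]
  simp

lemma norm_sq_descentAscent_le {ηx ηy : ℝ} (hx : 0 ≤ ηx) (hxy : ηx ≤ ηy) (z : PDPoint d m) :
    ‖descentAscent ηx ηy z‖ ^ 2 ≤ ηy ^ 2 * ‖z‖ ^ 2 := by
  rw [norm_sq_descentAscent, norm_sq_eq_fst_snd, mul_add]
  gcongr

variable {Edge : Fin M → Fin M → Prop} {W : Matrix (Fin M) (Fin M) ℝ} {p : DGDAParams}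

lemma dgdaNextZ_eq (W : Matrix (Fin M) (Fin M) ℝ) (p : DGDAParams) (st : DGDAState M d m) :
    dgdaNextZ W p st = fun i => mixRows W st.Z i + descentAscent p.ηx p.ηy (st.D i) := by
  funext i
  have h : mixRows W st.Z i = pdPoint (∑ j, W i j • (st.Z j).fst) (∑ j, W i j • (st.Z j).snd) := by
    rw [mixRows]
    refine (WithLp.ofLp_injective 2) (Prod.ext ?_ ?_)
    · simp [pdPoint, WithLp.ofLp_sum, Prod.fst_sum]
    · simp [pdPoint, WithLp.ofLp_sum, Prod.snd_sum]
  rw [h, dgdaNextZ, sub_eq_add_neg]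
  rfl

lemma IsMixingMatrix.rowAvg_dgdaNextZ (h : IsMixingMatrix Edge W) (st : DGDAState M d m) :
    rowAvg (dgdaNextZ W p st) = rowAvg st.Z + descentAscent p.ηx p.ηy (rowAvg st.D) := by
  rw [dgdaNextZ_eq, rowAvg_add, h.rowAvg_mixRows, rowAvg_map]

lemma perpSq_descentAscent_le {ηx ηy : ℝ} (hx : 0 ≤ ηx) (hxy : ηx ≤ ηy)
    (u : Fin M → PDPoint d m) :
    perpSq (fun i => descentAscent ηx ηy (u i)) ≤ ηy ^ 2 * perpSq u := by
  rw [perpSq, perpSq, rowAvg_map, Finset.mul_sum]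
  refine Finset.sum_le_sum fun i _ => ?_
  rw [← map_sub]
  exact norm_sq_descentAscent_le hx hxy _

lemma IsMixingMatrix.perpSq_dgdaNextZ_le (h : IsMixingMatrix Edge W) (hM : 0 < M)
    (hx : 0 ≤ p.ηx) (hxy : p.ηx ≤ p.ηy) (st : DGDAState M d m) :
    perpSq (dgdaNextZ W p st) ≤
      mixingRho W * perpSq st.Z + 2 / (1 - mixingRho W) * (p.ηy ^ 2 * perpSq st.D) := by
  have hr : 0 < 1 - mixingRho W := sub_pos.2 h.rho_lt_one
  rw [dgdaNextZ_eq]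
  refine (h.perpSq_mixRows_add_le hM _ _).trans ?_
  gcongr
  exact perpSq_descentAscent_le hx hxy _

lemma IsMixingMatrix.frobSq_dgdaNextZ_sub_le (h : IsMixingMatrix Edge W) (hM : 0 < M)
    (hx : 0 ≤ p.ηx) (hxy : p.ηx ≤ p.ηy) (st : DGDAState M d m) :
    frobSq (fun i => dgdaNextZ W p st i - st.Z i) ≤ 8 * perpSq st.Z + 4 * (p.ηy ^ 2 * perpSq st.D)
      + 4 * (M * (p.ηx ^ 2 * ‖(rowAvg st.D).fst‖ ^ 2 + p.ηy ^ 2 * ‖(rowAvg st.D).snd‖ ^ 2)) := by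
  have h1 : frobSq (fun i => dgdaNextZ W p st i - st.Z i) ≤
      4 * frobSq (fun i => mixRows W st.Z i - rowAvg st.Z) + 4 * perpSq st.Z +
      4 * perpSq (fun i => descentAscent p.ηx p.ηy (st.D i)) +
      ∑ _i : Fin M, 4 * ‖descentAscent p.ηx p.ηy (rowAvg st.D)‖ ^ 2 := by
    rw [dgdaNextZ_eq, frobSq, frobSq, perpSq, perpSq, Finset.mul_sum, Finset.mul_sum,
      Finset.mul_sum, ← Finset.sum_add_distrib, ← Finset.sum_add_distrib,
      ← Finset.sum_add_distrib, rowAvg_map]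
    refine Finset.sum_le_sum fun i _ => ?_
    -- Four contributions to the displacement: consensus deviation after and before mixing,
    -- deviation of the tracker, and the common move of the average. Only the last keeps the two
    -- step sizes apart, which the coupling with the primal descent requires.
    have e : mixRows W st.Z i + descentAscent p.ηx p.ηy (st.D i) - st.Z i =
      ((mixRows W st.Z i - rowAvg st.Z) + -(st.Z i - rowAvg st.Z)) +
      ((descentAscent p.ηx p.ηy (st.D i) - descentAscent p.ηx p.ηy (rowAvg st.D)) +
        descentAscent p.ηx p.ηy (rowAvg st.D)) := by abel
    rw [e]
    have a1 := norm_add_sq_le_two_mul ((mixRows W st.Z i - rowAvg st.Z) + -(st.Z i - rowAvg st.Z))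
      ((descentAscent p.ηx p.ηy (st.D i) - descentAscent p.ηx p.ηy (rowAvg st.D)) +
        descentAscent p.ηx p.ηy (rowAvg st.D))
    have a2 := norm_add_sq_le_two_mul (mixRows W st.Z i - rowAvg st.Z) (-(st.Z i - rowAvg st.Z))
    have a3 := norm_add_sq_le_two_mul
      (descentAscent p.ηx p.ηy (st.D i) - descentAscent p.ηx p.ηy (rowAvg st.D))
      (descentAscent p.ηx p.ηy (rowAvg st.D))
    rw [norm_neg] at a2
    linarith
  have h2 := h.frobSq_mixRows_sub_le hM st.Z
  have h3 := perpSq_descentAscent_le hx hxy st.D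
  have h4 : mixingRho W ^ 2 * perpSq st.Z ≤ 1 * perpSq st.Z := by
    gcongr
    · exact perpSq_nonneg _
    · exact pow_le_one₀ (mixingRho_nonneg W) h.rho_lt_one.le
  rw [Finset.sum_const, Finset.card_univ, Fintype.card_fin, nsmul_eq_mul,
    norm_sq_descentAscent] at h1
  linarith

/-- The gradient tracking invariant: mixing preserves averages, so the increments of `V` telescope
in the average of `D`. -/
lemma IsMixingMatrix.rowAvg_nextD (h : IsMixingMatrix Edge W) {D V V' : Fin M → PDPoint d m}
    (hDV : rowAvg D = rowAvg V) :
    rowAvg (fun i => ∑ j, W i j • (D j + V' j - V j)) = rowAvg V' := by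
  refine (h.rowAvg_mixRows (fun j => D j + V' j - V j)).trans ?_
  rw [rowAvg_sub, rowAvg_add, hDV]
  abel

lemma IsMixingMatrix.perpSq_nextD_le (h : IsMixingMatrix Edge W) (hM : 0 < M)
    (D V V' : Fin M → PDPoint d m) :
    perpSq (fun i => ∑ j, W i j • (D j + V' j - V j)) ≤
      mixingRho W * perpSq D + 2 / (1 - mixingRho W) * frobSq (fun i => V' i - V i) := by
  have hr : 0 < 1 - mixingRho W := sub_pos.2 h.rho_lt_one
  have e : (fun i => ∑ j, W i j • (D j + V' j - V j)) =
      fun i => mixRows W D i + mixRows W (fun j => V' j - V j) i := by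
    funext i
    simp only [mixRows, ← Finset.sum_add_distrib, ← smul_add]
    exact Finset.sum_congr rfl fun j _ => by rw [add_sub_assoc]
  rw [e]
  refine (h.perpSq_mixRows_add_le hM _ _).trans ?_
  gcongr
  rw [perpSq_eq_frobSq, h.rowAvg_mixRows]
  refine (h.frobSq_mixRows_sub_le hM _).trans ?_
  calc mixingRho W ^ 2 * perpSq (fun i => V' i - V i) ≤ 1 * perpSq (fun i => V' i - V i) := by
        gcongr
        · exact perpSq_nonneg _
        · exact pow_le_one₀ (mixingRho_nonneg W) h.rho_lt_one.le
    _ ≤ _ := by rw [one_mul]; exact perpSq_le_frobSq hM _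

/-- The squared error of the gradient estimates. -/
noncomputable def gradErrSq (f : Fin M → PDPoint d m → ℝ) (z v : Fin M → PDPoint d m) : ℝ :=
  ∑ i, ‖v i - gradient (f i) (z i)‖ ^ 2

lemma gradErrSq_nonneg (f : Fin M → PDPoint d m → ℝ) (z v : Fin M → PDPoint d m) :
    0 ≤ gradErrSq f z v := Finset.sum_nonneg fun _ _ => sq_nonneg _

variable {L μ : ℝ} {f : Fin M → PDPoint d m → ℝ}

namespace IsNCSCProblem

/-- Passes through the true gradients at both points; the factor `3` is Cauchy-Schwarz for three
terms. -/
lemma frobSq_estimate_sub_le (hf : IsNCSCProblem L μ f) (z z' v v' : Fin M → PDPoint d m) :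
    frobSq (fun i => v' i - v i) ≤
      3 * (gradErrSq f z' v' + gradErrSq f z v + L ^ 2 * frobSq fun i => z' i - z i) := by
  simp only [frobSq, gradErrSq, Finset.mul_sum, ← Finset.sum_add_distrib]
  refine Finset.sum_le_sum fun i _ => ?_
  have h1 := pow_le_pow_left₀ (norm_nonneg _) (hf.gradient_lipschitz i (z' i) (z i)) 2
  rw [mul_pow] at h1
  have e : v' i - v i = (v' i - gradient (f i) (z' i)) + -(v i - gradient (f i) (z i)) +
    (gradient (f i) (z' i) - gradient (f i) (z i)) := by abel
  have h2 : ‖v' i - v i‖ ≤ ‖v' i - gradient (f i) (z' i)‖ + ‖v i - gradient (f i) (z i)‖ +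
      ‖gradient (f i) (z' i) - gradient (f i) (z i)‖ := by
    rw [e]
    refine (norm_add_le _ _).trans (add_le_add_left ?_ _)
    refine (norm_add_le _ _).trans ?_
    rw [norm_neg]
  have h3 := pow_le_pow_left₀ (norm_nonneg _) h2 2
  nlinarith [sq_nonneg (‖v' i - gradient (f i) (z' i)‖ - ‖v i - gradient (f i) (z i)‖),
    sq_nonneg (‖v' i - gradient (f i) (z' i)‖ - ‖gradient (f i) (z' i) - gradient (f i) (z i)‖),
    sq_nonneg (‖v i - gradient (f i) (z i)‖ - ‖gradient (f i) (z' i) - gradient (f i) (z i)‖)]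

/-- The error of the averaged estimate as a gradient of `f` at the averaged point. -/
lemma norm_rowAvg_sub_gradient_sq_le (hf : IsNCSCProblem L μ f) (z v : Fin M → PDPoint d m) :
    ‖rowAvg v - gradient (meanObj f) (rowAvg z)‖ ^ 2 ≤
      2 * ((M : ℝ)⁻¹ * (gradErrSq f z v + L ^ 2 * perpSq z)) := by
  have h1 := norm_rowAvg_sub_sq_le v (fun i => gradient (f i) (z i))
  have h2 : ‖rowAvg (fun i => gradient (f i) (z i)) - gradient (meanObj f) (rowAvg z)‖ ^ 2 ≤
      (M : ℝ)⁻¹ * (L ^ 2 * perpSq z) := by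
    rw [hf.gradient_meanObj]
    refine (norm_rowAvg_sub_sq_le _ _).trans ?_
    rw [perpSq, Finset.mul_sum (a := L ^ 2)]
    gcongr with i
    rw [← mul_pow]
    exact pow_le_pow_left₀ (norm_nonneg _) (hf.gradient_lipschitz i _ _) 2
  have h3 := norm_add_sq_le_two_mul (rowAvg v - rowAvg (fun i => gradient (f i) (z i)))
    (rowAvg (fun i => gradient (f i) (z i)) - gradient (meanObj f) (rowAvg z))
  rw [sub_add_sub_cancel] at h3
  rw [gradErrSq]
  linarith

/-- The exact `y`-gradient vanishes at the best response, so it is controlled by the dual gap; the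
rest is estimation and consensus error. -/
lemma norm_rowAvg_snd_sq_le (hf : IsNCSCProblem L μ f) (hM : 0 < M) (hL : 0 < L) (hμ : 0 < μ)
    (z v : Fin M → PDPoint d m) :
    ‖(rowAvg v).snd‖ ^ 2 ≤ 2 * L ^ 2 * dualGapSq f z +
      4 * ((M : ℝ)⁻¹ * (gradErrSq f z v + L ^ 2 * perpSq z)) := by
  have hs := hf.isSmoothStronglyConcave hM hL.le
  have h1 := hf.norm_rowAvg_sub_gradient_sq_le z v
  have h2 := pow_le_pow_left₀ (norm_nonneg _)
    (norm_pd_snd_le (rowAvg v - gradient (meanObj f) (rowAvg z))) 2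
  have h3 := pow_le_pow_left₀ (norm_nonneg _) (hs.norm_gradient_snd_sub_le (rowAvg z).fst
    (rowAvg z).snd (bestResponse f (rowAvg z).fst)) 2
  rw [hs.gradient_snd_eq_zero hL (hf.le_bestResponse hM hL.le hμ _), sub_zero, mul_pow] at h3
  have h4 := norm_add_sq_le_two_mul (gradient (meanObj f) (rowAvg z)).snd
    (rowAvg v - gradient (meanObj f) (rowAvg z)).snd
  rw [WithLp.sub_snd, add_sub_cancel] at h4
  rw [WithLp.sub_snd] at h2
  change ‖(gradient (meanObj f) (rowAvg z)).snd‖ ^ 2 ≤ L ^ 2 * dualGapSq f z at h3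
  linarith

/-- By Danskin, `∇Φ` is the `x`-gradient at the best response, so its distance to the exact
`x`-gradient is controlled by the dual gap. -/
lemma norm_gradient_primal_sub_sq_le (hf : IsNCSCProblem L μ f) (hM : 0 < M) (hm : 0 < m)
    (hL : 0 < L) (hμ : 0 < μ) (z v : Fin M → PDPoint d m) :
    ‖gradient (primalFun f) (rowAvg z).fst - (rowAvg v).fst‖ ^ 2 ≤ 2 * L ^ 2 * dualGapSq f z +
      4 * ((M : ℝ)⁻¹ * (gradErrSq f z v + L ^ 2 * perpSq z)) := by
  have hs := hf.isSmoothStronglyConcave hM hL.le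
  have h1 := hf.norm_rowAvg_sub_gradient_sq_le z v
  have h2 := pow_le_pow_left₀ (norm_nonneg _)
    (norm_pd_fst_le (rowAvg v - gradient (meanObj f) (rowAvg z))) 2
  have h3 := pow_le_pow_left₀ (norm_nonneg _) (hs.norm_gradient_fst_sub_le (rowAvg z).fst
    (rowAvg z).snd (bestResponse f (rowAvg z).fst)) 2
  rw [← hf.gradient_primalFun hM hm hL hμ, mul_pow] at h3
  have h4 := norm_add_sq_le_two_mul (rowAvg v - gradient (meanObj f) (rowAvg z)).fst
    ((gradient (meanObj f) (rowAvg z)).fst - gradient (primalFun f) (rowAvg z).fst)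
  rw [WithLp.sub_fst, sub_add_sub_cancel, ← norm_neg, neg_sub] at h4
  rw [WithLp.sub_fst] at h2
  change ‖(gradient (meanObj f) (rowAvg z)).fst - gradient (primalFun f) (rowAvg z).fst‖ ^ 2 ≤
    L ^ 2 * dualGapSq f z at h3
  linarith

/-- Contraction of the dual gap. -/
lemma dualGapSq_step_le (hf : IsNCSCProblem L μ f) (hM : 0 < M) (hL : 0 < L) (hμ : 0 < μ)
    {ηx ηy : ℝ} (hy : 0 < ηy) (hy' : L ^ 2 * ηy ≤ μ) (hy1 : μ * ηy ≤ 1)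
    {z z' v : Fin M → PDPoint d m}
    (hz : rowAvg z' = rowAvg z + descentAscent ηx ηy (rowAvg v)) :
    dualGapSq f z' ≤ (1 - μ * ηy / 2) * dualGapSq f z + 6 / (μ * ηy) *
      (ηy ^ 2 * (2 * ((M : ℝ)⁻¹ * (gradErrSq f z v + L ^ 2 * perpSq z))) +
        (L / μ) ^ 2 * (ηx ^ 2 * ‖(rowAvg v).fst‖ ^ 2)) := by
  have hs := hf.isSmoothStronglyConcave hM hL.le
  have h1 := hf.norm_rowAvg_sub_gradient_sq_le z v
  have h2 := pow_le_pow_left₀ (norm_nonneg _)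
    (norm_pd_snd_le (rowAvg v - gradient (meanObj f) (rowAvg z))) 2
  have hx' : (rowAvg z').fst = (rowAvg z).fst + -(ηx • (rowAvg v).fst) := by rw [hz]; rfl
  have hy' : (rowAvg z').snd = (rowAvg z).snd + ηy • (rowAvg v).snd := by rw [hz]; rfl
  have h3 := hs.norm_ascent_sub_sq_le hL hy.le ‹_›
    (hf.le_bestResponse hM hL.le hμ (rowAvg z).fst) (rowAvg z).snd
  have h4 := pow_le_pow_left₀ (norm_nonneg _)
    (hf.norm_bestResponse_sub_le hM hL hμ (rowAvg z).fst (rowAvg z').fst) 2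
  rw [hx'] at h4
  rw [sub_add_cancel_left, neg_neg, norm_smul, mul_pow, mul_pow, Real.norm_eq_abs, sq_abs,
    ← hx'] at h4
  set g := gradient (meanObj f) (rowAvg z) with hg
  change ‖(rowAvg z).snd + ηy • g.snd - _‖ ^ 2 ≤ (1 - μ * ηy) * dualGapSq f z at h3
  rw [dualGapSq, hy']
  -- Exact ascent step towards the old target, then the gradient error and the drift of the target.
  have e : (rowAvg z).snd + ηy • (rowAvg v).snd - bestResponse f (rowAvg z').fst =
      ((rowAvg z).snd + ηy • g.snd - bestResponse f (rowAvg z).fst) +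
      (ηy • (rowAvg v - g).snd +
        (bestResponse f (rowAvg z).fst - bestResponse f (rowAvg z').fst)) := by
    rw [WithLp.sub_snd]; module
  rw [e]
  have ha : 0 < μ * ηy := by positivity
  -- With `a = μ ηy` and Young parameter `a / 2`: `(1 + a / 2)(1 - a) ≤ 1 - a / 2`, and `1 + 2 / a ≤
  -- 3 / a` since `a ≤ 1`.
  have h5 := norm_add_sq_le_weighted (half_pos ha)
    ((rowAvg z).snd + ηy • g.snd - bestResponse f (rowAvg z).fst)
    (ηy • (rowAvg v - g).snd +
        (bestResponse f (rowAvg z).fst - bestResponse f (rowAvg z').fst))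
  have h6 := norm_add_sq_le_two_mul (ηy • (rowAvg v - g).snd)
        (bestResponse f (rowAvg z).fst - bestResponse f (rowAvg z').fst)
  rw [norm_smul, mul_pow, Real.norm_eq_abs, sq_abs] at h6
  have hδ : 0 ≤ dualGapSq f z := sq_nonneg _
  have h7 : (1 + μ * ηy / 2) * ‖(rowAvg z).snd + ηy • g.snd - bestResponse f (rowAvg z).fst‖ ^ 2
      ≤ (1 - μ * ηy / 2) * dualGapSq f z := by
    calc _ ≤ (1 + μ * ηy / 2) * ((1 - μ * ηy) * dualGapSq f z) := by gcongr
      _ = (1 - μ * ηy / 2 - (μ * ηy) ^ 2 / 2) * dualGapSq f z := by ring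
      _ ≤ _ := by linarith [mul_nonneg (sq_nonneg (μ * ηy)) hδ]
  have h8 : 1 + 1 / (μ * ηy / 2) ≤ 3 / (μ * ηy) := by
    have : 1 ≤ 1 / (μ * ηy) := (one_le_div ha).2 hy1
    have e1 : 1 / (μ * ηy / 2) = 2 * (1 / (μ * ηy)) := by field_simp
    have e2 : 3 / (μ * ηy) = 3 * (1 / (μ * ηy)) := by ring
    linarith
  have h9 : ηy ^ 2 * ‖(rowAvg v - g).snd‖ ^ 2 ≤
      ηy ^ 2 * (2 * ((M : ℝ)⁻¹ * (gradErrSq f z v + L ^ 2 * perpSq z))) := by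
    gcongr
    exact h2.trans h1
  have h10 : (1 + 1 / (μ * ηy / 2)) * ‖ηy • (rowAvg v - g).snd +
        (bestResponse f (rowAvg z).fst - bestResponse f (rowAvg z').fst)‖ ^ 2 ≤
      3 / (μ * ηy) * (2 * (ηy ^ 2 * (2 * ((M : ℝ)⁻¹ * (gradErrSq f z v + L ^ 2 * perpSq z))) +
        (L / μ) ^ 2 * (ηx ^ 2 * ‖(rowAvg v).fst‖ ^ 2))) := by
    gcongr
    linarith
  have e3 : ∀ w : ℝ, 3 / (μ * ηy) * (2 * w) = 6 / (μ * ηy) * w := fun w => by ring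
  rw [e3] at h10
  linarith

/-- Descent of the primal function. -/
lemma primalFun_step_le (hf : IsNCSCProblem L μ f) (hM : 0 < M) (hm : 0 < m) (hL : 0 < L)
    (hμ : 0 < μ) {ηx ηy : ℝ} (hx : 0 < ηx) (hx' : 2 * L * (L / μ) * ηx ≤ 1 / 4)
    {z z' v : Fin M → PDPoint d m}
    (hz : rowAvg z' = rowAvg z + descentAscent ηx ηy (rowAvg v)) :
    primalFun f (rowAvg z').fst ≤ primalFun f (rowAvg z).fst -
      ηx / 2 * ‖gradient (primalFun f) (rowAvg z).fst‖ ^ 2 - ηx / 4 * ‖(rowAvg v).fst‖ ^ 2 +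
      ηx / 2 * (2 * L ^ 2 * dualGapSq f z +
        4 * ((M : ℝ)⁻¹ * (gradErrSq f z v + L ^ 2 * perpSq z))) := by
  have h1 := (abs_le.1 (hf.abs_primalFun_sub_le hM hm hL hμ (rowAvg z).fst (rowAvg z').fst)).2
  have e : (rowAvg z').fst - (rowAvg z).fst = -(ηx • (rowAvg v).fst) := by
    rw [hz]
    exact add_sub_cancel_left _ _
  have h2 := hf.norm_gradient_primal_sub_sq_le hM hm hL hμ z v
  rw [← hf.gradient_primalFun hM hm hL hμ, e, norm_neg, norm_smul, inner_neg_right,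
    inner_smul_right, mul_pow, Real.norm_eq_abs, sq_abs] at h1
  -- Polarization turns `-ηx ⟨∇Φ, v̄_x⟩` into `-ηx / 2 (‖∇Φ‖² + ‖v̄_x‖²)` plus half the squared
  -- error. The curvature term then consumes half of the `‖v̄_x‖²` part; the remaining quarter later
  -- pays for the drift of `y*`.
  rw [norm_sub_sq_real] at h2
  have h3 := mul_le_mul_of_nonneg_left h2 (half_pos hx).le
  have h4 : 2 * L * (L / μ) * (ηx ^ 2 * ‖(rowAvg v).fst‖ ^ 2) ≤
      1 / 4 * (ηx * ‖(rowAvg v).fst‖ ^ 2) := by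
    calc _ = 2 * L * (L / μ) * ηx * (ηx * ‖(rowAvg v).fst‖ ^ 2) := by ring
      _ ≤ _ := by gcongr
  linarith

end IsNCSCProblem

end Step

/-! ### Independent centred perturbations -/

section Perturbation

/-- Working with the lower integral gives square integrability and the moment bound at once, without
assuming integrability beforehand. -/
lemma memLp_two_of_lintegral_le {Ω E : Type*} {mΩ : MeasurableSpace Ω} {P : Measure Ω}
    [NormedAddCommGroup E] {X : Ω → E} (hX : AEStronglyMeasurable X P) {b : ℝ}
    (h : ∫⁻ ω, ENNReal.ofReal (‖X ω‖ ^ 2) ∂P ≤ ENNReal.ofReal b) (hb : 0 ≤ b) :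
    MemLp X 2 P ∧ ∫ ω, ‖X ω‖ ^ 2 ∂P ≤ b := by
  have h1 : Integrable (fun ω => ‖X ω‖ ^ 2) P := by
    refine ⟨hX.norm.pow 2, ?_⟩
    rw [hasFiniteIntegral_iff_ofReal (Filter.Eventually.of_forall fun ω => sq_nonneg _)]
    exact h.trans_lt ENNReal.ofReal_lt_top
  refine ⟨(memLp_two_iff_integrable_sq_norm hX).2 h1, ?_⟩
  rw [← ofReal_integral_eq_lintegral_ofReal h1 (Filter.Eventually.of_forall fun ω => sq_nonneg _)]
    at h
  exact (ENNReal.ofReal_le_ofReal_iff hb).1 h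

variable {Ω α Ξ E : Type*} {𝓕 mΩ : MeasurableSpace Ω} [MeasurableSpace α] [MeasurableSpace Ξ]
  {P : Measure Ω} {D : Measure Ξ} [IsProbabilityMeasure D]
  [NormedAddCommGroup E] [InnerProductSpace ℝ E] [FiniteDimensional ℝ E]

lemma integral_norm_add_sq_of_integral_eq_zero {X : Ξ → E} (hX : MemLp X 2 D)
    (h0 : ∫ s, X s ∂D = 0) (u : E) :
    ∫ s, ‖u + X s‖ ^ 2 ∂D = ‖u‖ ^ 2 + ∫ s, ‖X s‖ ^ 2 ∂D := by
  have hi : Integrable X D := hX.integrable (by norm_num)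
  simp only [norm_add_sq_real]
  rw [integral_add (by fun_prop) hX.integrable_norm_pow', integral_add (by fun_prop)
    ((hi.const_inner u).const_mul 2), integral_const_mul, integral_inner hi, h0]
  simp

lemma integral_norm_sub_integral_sq_le {X : Ξ → E} (hX : MemLp X 2 D) :
    ∫ s, ‖X s - ∫ r, X r ∂D‖ ^ 2 ∂D ≤ ∫ s, ‖X s‖ ^ 2 ∂D := by
  have hi : Integrable X D := hX.integrable (by norm_num)
  have h := integral_norm_add_sq_of_integral_eq_zero (X := fun s => X s - ∫ r, X r ∂D)
    (hX.sub (memLp_const _)) (by rw [integral_sub hi (integrable_const _)]; simp) (∫ r, X r ∂D)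
  simp only [add_sub_cancel] at h
  nlinarith [sq_nonneg ‖∫ r, X r ∂D‖]

variable [IsProbabilityMeasure P] [MeasurableSpace E] [BorelSpace E]

/-- Adding an independent perturbation that is centred given `X` adds the second moments. -/
lemma integral_norm_add_perturbation_sq_le (h𝓕 : 𝓕 ≤ mΩ) {ζ : Ω → Ξ}
    (hζ : Measurable ζ) (hlaw : P.map ζ = D)
    (hind : Indep 𝓕 (MeasurableSpace.comap ζ inferInstance) P) {U : Ω → E} {X : Ω → α}
    (hU : Measurable[𝓕] U) (hX : Measurable[𝓕] X) (hU2 : MemLp U 2 P) {h : α → Ξ → E}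
    (hh : Measurable (Function.uncurry h)) (h2 : ∀ x, MemLp (h x) 2 D)
    (h0 : ∀ x, ∫ s, h x s ∂D = 0) {B : α → ℝ} (hB : ∀ x, ∫ s, ‖h x s‖ ^ 2 ∂D ≤ B x)
    (hBi : Integrable (fun ω => B (X ω)) P) :
    MemLp (fun ω => U ω + h (X ω) (ζ ω)) 2 P ∧
      ∫ ω, ‖U ω + h (X ω) (ζ ω)‖ ^ 2 ∂P ≤ ∫ ω, ‖U ω‖ ^ 2 ∂P + ∫ ω, B (X ω) ∂P := by
  have hY : Measurable[𝓕] fun ω => (U ω, X ω) := hU.prodMk hX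
  have hY' : Measurable fun ω => (U ω, X ω) := hY.mono h𝓕 le_rfl
  have hYζ : IndepFun (fun ω => (U ω, X ω)) ζ P :=
    (IndepFun_iff_Indep _ _ _).2 (indep_of_indep_of_le_left hind hY.comap_le)
  have hB0 : ∀ x, 0 ≤ B x := fun x => (integral_nonneg fun s => sq_nonneg _).trans (hB x)
  have hF : Measurable fun q : (E × α) × Ξ => q.1.1 + h q.1.2 q.2 :=
    (measurable_fst.comp measurable_fst).add
      (hh.comp ((measurable_snd.comp measurable_fst).prodMk measurable_snd))
  have hG : Measurable fun q : (E × α) × Ξ => ENNReal.ofReal (‖q.1.1 + h q.1.2 q.2‖ ^ 2) :=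
    (hF.norm.pow_const 2).ennreal_ofReal
  have hUi : Integrable (fun ω => ‖U ω‖ ^ 2) P := hU2.integrable_norm_pow'
  refine memLp_two_of_lintegral_le
    (X := fun ω => U ω + h (X ω) (ζ ω)) (hF.comp (hY'.prodMk hζ)).aestronglyMeasurable ?_
    (add_nonneg (integral_nonneg fun ω => sq_nonneg _) (integral_nonneg fun ω => hB0 _))
  calc ∫⁻ ω, ENNReal.ofReal (‖U ω + h (X ω) (ζ ω)‖ ^ 2) ∂P
      = ∫⁻ q, ENNReal.ofReal (‖q.1.1 + h q.1.2 q.2‖ ^ 2)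
          ∂(P.map fun ω => ((U ω, X ω), ζ ω)) :=
        (lintegral_map hG (hY'.prodMk hζ)).symm
    -- Independence makes the joint law a product; with `(U, X)` frozen, the inner integral over `D`
    -- plays the role of a conditional expectation and kills the cross term.
    _ = ∫⁻ y, ∫⁻ s, ENNReal.ofReal (‖y.1 + h y.2 s‖ ^ 2) ∂D ∂(P.map fun ω => (U ω, X ω)) := by
        rw [(indepFun_iff_map_prod_eq_prod_map_map hY'.aemeasurable hζ.aemeasurable).1 hYζ, hlaw,
          lintegral_prod _ hG.aemeasurable]
    _ = ∫⁻ ω, ∫⁻ s, ENNReal.ofReal (‖U ω + h (X ω) s‖ ^ 2) ∂D ∂P :=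
        lintegral_map hG.lintegral_prod_right' hY'
    _ ≤ ∫⁻ ω, ENNReal.ofReal (‖U ω‖ ^ 2 + B (X ω)) ∂P := by
        refine lintegral_mono fun ω => ?_
        dsimp only
        have hi : Integrable (fun s => ‖U ω + h (X ω) s‖ ^ 2) D :=
          ((memLp_const (U ω)).add (h2 (X ω))).integrable_norm_pow'
        rw [← ofReal_integral_eq_lintegral_ofReal hi
          (Filter.Eventually.of_forall fun s => sq_nonneg _),
          integral_norm_add_sq_of_integral_eq_zero (h2 _) (h0 _)]
        exact ENNReal.ofReal_le_ofReal (by linarith [hB (X ω)])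
    _ = ENNReal.ofReal (∫ ω, ‖U ω‖ ^ 2 ∂P + ∫ ω, B (X ω) ∂P) := by
        rw [← integral_add hUi hBi]
        exact (ofReal_integral_eq_lintegral_ofReal (hUi.add hBi)
          (Filter.Eventually.of_forall fun ω => add_nonneg (sq_nonneg _) (hB0 _))).symm

/-- Adding the mean of a batch of independent centred perturbations. -/
lemma integral_norm_add_batch_sq_le {𝓖 : ℕ → MeasurableSpace Ω} (h𝓖 : ∀ k, 𝓖 k ≤ mΩ)
    (hmono : Monotone 𝓖) {ζ : ℕ → Ω → Ξ} (hζ : ∀ k, Measurable[𝓖 (k + 1)] (ζ k))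
    (hlaw : ∀ k, P.map (ζ k) = D)
    (hind : ∀ k, Indep (𝓖 k) (MeasurableSpace.comap (ζ k) inferInstance) P)
    {U : Ω → E} {X : Ω → α}
    (hU : Measurable[𝓖 0] U) (hX : Measurable[𝓖 0] X) (hU2 : MemLp U 2 P) {h : α → Ξ → E}
    (hh : Measurable (Function.uncurry h)) (h2 : ∀ x, MemLp (h x) 2 D)
    (h0 : ∀ x, ∫ s, h x s ∂D = 0) {B : α → ℝ} (hB : ∀ x, ∫ s, ‖h x s‖ ^ 2 ∂D ≤ B x)
    (hBi : Integrable (fun ω => B (X ω)) P) {S : ℕ} (hS : 0 < S) :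
    MemLp (fun ω => U ω + (S : ℝ)⁻¹ • ∑ k ∈ Finset.range S, h (X ω) (ζ k ω)) 2 P ∧
      ∫ ω, ‖U ω + (S : ℝ)⁻¹ • ∑ k ∈ Finset.range S, h (X ω) (ζ k ω)‖ ^ 2 ∂P ≤
        ∫ ω, ‖U ω‖ ^ 2 ∂P + (S : ℝ)⁻¹ * ∫ ω, B (X ω) ∂P := by
  have hS' : (S : ℝ) ≠ 0 := by exact_mod_cast hS.ne'
  -- Samples are added one at a time: the partial sum is `𝓖 n`-measurable, hence independent of the
  -- next sample. Each sample contributes `S⁻² 𝐄 B`, so `S` of them contribute `S⁻¹ 𝐄 B`.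
  have key : ∀ n : ℕ,
      Measurable[𝓖 n] (fun ω => U ω + (S : ℝ)⁻¹ • ∑ k ∈ Finset.range n, h (X ω) (ζ k ω)) ∧
      MemLp (fun ω => U ω + (S : ℝ)⁻¹ • ∑ k ∈ Finset.range n, h (X ω) (ζ k ω)) 2 P ∧
      ∫ ω, ‖U ω + (S : ℝ)⁻¹ • ∑ k ∈ Finset.range n, h (X ω) (ζ k ω)‖ ^ 2 ∂P ≤
        ∫ ω, ‖U ω‖ ^ 2 ∂P + n * ((S : ℝ)⁻¹ ^ 2 * ∫ ω, B (X ω) ∂P) := by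
    intro n
    induction n with
    | zero => simpa using ⟨hU, hU2⟩
    | succ n ih =>
      obtain ⟨i1, i2, i3⟩ := ih
      have hXn : Measurable[𝓖 n] X := hX.mono (hmono n.zero_le) le_rfl
      have e : ∀ ω, U ω + (S : ℝ)⁻¹ • ∑ k ∈ Finset.range (n + 1), h (X ω) (ζ k ω) =
          (U ω + (S : ℝ)⁻¹ • ∑ k ∈ Finset.range n, h (X ω) (ζ k ω)) +
            (S : ℝ)⁻¹ • h (X ω) (ζ n ω) := fun ω => by
        rw [Finset.sum_range_succ, smul_add, add_assoc]
      simp only [e]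
      have step := integral_norm_add_perturbation_sq_le (h𝓖 n)
        ((hζ n).mono (h𝓖 _) le_rfl) (hlaw n) (hind n) i1 hXn i2
        (h := fun x s => (S : ℝ)⁻¹ • h x s) (hh.const_smul (S : ℝ)⁻¹)
        (fun x => (h2 x).const_smul _) (fun x => by rw [integral_smul, h0, smul_zero])
        (B := fun x => (S : ℝ)⁻¹ ^ 2 * B x)
        (fun x => by
          simp only [norm_smul, mul_pow, Real.norm_eq_abs, sq_abs]
          rw [integral_const_mul]
          exact mul_le_mul_of_nonneg_left (hB x) (sq_nonneg _))
        (hBi.const_mul _)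
      refine ⟨?_, step.1, step.2.trans ?_⟩
      · have m1 := i1.mono (hmono n.le_succ) le_rfl
        have m2 : Measurable[𝓖 (n + 1)] fun ω => h (X ω) (ζ n ω) :=
          hh.comp ((hXn.mono (hmono n.le_succ) le_rfl).prodMk (hζ n))
        exact m1.add (m2.const_smul (S : ℝ)⁻¹)
      · rw [integral_const_mul]
        push_cast
        linarith
  obtain ⟨-, k2, k3⟩ := key S
  refine ⟨k2, k3.trans (le_of_eq ?_)⟩
  congr 1
  field_simp

end Perturbation

/-! ### The samples -/

section Samples

variable {M : ℕ} {Ω Ξ : Type*} {mΩ : MeasurableSpace Ω} [MeasurableSpace Ξ]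
  {P : Measure Ω} {𝒟 : Fin M → Measure Ξ} {ξ : ℕ → Fin M → ℕ → Ω → Ξ}

/-- The information carried by the samples with index in `S`. -/
abbrev sampleSigma (ξ : ℕ → Fin M → ℕ → Ω → Ξ) (S : Set (ℕ × Fin M × ℕ)) : MeasurableSpace Ω :=
  ⨆ a ∈ S, MeasurableSpace.comap (ξ a.1 a.2.1 a.2.2) inferInstance

lemma sampleSigma_mono (ξ : ℕ → Fin M → ℕ → Ω → Ξ) : Monotone (sampleSigma ξ) :=
  fun _ _ h => biSup_mono h

lemma measurable_sampleSigma (ξ : ℕ → Fin M → ℕ → Ω → Ξ) {S : Set (ℕ × Fin M × ℕ)} {t : ℕ}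
    {i : Fin M} {k : ℕ} (h : (t, i, k) ∈ S) : Measurable[sampleSigma ξ S] (ξ t i k) :=
  Measurable.of_comap_le (le_biSup
    (fun a : ℕ × Fin M × ℕ => MeasurableSpace.comap (ξ a.1 a.2.1 a.2.2) inferInstance) h)

lemma IsSampling.sampleSigma_le (hξ : IsSampling P 𝒟 ξ) (S : Set (ℕ × Fin M × ℕ)) :
    sampleSigma ξ S ≤ mΩ :=
  iSup₂_le fun a _ => (hξ.measurable a.1 a.2.1 a.2.2).comap_le

lemma IsSampling.indep_sample (hξ : IsSampling P 𝒟 ξ) {S : Set (ℕ × Fin M × ℕ)} {t : ℕ}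
    {i : Fin M} {k : ℕ} (h : (t, i, k) ∉ S) :
    Indep (sampleSigma ξ S) (MeasurableSpace.comap (ξ t i k) inferInstance) P := by
  have := indep_iSup_of_disjoint (m := fun a : ℕ × Fin M × ℕ =>
    MeasurableSpace.comap (ξ a.1 a.2.1 a.2.2) inferInstance)
    (fun a => (hξ.measurable a.1 a.2.1 a.2.2).comap_le) hξ.indep
    (Set.disjoint_singleton_right.2 h)
  simpa [sampleSigma] using this

variable {α E : Type*} [MeasurableSpace α] [IsProbabilityMeasure P]
  [∀ i, IsProbabilityMeasure (𝒟 i)]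
  [NormedAddCommGroup E] [InnerProductSpace ℝ E] [FiniteDimensional ℝ E]
  [MeasurableSpace E] [BorelSpace E]

lemma IsSampling.integral_norm_add_batch_sq_le (hξ : IsSampling P 𝒟 ξ)
    {S₀ : Set (ℕ × Fin M × ℕ)} {t : ℕ} {i : Fin M} (hS₀ : ∀ k, (t, i, k) ∉ S₀)
    {U : Ω → E} {X : Ω → α} (hU : Measurable[sampleSigma ξ S₀] U)
    (hX : Measurable[sampleSigma ξ S₀] X) (hU2 : MemLp U 2 P) {h : α → Ξ → E}
    (hh : Measurable (Function.uncurry h)) (h2 : ∀ x, MemLp (h x) 2 (𝒟 i))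
    (h0 : ∀ x, ∫ s, h x s ∂(𝒟 i) = 0) {B : α → ℝ}
    (hB : ∀ x, ∫ s, ‖h x s‖ ^ 2 ∂(𝒟 i) ≤ B x)
    (hBi : Integrable (fun ω => B (X ω)) P) {S : ℕ} (hS : 0 < S) :
    MemLp (fun ω => U ω + (S : ℝ)⁻¹ • ∑ k ∈ Finset.range S, h (X ω) (ξ t i k ω)) 2 P ∧
      ∫ ω, ‖U ω + (S : ℝ)⁻¹ • ∑ k ∈ Finset.range S, h (X ω) (ξ t i k ω)‖ ^ 2 ∂P ≤
        ∫ ω, ‖U ω‖ ^ 2 ∂P + (S : ℝ)⁻¹ * ∫ ω, B (X ω) ∂P := by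
  -- The filtration inside a batch: the information `S₀` together with the first `n` samples of the
  -- batch.
  refine _root_.integral_norm_add_batch_sq_le (D := 𝒟 i) (ζ := fun k => ξ t i k)
    (𝓖 := fun n => sampleSigma ξ (S₀ ∪ {a | ∃ k < n, a = (t, i, k)}))
    (fun n => hξ.sampleSigma_le _) ?_ ?_ (fun k => hξ.law t i k) ?_ ?_ ?_ hU2 hh h2 h0 hB hBi hS
  · intro a b hab
    refine sampleSigma_mono ξ (Set.union_subset_union_right _ ?_)
    rintro _ ⟨k, hk, rfl⟩
    exact ⟨k, hk.trans_le hab, rfl⟩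
  · exact fun k => measurable_sampleSigma ξ (Or.inr ⟨k, k.lt_succ_self, rfl⟩)
  · intro k
    refine hξ.indep_sample ?_
    rintro (h | ⟨j, hj, h⟩)
    · exact hS₀ k h
    · simp only [Prod.mk.injEq, true_and] at h
      exact hj.ne' h
  · exact hU.mono (sampleSigma_mono ξ Set.subset_union_left) le_rfl
  · exact hX.mono (sampleSigma_mono ξ Set.subset_union_left) le_rfl

end Samples

/-! ### Batches of oracle calls -/

section Lipschitz

variable {E F : Type*} [NormedAddCommGroup E] [NormedAddCommGroup F] {G : E → F} {C : ℝ}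

lemma continuous_of_norm_sub_le (hG : ∀ x x', ‖G x - G x'‖ ≤ C * ‖x - x'‖) : Continuous G := by
  refine (LipschitzWith.of_dist_le_mul (K := C.toNNReal) fun x x' => ?_).continuous
  rw [dist_eq_norm, dist_eq_norm]
  exact (hG x x').trans (mul_le_mul_of_nonneg_right (Real.le_coe_toNNReal C) (norm_nonneg _))

lemma MemLp.comp_of_norm_sub_le {Ω : Type*} {mΩ : MeasurableSpace Ω} {P : Measure Ω}
    [IsProbabilityMeasure P] (hG : ∀ x x', ‖G x - G x'‖ ≤ C * ‖x - x'‖) {X : Ω → E}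
    (hX : MemLp X 2 P) : MemLp (fun ω => G (X ω)) 2 P := by
  have h := (hX.norm.const_mul C).add (memLp_const ‖G 0‖)
  refine h.mono ((continuous_of_norm_sub_le hG).comp_aestronglyMeasurable hX.1)
    (Filter.Eventually.of_forall fun ω => ?_)
  have h1 := hG (X ω) 0
  rw [sub_zero] at h1
  have h2 := norm_add_le (G (X ω) - G 0) (G 0)
  rw [sub_add_cancel] at h2
  exact (by linarith : ‖G (X ω)‖ ≤ C * ‖X ω‖ + ‖G 0‖).trans (Real.le_norm_self _)

end Lipschitz

section Oracle

variable {M d m : ℕ} {Ω Ξ : Type*} {mΩ : MeasurableSpace Ω} [MeasurableSpace Ξ]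
  {P : Measure Ω} [IsProbabilityMeasure P]
  {𝒟 : Fin M → Measure Ξ}
  {ξ : ℕ → Fin M → ℕ → Ω → Ξ} {L μ σ : ℝ} {f : Fin M → PDPoint d m → ℝ}
  {g : Fin M → PDPoint d m → Ξ → PDPoint d m}

lemma IsNCSCProblem.measurable_gradient (hf : IsNCSCProblem L μ f) (i : Fin M) :
    Measurable (gradient (f i)) :=
  (continuous_of_norm_sub_le (hf.gradient_lipschitz i)).measurable

namespace IsStochasticOracle

lemma memLp_sub_gradient (hg : IsStochasticOracle L σ f 𝒟 g) (i : Fin M) (z : PDPoint d m) :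
    MemLp (fun s => g i z s - gradient (f i) z) 2 (𝒟 i) :=
  (memLp_two_iff_integrable_sq_norm
    ((hg.integrable i z).1.sub aestronglyMeasurable_const)).2 (hg.integrable_sq i z)

variable [∀ i, IsProbabilityMeasure (𝒟 i)]

lemma memLp (hg : IsStochasticOracle L σ f 𝒟 g) (i : Fin M) (z : PDPoint d m) :
    MemLp (g i z) 2 (𝒟 i) := by
  simpa [Pi.add_def] using (hg.memLp_sub_gradient i z).add (memLp_const (gradient (f i) z))

lemma integral_fresh_batch_le (hg : IsStochasticOracle L σ f 𝒟 g) (hf : IsNCSCProblem L μ f)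
    (hξ : IsSampling P 𝒟 ξ) {S₀ : Set (ℕ × Fin M × ℕ)} {t : ℕ} {i : Fin M}
    (hS₀ : ∀ k, (t, i, k) ∉ S₀) {X : Ω → PDPoint d m} (hX : Measurable[sampleSigma ξ S₀] X)
    {S : ℕ} (hS : 0 < S) :
    MemLp (fun ω => batchMean (g i) S (X ω) (fun k => ξ t i k ω) - gradient (f i) (X ω)) 2 P ∧
      ∫ ω, ‖batchMean (g i) S (X ω) (fun k => ξ t i k ω) - gradient (f i) (X ω)‖ ^ 2 ∂P ≤
        (S : ℝ)⁻¹ * σ ^ 2 := by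
  have hS' : (S : ℝ) ≠ 0 := by exact_mod_cast hS.ne'
  have h := hξ.integral_norm_add_batch_sq_le hS₀ (U := fun _ => (0 : PDPoint d m)) (X := X)
    measurable_const hX (memLp_const _) (h := fun z s => g i z s - gradient (f i) z)
    ((hg.measurable i).sub ((hf.measurable_gradient i).comp measurable_fst))
    (fun z => hg.memLp_sub_gradient i z)
    (fun z => by
      rw [integral_sub (hg.integrable i z) (integrable_const _), hg.unbiased]; simp)
    (B := fun _ => σ ^ 2) (fun z => hg.variance_le i z) (integrable_const _) hS
  have e : ∀ ω, 0 + (S : ℝ)⁻¹ • ∑ k ∈ Finset.range S,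
      (g i (X ω) (ξ t i k ω) - gradient (f i) (X ω)) =
      batchMean (g i) S (X ω) (fun k => ξ t i k ω) - gradient (f i) (X ω) := fun ω => by
    rw [zero_add, Finset.sum_sub_distrib, smul_sub, Finset.sum_const, Finset.card_range,
      ← Nat.cast_smul_eq_nsmul ℝ, inv_smul_smul₀ hS', batchMean]
  simp only [e] at h
  refine ⟨h.1, h.2.trans (le_of_eq ?_)⟩
  simp

/-- The martingale structure of the SPIDER estimator: the new error is the old error plus a batch
mean of differences centred given the past. Their variance is at most their second moment, hence at
most `L² ‖X' - X‖²`. -/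
lemma integral_difference_batch_le (hg : IsStochasticOracle L σ f 𝒟 g)
    (hf : IsNCSCProblem L μ f) (hξ : IsSampling P 𝒟 ξ) {S₀ : Set (ℕ × Fin M × ℕ)} {t : ℕ}
    {i : Fin M} (hS₀ : ∀ k, (t, i, k) ∉ S₀) {V X X' : Ω → PDPoint d m}
    (hV : Measurable[sampleSigma ξ S₀] V) (hX : Measurable[sampleSigma ξ S₀] X)
    (hX' : Measurable[sampleSigma ξ S₀] X') (hV2 : MemLp V 2 P) (hX2 : MemLp X 2 P)
    (hX2' : MemLp X' 2 P) {S : ℕ} (hS : 0 < S) :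
    MemLp (fun ω => batchMean (g i) S (X' ω) (fun k => ξ t i k ω)
        - batchMean (g i) S (X ω) (fun k => ξ t i k ω) + V ω - gradient (f i) (X' ω)) 2 P ∧
      ∫ ω, ‖batchMean (g i) S (X' ω) (fun k => ξ t i k ω)
        - batchMean (g i) S (X ω) (fun k => ξ t i k ω) + V ω - gradient (f i) (X' ω)‖ ^ 2 ∂P ≤
        ∫ ω, ‖V ω - gradient (f i) (X ω)‖ ^ 2 ∂P
          + (S : ℝ)⁻¹ * ∫ ω, L ^ 2 * ‖X' ω - X ω‖ ^ 2 ∂P := by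
  have hS' : (S : ℝ) ≠ 0 := by exact_mod_cast hS.ne'
  have hm := hf.measurable_gradient i
  have h0 : ∀ z z' : PDPoint d m, ∫ s, (g i z' s - g i z s) ∂(𝒟 i) =
      gradient (f i) z' - gradient (f i) z := fun z z' => by
    rw [integral_sub (hg.integrable i _) (hg.integrable i _), hg.unbiased, hg.unbiased]
  have hL2 : ∀ z z' : PDPoint d m, MemLp (fun s => g i z' s - g i z s) 2 (𝒟 i) :=
    fun z z' => (hg.memLp i z').sub (hg.memLp i z)
  have hU : Measurable[sampleSigma ξ S₀] fun ω => V ω - gradient (f i) (X ω) :=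
    hV.sub (hm.comp hX)
  have hU2 : MemLp (fun ω => V ω - gradient (f i) (X ω)) 2 P :=
    hV2.sub (MemLp.comp_of_norm_sub_le (hf.gradient_lipschitz i) hX2)
  have hg1 : Measurable fun q : (PDPoint d m × PDPoint d m) × Ξ => g i q.1.1 q.2 :=
    (hg.measurable i).comp ((measurable_fst.comp measurable_fst).prodMk measurable_snd)
  have hg2 : Measurable fun q : (PDPoint d m × PDPoint d m) × Ξ => g i q.1.2 q.2 :=
    (hg.measurable i).comp ((measurable_snd.comp measurable_fst).prodMk measurable_snd)
  have hm1 : Measurable fun q : (PDPoint d m × PDPoint d m) × Ξ => gradient (f i) q.1.1 :=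
    hm.comp (measurable_fst.comp measurable_fst)
  have hm2 : Measurable fun q : (PDPoint d m × PDPoint d m) × Ξ => gradient (f i) q.1.2 :=
    hm.comp (measurable_snd.comp measurable_fst)
  have hh : Measurable (Function.uncurry fun (z : PDPoint d m × PDPoint d m) (s : Ξ) =>
      g i z.1 s - g i z.2 s - (gradient (f i) z.1 - gradient (f i) z.2)) :=
    (hg1.sub hg2).sub (hm1.sub hm2)
  have hmean : ∀ z : PDPoint d m × PDPoint d m, ∫ s, (g i z.1 s - g i z.2 s -
      (gradient (f i) z.1 - gradient (f i) z.2)) ∂(𝒟 i) = 0 := fun z => by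
    rw [integral_sub ((hL2 _ _).integrable one_le_two) (integrable_const _), h0, integral_const]
    simp
  have hvar : ∀ z : PDPoint d m × PDPoint d m, ∫ s, ‖g i z.1 s - g i z.2 s -
      (gradient (f i) z.1 - gradient (f i) z.2)‖ ^ 2 ∂(𝒟 i) ≤ L ^ 2 * ‖z.1 - z.2‖ ^ 2 :=
    fun z => by
      rw [← h0]
      exact (integral_norm_sub_integral_sq_le (hL2 z.2 z.1)).trans
        (hg.meanSquare_lipschitz i z.1 z.2)
  have hB : Integrable (fun ω => L ^ 2 * ‖X' ω - X ω‖ ^ 2) P :=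
    (hX2'.sub hX2).integrable_norm_pow'.const_mul (L ^ 2)
  have h := hξ.integral_norm_add_batch_sq_le hS₀ hU (hX'.prodMk hX) hU2 hh
    (fun z => (hL2 z.2 z.1).sub (memLp_const _)) hmean hvar hB hS
  have e : (fun ω => V ω - gradient (f i) (X ω) + (S : ℝ)⁻¹ • ∑ k ∈ Finset.range S,
      (g i (X' ω) (ξ t i k ω) - g i (X ω) (ξ t i k ω)
        - (gradient (f i) (X' ω) - gradient (f i) (X ω)))) =
      fun ω => batchMean (g i) S (X' ω) (fun k => ξ t i k ω)
        - batchMean (g i) S (X ω) (fun k => ξ t i k ω) + V ω - gradient (f i) (X' ω) := by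
    funext ω
    rw [Finset.sum_sub_distrib, smul_sub, Finset.sum_const, Finset.card_range,
      ← Nat.cast_smul_eq_nsmul ℝ, inv_smul_smul₀ hS', Finset.sum_sub_distrib, smul_sub,
      batchMean, batchMean]
    abel
  have e' := congrArg (fun F : Ω → PDPoint d m => ∫ ω, ‖F ω‖ ^ 2 ∂P) e
  exact ⟨e ▸ h.1, e'.symm.trans_le h.2⟩

end IsStochasticOracle

end Oracle

/-! ### The iterates as random variables -/

section Run

variable {M d m : ℕ} {Ω Ξ : Type*}
  {ξ : ℕ → Fin M → ℕ → Ω → Ξ} {L μ σ : ℝ} {f : Fin M → PDPoint d m → ℝ}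
  {g : Fin M → PDPoint d m → Ξ → PDPoint d m} {W : Matrix (Fin M) (Fin M) ℝ} {p : DGDAParams}
  {Z₀ : Fin M → PDPoint d m} {D₀ : Ω → Fin M → PDPoint d m}

/-- The state at iteration `t` as a random variable. -/
noncomputable def dgdaRun (W : Matrix (Fin M) (Fin M) ℝ)
    (g : Fin M → PDPoint d m → Ξ → PDPoint d m) (p : DGDAParams) (Z₀ : Fin M → PDPoint d m)
    (D₀ : Ω → Fin M → PDPoint d m) (ξ : ℕ → Fin M → ℕ → Ω → Ξ) (t : ℕ) (ω : Ω) :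
    DGDAState M d m :=
  dgdaIter W g p Z₀ (D₀ ω) (fun t i k => ξ t i k ω) t

lemma dgdaRun_succ_Z (t : ℕ) (ω : Ω) :
    (dgdaRun W g p Z₀ D₀ ξ (t + 1) ω).Z = dgdaNextZ W p (dgdaRun W g p Z₀ D₀ ξ t ω) := rfl

lemma dgdaRun_succ_V (t : ℕ) (ω : Ω) (i : Fin M) :
    (dgdaRun W g p Z₀ D₀ ξ (t + 1) ω).V i =
      if t % p.q = 0 then batchMean (g i) p.S₁ ((dgdaRun W g p Z₀ D₀ ξ (t + 1) ω).Z i)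
        (fun k => ξ (t + 1) i k ω)
      else batchMean (g i) p.S₂ ((dgdaRun W g p Z₀ D₀ ξ (t + 1) ω).Z i) (fun k => ξ (t + 1) i k ω)
        - batchMean (g i) p.S₂ ((dgdaRun W g p Z₀ D₀ ξ t ω).Z i) (fun k => ξ (t + 1) i k ω)
        + (dgdaRun W g p Z₀ D₀ ξ t ω).V i := rfl

lemma dgdaRun_succ_D (t : ℕ) (ω : Ω) (i : Fin M) :
    (dgdaRun W g p Z₀ D₀ ξ (t + 1) ω).D i =
      mixRows W (fun j => (dgdaRun W g p Z₀ D₀ ξ t ω).D j + (dgdaRun W g p Z₀ D₀ ξ (t + 1) ω).V j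
        - (dgdaRun W g p Z₀ D₀ ξ t ω).V j) i := rfl

lemma rowAvg_dgdaRun_D {Edge : Fin M → Fin M → Prop} (hW : IsMixingMatrix Edge W)
    (h0 : ∀ ω, rowAvg (D₀ ω) = rowAvg (dgdaInitV g p Z₀ fun i k => ξ 0 i k ω)) (t : ℕ) (ω : Ω) :
    rowAvg (dgdaRun W g p Z₀ D₀ ξ t ω).D = rowAvg (dgdaRun W g p Z₀ D₀ ξ t ω).V := by
  induction t with
  | zero => exact h0 ω
  | succ t ih => exact hW.rowAvg_nextD ih

lemma norm_descentAscent_sub_le (ηx ηy : ℝ) (z z' : PDPoint d m) :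
    ‖descentAscent ηx ηy z - descentAscent ηx ηy z'‖ ≤ (|ηx| + |ηy|) * ‖z - z'‖ := by
  rw [← map_sub]
  refine le_of_sq_le_sq ?_ (by positivity)
  rw [norm_sq_descentAscent, mul_pow, norm_sq_eq_fst_snd (z - z'), mul_add]
  have h1 : ηx ^ 2 ≤ (|ηx| + |ηy|) ^ 2 := by
    rw [← sq_abs ηx]
    exact pow_le_pow_left₀ (abs_nonneg _) (le_add_of_nonneg_right (abs_nonneg _)) 2
  have h2 : ηy ^ 2 ≤ (|ηx| + |ηy|) ^ 2 := by
    rw [← sq_abs ηy]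
    exact pow_le_pow_left₀ (abs_nonneg _) (le_add_of_nonneg_left (abs_nonneg _)) 2
  gcongr

lemma measurable_descentAscent (ηx ηy : ℝ) :
    Measurable fun z : PDPoint d m => descentAscent ηx ηy z :=
  (continuous_of_norm_sub_le (norm_descentAscent_sub_le ηx ηy)).measurable

variable {mΩ : MeasurableSpace Ω} {P : Measure Ω}

lemma measurable_mixRows (W : Matrix (Fin M) (Fin M) ℝ)
    {U : Ω → Fin M → PDPoint d m} (hU : ∀ i, Measurable fun ω => U ω i) (i : Fin M) :
    Measurable fun ω => mixRows W (U ω) i :=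
  Finset.measurable_fun_sum _ fun j _ => (hU j).const_smul (W i j)

lemma memLp_mixRows (W : Matrix (Fin M) (Fin M) ℝ) {U : Ω → Fin M → PDPoint d m}
    (hU : ∀ i, MemLp (fun ω => U ω i) 2 P) (i : Fin M) :
    MemLp (fun ω => mixRows W (U ω) i) 2 P :=
  memLp_finsetSum _ fun j _ => (hU j).const_smul (W i j)

lemma measurable_dgdaRun_succ_Z {t : ℕ}
    (hZ : ∀ i, Measurable fun ω => (dgdaRun W g p Z₀ D₀ ξ t ω).Z i)
    (hD : ∀ i, Measurable fun ω => (dgdaRun W g p Z₀ D₀ ξ t ω).D i) (i : Fin M) :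
    Measurable fun ω => (dgdaRun W g p Z₀ D₀ ξ (t + 1) ω).Z i := by
  simp only [dgdaRun_succ_Z, dgdaNextZ_eq]
  exact (measurable_mixRows W hZ i).add ((measurable_descentAscent _ _).comp (hD i))

variable [IsProbabilityMeasure P]

lemma memLp_dgdaRun_succ_Z {t : ℕ}
    (hZ : ∀ i, MemLp (fun ω => (dgdaRun W g p Z₀ D₀ ξ t ω).Z i) 2 P)
    (hD : ∀ i, MemLp (fun ω => (dgdaRun W g p Z₀ D₀ ξ t ω).D i) 2 P) (i : Fin M) :
    MemLp (fun ω => (dgdaRun W g p Z₀ D₀ ξ (t + 1) ω).Z i) 2 P := by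
  simp only [dgdaRun_succ_Z, dgdaNextZ_eq]
  exact (memLp_mixRows W hZ i).add
    (MemLp.comp_of_norm_sub_le (norm_descentAscent_sub_le p.ηx p.ηy) (hD i))

lemma memLp_estimate (hf : IsNCSCProblem L μ f) {i : Fin M} {X V : Ω → PDPoint d m}
    (hX : MemLp X 2 P) (h : MemLp (fun ω => V ω - gradient (f i) (X ω)) 2 P) : MemLp V 2 P := by
  simpa [Pi.add_def] using h.add (MemLp.comp_of_norm_sub_le (hf.gradient_lipschitz i) hX)

variable [MeasurableSpace Ξ] {𝒟 : Fin M → Measure Ξ}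

/-- The information carried by the samples used up to iterate `t`. -/
abbrev pastSigma (ξ : ℕ → Fin M → ℕ → Ω → Ξ) (t : ℕ) : MeasurableSpace Ω :=
  sampleSigma ξ {a | a.1 ≤ t}

lemma pastSigma_mono (ξ : ℕ → Fin M → ℕ → Ω → Ξ) {s t : ℕ} (h : s ≤ t) :
    pastSigma ξ s ≤ pastSigma ξ t :=
  sampleSigma_mono ξ fun _ ha => le_trans ha h

lemma initialSigma_le_pastSigma (ξ : ℕ → Fin M → ℕ → Ω → Ξ) :
    initialSigma ξ ≤ pastSigma ξ 0 :=
  iSup_le fun i => iSup_le fun k => le_biSup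
    (fun a : ℕ × Fin M × ℕ => MeasurableSpace.comap (ξ a.1 a.2.1 a.2.2) inferInstance)
    (show (0, i, k) ∈ {a : ℕ × Fin M × ℕ | a.1 ≤ 0} from Nat.le_refl 0)

lemma measurable_batchMean {G : PDPoint d m → Ξ → PDPoint d m}
    (hG : Measurable fun q : PDPoint d m × Ξ => G q.1 q.2) (S : ℕ) {X : Ω → PDPoint d m}
    (hX : Measurable X) {ζ : ℕ → Ω → Ξ} (hζ : ∀ k, Measurable (ζ k)) :
    Measurable fun ω => batchMean G S (X ω) fun k => ζ k ω :=
  (Finset.measurable_fun_sum _ fun k _ => hG.comp (hX.prodMk (hζ k))).const_smul (S : ℝ)⁻¹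

/-- The state at iterate `t` is a function of the samples used up to then. -/
lemma measurable_dgdaRun (hg : IsStochasticOracle L σ f 𝒟 g)
    (hD₀ : Measurable[initialSigma ξ] D₀) (t : ℕ) :
    (∀ i, Measurable[pastSigma ξ t] fun ω => (dgdaRun W g p Z₀ D₀ ξ t ω).Z i) ∧
    (∀ i, Measurable[pastSigma ξ t] fun ω => (dgdaRun W g p Z₀ D₀ ξ t ω).V i) ∧
    (∀ i, Measurable[pastSigma ξ t] fun ω => (dgdaRun W g p Z₀ D₀ ξ t ω).D i) := by
  have hs : ∀ t i k, Measurable[pastSigma ξ t] (ξ t i k) := fun t i k =>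
    measurable_sampleSigma ξ (le_refl t)
  induction t with
  | zero =>
    refine ⟨fun i => measurable_const, fun i => ?_, fun i => ?_⟩
    · exact measurable_batchMean (hg.measurable i) _ measurable_const (hs 0 i)
    · exact (measurable_pi_apply i).comp (hD₀.mono (initialSigma_le_pastSigma ξ) le_rfl)
  | succ t ih =>
    obtain ⟨iZ, iV, iD⟩ := ih
    have hle := pastSigma_mono ξ t.le_succ
    have jZ := fun i => (iZ i).mono hle le_rfl
    have jV := fun i => (iV i).mono hle le_rfl
    have jD := fun i => (iD i).mono hle le_rfl
    have kZ := measurable_dgdaRun_succ_Z jZ jD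
    have kV : ∀ i, Measurable[pastSigma ξ (t + 1)]
        fun ω => (dgdaRun W g p Z₀ D₀ ξ (t + 1) ω).V i := fun i => by
      simp only [dgdaRun_succ_V]
      split_ifs
      · exact measurable_batchMean (hg.measurable i) _ (kZ i) (hs (t + 1) i)
      · exact ((measurable_batchMean (hg.measurable i) _ (kZ i) (hs (t + 1) i)).sub
          (measurable_batchMean (hg.measurable i) _ (jZ i) (hs (t + 1) i))).add (jV i)
    refine ⟨kZ, kV, fun i => ?_⟩
    simp only [dgdaRun_succ_D]
    exact measurable_mixRows W (fun j => ((jD j).add (kV j)).sub (jV j)) i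

variable [∀ i, IsProbabilityMeasure (𝒟 i)]

lemma not_mem_past (t : ℕ) (i : Fin M) (k : ℕ) :
    (t + 1, i, k) ∉ {a : ℕ × Fin M × ℕ | a.1 ≤ t} := fun h => absurd h (Nat.not_succ_le_self t)

lemma memLp_initial_error (hf : IsNCSCProblem L μ f) (hg : IsStochasticOracle L σ f 𝒟 g)
    (hξ : IsSampling P 𝒟 ξ) (hS₁ : 0 < p.S₁) (i : Fin M) :
    MemLp (fun ω => (dgdaRun W g p Z₀ D₀ ξ 0 ω).V i
        - gradient (f i) ((dgdaRun W g p Z₀ D₀ ξ 0 ω).Z i)) 2 P ∧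
      ∫ ω, ‖(dgdaRun W g p Z₀ D₀ ξ 0 ω).V i
        - gradient (f i) ((dgdaRun W g p Z₀ D₀ ξ 0 ω).Z i)‖ ^ 2 ∂P ≤ (p.S₁ : ℝ)⁻¹ * σ ^ 2 :=
  hg.integral_fresh_batch_le hf hξ (S₀ := ∅) (t := 0) (i := i) (fun _ h => h)
    (X := fun _ => Z₀ i) measurable_const hS₁

/-- The oracle is known to be square integrable only at fixed points. At the random iterates `V` is
handled through its error `V - ∇f(Z)`, which is in `L²` by independence, while `∇f(Z)` is in `L²` by
Lipschitz continuity. -/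
lemma memLp_dgdaRun (hf : IsNCSCProblem L μ f) (hg : IsStochasticOracle L σ f 𝒟 g)
    (hξ : IsSampling P 𝒟 ξ) (hS₁ : 0 < p.S₁) (hS₂ : 0 < p.S₂)
    (hD₀ : Measurable[initialSigma ξ] D₀) (hD₀' : ∀ i, MemLp (fun ω => D₀ ω i) 2 P) (t : ℕ) :
    (∀ i, MemLp (fun ω => (dgdaRun W g p Z₀ D₀ ξ t ω).Z i) 2 P) ∧
    (∀ i, MemLp (fun ω => (dgdaRun W g p Z₀ D₀ ξ t ω).V i) 2 P) ∧
    (∀ i, MemLp (fun ω => (dgdaRun W g p Z₀ D₀ ξ t ω).D i) 2 P) := by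
  induction t with
  | zero =>
    exact ⟨fun i => memLp_const _, fun i => memLp_estimate hf (X := fun _ => Z₀ i) (memLp_const _)
      (memLp_initial_error (W := W) (D₀ := D₀) hf hg hξ hS₁ i).1, hD₀'⟩
  | succ t ih =>
    obtain ⟨iZ, iV, iD⟩ := ih
    obtain ⟨mZ, mV, mD⟩ := measurable_dgdaRun (W := W) (p := p) (Z₀ := Z₀) hg hD₀ t
    have kZ := memLp_dgdaRun_succ_Z iZ iD
    have nZ := measurable_dgdaRun_succ_Z mZ mD
    have kV : ∀ i, MemLp (fun ω => (dgdaRun W g p Z₀ D₀ ξ (t + 1) ω).V i) 2 P := fun i => by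
      refine memLp_estimate hf (i := i) (kZ i) ?_
      simp only [dgdaRun_succ_V]
      split_ifs
      · exact (hg.integral_fresh_batch_le hf hξ (not_mem_past t i) (nZ i) hS₁).1
      · exact (hg.integral_difference_batch_le hf hξ (not_mem_past t i) (mV i) (mZ i) (nZ i)
          (iV i) (iZ i) (kZ i) hS₂).1
    refine ⟨kZ, kV, fun i => ?_⟩
    simp only [dgdaRun_succ_D]
    exact memLp_mixRows W (fun j => ((iD j).add (kV j)).sub (iV j)) i

/-- The recursion for the mean squared error of the gradient estimates. -/
lemma integral_gradErrSq_zero_le (hf : IsNCSCProblem L μ f) (hg : IsStochasticOracle L σ f 𝒟 g)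
    (hξ : IsSampling P 𝒟 ξ) (hS₁ : 0 < p.S₁) :
    ∫ ω, gradErrSq f (dgdaRun W g p Z₀ D₀ ξ 0 ω).Z (dgdaRun W g p Z₀ D₀ ξ 0 ω).V ∂P ≤
      M * ((p.S₁ : ℝ)⁻¹ * σ ^ 2) := by
  have h := fun i => memLp_initial_error (W := W) (D₀ := D₀) (Z₀ := Z₀) hf hg hξ hS₁ i
  simp only [gradErrSq]
  rw [integral_finsetSum _ fun i _ => (h i).1.integrable_norm_pow']
  simpa using Finset.sum_le_sum fun i (_ : i ∈ Finset.univ) => (h i).2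

lemma integral_gradErrSq_succ_le (hf : IsNCSCProblem L μ f) (hg : IsStochasticOracle L σ f 𝒟 g)
    (hξ : IsSampling P 𝒟 ξ) (hS₁ : 0 < p.S₁) (hS₂ : 0 < p.S₂)
    (hD₀ : Measurable[initialSigma ξ] D₀) (hD₀' : ∀ i, MemLp (fun ω => D₀ ω i) 2 P) (t : ℕ) :
    ∫ ω, gradErrSq f (dgdaRun W g p Z₀ D₀ ξ (t + 1) ω).Z (dgdaRun W g p Z₀ D₀ ξ (t + 1) ω).V ∂P ≤
      if t % p.q = 0 then M * ((p.S₁ : ℝ)⁻¹ * σ ^ 2)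
      else ∫ ω, gradErrSq f (dgdaRun W g p Z₀ D₀ ξ t ω).Z (dgdaRun W g p Z₀ D₀ ξ t ω).V ∂P
        + (p.S₂ : ℝ)⁻¹ * (L ^ 2 * ∫ ω, frobSq (fun i => (dgdaRun W g p Z₀ D₀ ξ (t + 1) ω).Z i
          - (dgdaRun W g p Z₀ D₀ ξ t ω).Z i) ∂P) := by
  obtain ⟨mZ, mV, mD⟩ := measurable_dgdaRun (W := W) (p := p) (Z₀ := Z₀) hg hD₀ t
  obtain ⟨iZ, iV, iD⟩ := memLp_dgdaRun (W := W) (Z₀ := Z₀) hf hg hξ hS₁ hS₂ hD₀ hD₀' t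
  obtain ⟨kZ, kV, kD⟩ := memLp_dgdaRun (W := W) (Z₀ := Z₀) hf hg hξ hS₁ hS₂ hD₀ hD₀' (t + 1)
  have nZ := measurable_dgdaRun_succ_Z mZ mD
  have ie : ∀ {X V : Ω → Fin M → PDPoint d m}, (∀ i, MemLp (fun ω => X ω i) 2 P) →
      (∀ i, MemLp (fun ω => V ω i) 2 P) → ∀ i,
      Integrable (fun ω => ‖V ω i - gradient (f i) (X ω i)‖ ^ 2) P := fun hX hV i =>
    ((hV i).sub (MemLp.comp_of_norm_sub_le (hf.gradient_lipschitz i) (hX i))).integrable_norm_pow'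
  have ia : ∀ i, Integrable (fun ω => ‖(dgdaRun W g p Z₀ D₀ ξ (t + 1) ω).Z i
      - (dgdaRun W g p Z₀ D₀ ξ t ω).Z i‖ ^ 2) P := fun i =>
    ((kZ i).sub (iZ i)).integrable_norm_pow'
  simp only [gradErrSq, frobSq]
  rw [integral_finsetSum _ fun i _ => ie kZ kV i, integral_finsetSum _ fun i _ => ie iZ iV i,
    integral_finsetSum _ fun i _ => ia i]
  split_ifs with hq
  · refine (Finset.sum_le_sum (g := fun _ => (p.S₁ : ℝ)⁻¹ * σ ^ 2) fun i _ => ?_).trans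
      (by simp)
    simp only [dgdaRun_succ_V, if_pos hq]
    exact (hg.integral_fresh_batch_le hf hξ (not_mem_past t i) (nZ i) hS₁).2
  · rw [Finset.mul_sum, Finset.mul_sum, ← Finset.sum_add_distrib]
    refine Finset.sum_le_sum fun i _ => ?_
    simp only [dgdaRun_succ_V, if_neg hq]
    have := (hg.integral_difference_batch_le hf hξ (not_mem_past t i) (mV i) (mZ i) (nZ i)
          (iV i) (iZ i) (kZ i) hS₂).2
    rwa [integral_const_mul] at this

end Run

/-! ### Recursions of real numbers -/

section Recursions

/-- Telescoping of `r a t ≤ a t - a (t + 1) + b t`. The last summand on the left is absorbed by the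
leftover `a T`, as `r ≤ 1`. -/
lemma sum_le_of_contraction {a b : ℕ → ℝ} {r : ℝ} (hr : r ≤ 1) (ha : ∀ t, 0 ≤ a t)
    (h : ∀ t, a (t + 1) ≤ (1 - r) * a t + b t) (T : ℕ) :
    r * ∑ t ∈ Finset.range (T + 1), a t ≤ a 0 + ∑ t ∈ Finset.range T, b t := by
  have key : ∀ T, r * ∑ t ∈ Finset.range T, a t + a T ≤ a 0 + ∑ t ∈ Finset.range T, b t := by
    intro T
    induction T with
    | zero => simp
    | succ T ih =>
      rw [Finset.sum_range_succ, Finset.sum_range_succ]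
      linarith [h T]
  rw [Finset.sum_range_succ]
  linarith [key T, mul_le_of_le_one_left (ha T) hr]

/-- The accumulated error of an estimator that is refreshed every `q` steps. -/
lemma sum_le_of_periodic_refresh {e A : ℕ → ℝ} {s c : ℝ} {q : ℕ} (hq : 0 < q) (hA : ∀ t, 0 ≤ A t)
    (hc : c * q ≤ 1) (hc0 : 0 ≤ c) (h0 : e 0 ≤ s)
    (h : ∀ t, e (t + 1) ≤ if t % q = 0 then s else e t + c * A t) (T : ℕ) :
    ∑ t ∈ Finset.range T, e t ≤ T * s + ∑ t ∈ Finset.range T, A t := by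
  -- The excess of `e` over `s` built up since the last refresh, as an exact recursion; unlike `e -
  -- s`, it is nonnegative.
  let u : ℕ → ℝ := fun t => Nat.rec 0 (fun t v => if t % q = 0 then 0 else v + c * A t) t
  have hu0 : u 0 = 0 := rfl
  have hus : ∀ t, u (t + 1) = if t % q = 0 then 0 else u t + c * A t := fun t => rfl
  have hun : ∀ t, 0 ≤ u t := fun t => by
    induction t with
    | zero => exact hu0.ge
    | succ t ih =>
      rw [hus]
      split_ifs
      · exact le_rfl
      · exact add_nonneg ih (mul_nonneg hc0 (hA t))
  have heu : ∀ t, e t ≤ s + u t := fun t => by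
    induction t with
    | zero => linarith
    | succ t ih =>
      refine (h t).trans ?_
      rw [hus]
      split_ifs <;> linarith
  -- The extra term is a credit: with `t % q` steps elapsed, the value `u (t + 1)` can enter at most
  -- `q - t % q` further summands before the reset. Each `c * A j` is thus counted at most `q`
  -- times, and `c q ≤ 1`.
  have key : ∀ t, ∑ j ∈ Finset.range (t + 1), u j + ((q : ℝ) - (t % q : ℕ)) * u (t + 1) ≤
      ∑ j ∈ Finset.range (t + 1), A j := fun t => by
    induction t with
    | zero => simpa [hu0, hus] using hA 0
    | succ t ih =>
      rw [Finset.sum_range_succ, Finset.sum_range_succ (f := A), hus (t + 1)]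
      have hlt : t % q < q := Nat.mod_lt t hq
      split_ifs with ht
      · have h1 : (1 : ℝ) ≤ (q : ℝ) - (t % q : ℕ) := by
          have : t % q + 1 ≤ q := hlt
          have : ((t % q + 1 : ℕ) : ℝ) ≤ q := by exact_mod_cast this
          push_cast at this
          linarith
        nlinarith [hun (t + 1), hA (t + 1)]
      · have h1 : (t + 1) % q = t % q + 1 := by
          rw [Nat.add_mod] at ht ⊢
          rcases Nat.eq_or_lt_of_le hq with h | h
          · subst h; simp [Nat.mod_one] at ht
          · rw [Nat.mod_eq_of_lt h] at ht ⊢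
            refine Nat.mod_eq_of_lt (lt_of_le_of_ne hlt fun h' => ht ?_)
            have h'' : t % q + 1 = q := h'
            rw [h'', Nat.mod_self]
        rw [h1]
        push_cast
        have h2 : ((q : ℝ) - ((t % q : ℕ) + 1)) * (c * A (t + 1)) ≤ A (t + 1) := by
          calc ((q : ℝ) - ((t % q : ℕ) + 1)) * (c * A (t + 1)) ≤ q * (c * A (t + 1)) := by
                refine mul_le_mul_of_nonneg_right ?_ (mul_nonneg hc0 (hA _))
                have : (0 : ℝ) ≤ (t % q : ℕ) := Nat.cast_nonneg _
                linarith
            _ = c * q * A (t + 1) := by ring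
            _ ≤ 1 * A (t + 1) := mul_le_mul_of_nonneg_right hc (hA _)
            _ = A (t + 1) := one_mul _
        linarith
  have hsum : ∑ t ∈ Finset.range T, u t ≤ ∑ t ∈ Finset.range T, A t := by
    cases T with
    | zero => simp
    | succ t =>
      have h1 : (0 : ℝ) ≤ (q : ℝ) - (t % q : ℕ) := by
        have : t % q ≤ q := (Nat.mod_lt t hq).le
        have : ((t % q : ℕ) : ℝ) ≤ q := by exact_mod_cast this
        linarith
      linarith [key t, mul_nonneg h1 (hun (t + 1))]
  calc ∑ t ∈ Finset.range T, e t ≤ ∑ t ∈ Finset.range T, (s + u t) :=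
        Finset.sum_le_sum fun t _ => heu t
    _ = T * s + ∑ t ∈ Finset.range T, u t := by simp [Finset.sum_add_distrib]
    _ ≤ _ := by linarith

/-- The bounds satisfied by the mean errors along the run: consensus errors `Z` and `D`, estimation
error `e`, squared displacement `A`, dual gap `δ`, squared primal gradient `G`, squared primal
direction `B` and primal value `Φ`. -/
structure MeanRecursion (N L μ r ηx ηy s : ℝ) (q : ℕ) (Z D e A δ G B Φ : ℕ → ℝ) : Prop where
  Z_nonneg : ∀ t, 0 ≤ Z t
  D_nonneg : ∀ t, 0 ≤ D t
  e_nonneg : ∀ t, 0 ≤ e t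
  A_nonneg : ∀ t, 0 ≤ A t
  δ_nonneg : ∀ t, 0 ≤ δ t
  G_nonneg : ∀ t, 0 ≤ G t
  B_nonneg : ∀ t, 0 ≤ B t
  Z_succ : ∀ t, Z (t + 1) ≤ (1 - r) * Z t + 2 / r * (ηy ^ 2 * D t)
  D_succ : ∀ t, D (t + 1) ≤ (1 - r) * D t + 2 / r * (3 * (e (t + 1) + e t + L ^ 2 * A t))
  A_le : ∀ t, A t ≤ 8 * Z t + 4 * (ηy ^ 2 * D t) + 4 * (N * (ηx ^ 2 * B t +
    ηy ^ 2 * (2 * L ^ 2 * δ t + 4 * (N⁻¹ * (e t + L ^ 2 * Z t)))))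
  δ_succ : ∀ t, δ (t + 1) ≤ (1 - μ * ηy / 2) * δ t + 6 / (μ * ηy) *
    (ηy ^ 2 * (2 * (N⁻¹ * (e t + L ^ 2 * Z t))) + (L / μ) ^ 2 * (ηx ^ 2 * B t))
  Φ_succ : ∀ t, Φ (t + 1) ≤ Φ t - ηx / 2 * G t - ηx / 4 * B t +
    ηx / 2 * (2 * L ^ 2 * δ t + 4 * (N⁻¹ * (e t + L ^ 2 * Z t)))
  e_zero : e 0 ≤ N * s
  e_succ : ∀ t, e (t + 1) ≤ if t % q = 0 then N * s else e t + (q : ℝ)⁻¹ * (L ^ 2 * A t)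

variable {N L μ r ηx ηy s : ℝ} {q : ℕ} {Z D e A δ G B Φ : ℕ → ℝ}

/-- The normalized form of `bounds_of_coupled_sums`. -/
lemma bounds_of_linear_system {E z a w y SG SB n φ ψ l K : ℝ} (hE : 0 ≤ E) (hz : 0 ≤ z)
    (hSG : 0 ≤ SG) (hSB : 0 ≤ SB) (hn : 0 ≤ n) (hK : 0 ≤ K)
    (hφ : 0 ≤ φ) (hψ : 0 ≤ ψ) (hl : 0 ≤ l)
    (f1 : w ≤ 1 / 10000 * (l + 12 * E + 6 * a)) (f2 : z ≤ l + 2 * w)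
    (f3 : a ≤ 8 * z + 4 * w + 4 * (1 / 10000 * SB) + 4 * (1 / 10000 * (2 * y + 4 * (E + z))))
    (f4 : y ≤ 2 * ψ + 24 * (E + z) + 12 / 256 * SB)
    (f5 : SG + SB / 2 ≤ 2 * φ + 2 * y + 4 * (E + z)) (f6 : E ≤ n + a)
    (hφK : φ ≤ K) (hψK : ψ ≤ K) (hlK : l ≤ 2 * K) :
    SG ≤ 2000 * K + 100 * n ∧ z ≤ 2000 * K + 100 * n ∧ y ≤ 2000 * K + 100 * n := by
  have k1 : SB ≤ 8 * φ + 16 * ψ + 208 * (E + z) := by linarith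
  have k2 : a ≤ 20 * l + n + 1 / 10 * (φ + ψ) := by linarith
  have k3 : E + z ≤ 30 * l + 2 * n + φ + ψ := by linarith
  refine ⟨?_, ?_, ?_⟩ <;> linarith

/-- Elimination of the sums of the error terms. -/
lemma bounds_of_coupled_sums {N L κ r ηx ηy s Z₀ D₀ δ₀ ΔΦ SZ SD Se SA Sδ SG SB : ℝ} (hN : 0 < N)
    (hL : 0 < L) (hκ : 1 ≤ κ) (hr : 0 < r) (hr1 : r ≤ 1) (hx : 0 < ηx) (hy : 0 < ηy)
    (hy1 : L * ηy ≤ r ^ 2 / 100) (hy2 : L * κ * ηy ≤ 1 / 100) (hxy : ηx * κ ^ 2 ≤ ηy / 16)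
    (hZ₀ : 0 ≤ Z₀) (hD₀ : 0 ≤ D₀) (hδ₀ : 0 ≤ δ₀) (hΔ : 0 ≤ ΔΦ)
    (hSZ : 0 ≤ SZ) (hSD : 0 ≤ SD) (hSe : 0 ≤ Se) (hSδ : 0 ≤ Sδ) (hSG : 0 ≤ SG)
    (hSB : 0 ≤ SB) (hs : 0 ≤ s)
    (h1 : r * SD ≤ D₀ + 2 / r * (3 * (2 * Se + L ^ 2 * SA)))
    (h2 : r * SZ ≤ Z₀ + 2 / r * (ηy ^ 2 * SD))
    (h3 : SA ≤ 8 * SZ + 4 * (ηy ^ 2 * SD) + 4 * (N * (ηx ^ 2 * SB +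
      ηy ^ 2 * (2 * L ^ 2 * Sδ + 4 * (N⁻¹ * (Se + L ^ 2 * SZ))))))
    (h4 : L / κ * ηy / 2 * Sδ ≤ δ₀ + 6 / (L / κ * ηy) *
      (ηy ^ 2 * (2 * (N⁻¹ * (Se + L ^ 2 * SZ))) + κ ^ 2 * (ηx ^ 2 * SB)))
    (h5 : ηx / 2 * SG + ηx / 4 * SB ≤ ΔΦ +
      ηx / 2 * (2 * L ^ 2 * Sδ + 4 * (N⁻¹ * (Se + L ^ 2 * SZ))))
    (h6 : Se ≤ N * s + L ^ 2 * SA) {K : ℝ}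
    (hK1 : ΔΦ / ηx ≤ K) (hK2 : L * κ * δ₀ / ηy ≤ K)
    (hK3 : κ ^ 2 * (L ^ 2 * Z₀ + D₀) / (r * N) ≤ 2 * K) :
    SG ≤ 2000 * K + 100 * (κ ^ 2 * s) ∧ κ ^ 2 * L ^ 2 * SZ / N ≤ 2000 * K + 100 * (κ ^ 2 * s) ∧
      L ^ 2 * Sδ ≤ 2000 * K + 100 * (κ ^ 2 * s) := by
  have hκ0 : 0 < κ := by linarith
  have hκ2 : 1 ≤ κ ^ 2 := one_le_pow₀ hκ
  have b1 : (L * ηy) ^ 2 ≤ r ^ 4 / 10000 := by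
    calc (L * ηy) ^ 2 ≤ (r ^ 2 / 100) ^ 2 := by gcongr
      _ = _ := by ring
  have b2 : κ ^ 2 * L ^ 2 * ηy ^ 2 ≤ 1 / 10000 := by
    calc κ ^ 2 * L ^ 2 * ηy ^ 2 = (L * κ * ηy) ^ 2 := by ring
      _ ≤ (1 / 100) ^ 2 := by gcongr
      _ = _ := by norm_num
  have b3 : ηx ≤ ηy := by
    have : ηx * 1 ≤ ηx * κ ^ 2 := by gcongr
    linarith
  have b4 : κ ^ 2 * L ^ 2 * ηx ^ 2 ≤ 1 / 10000 := by
    refine le_trans ?_ b2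
    gcongr
  -- All sums are rescaled to the units of `SG`, so that the coefficients become absolute numbers.
  -- The factor `κ²` in `E` and `z` is the amplification of gradient errors by the dual gap
  -- recursion.
  obtain ⟨E, hE⟩ : ∃ E, E = κ ^ 2 * Se / N := ⟨_, rfl⟩
  obtain ⟨z, hz⟩ : ∃ z, z = κ ^ 2 * L ^ 2 * SZ / N := ⟨_, rfl⟩
  obtain ⟨a, ha⟩ : ∃ a, a = κ ^ 2 * L ^ 2 * SA / N := ⟨_, rfl⟩
  obtain ⟨w, hw⟩ : ∃ w, w = κ ^ 2 * L ^ 2 * ηy ^ 2 * SD / (N * r ^ 2) := ⟨_, rfl⟩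
  obtain ⟨y, hy'⟩ : ∃ y, y = L ^ 2 * Sδ := ⟨_, rfl⟩
  have hE0 : 0 ≤ E := by rw [hE]; positivity
  have hz0 : 0 ≤ z := by rw [hz]; positivity
  have hw0 : 0 ≤ w := by rw [hw]; positivity
  have hb : N⁻¹ * (Se + L ^ 2 * SZ) = (E + z) / κ ^ 2 := by rw [hE, hz]; field_simp
  have hb' : (E + z) / κ ^ 2 ≤ E + z := div_le_self (by positivity) hκ2
  rw [hb] at h3 h4 h5
  -- Summing the tracker recursion costs `r⁻²`, and the consensus recursion driven by it costs
  -- another `r⁻²`, already included in `w`. The condition `L ηy ≤ r² / 100` compensates both.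
  have f1 : w ≤ 1 / 10000 * (κ ^ 2 * (L ^ 2 * Z₀ + D₀) / (r * N) + 12 * E + 6 * a) := by
    have g1 : r ^ 2 * SD ≤ r * D₀ + 6 * (2 * Se + L ^ 2 * SA) := by
      have := mul_le_mul_of_nonneg_left h1 hr.le
      have e1 : r * (D₀ + 2 / r * (3 * (2 * Se + L ^ 2 * SA))) =
        r * D₀ + 6 * (2 * Se + L ^ 2 * SA) := by field_simp; ring
      rw [e1] at this
      rwa [pow_two, mul_assoc]
    have g2 : r * D₀ ≤ (L ^ 2 * Z₀ + D₀) / r := by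
      rw [le_div_iff₀ hr]
      calc r * D₀ * r = r ^ 2 * D₀ := by ring
        _ ≤ D₀ := mul_le_of_le_one_left hD₀ (pow_le_one₀ hr.le hr1)
        _ ≤ _ := le_add_of_nonneg_left (by positivity)
    calc w = κ ^ 2 * SD * (L * ηy) ^ 2 / (N * r ^ 2) := by rw [hw]; ring
      _ ≤ κ ^ 2 * SD * (r ^ 4 / 10000) / (N * r ^ 2) := by gcongr
      _ = 1 / 10000 * (κ ^ 2 / N * (r ^ 2 * SD)) := by field_simp
      _ ≤ 1 / 10000 * (κ ^ 2 / N * ((L ^ 2 * Z₀ + D₀) / r + 6 * (2 * Se + L ^ 2 * SA))) := by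
        gcongr
        exact g1.trans (add_le_add_left g2 _)
      _ = _ := by rw [hE, ha]; field_simp; ring
  have f2 : z ≤ κ ^ 2 * (L ^ 2 * Z₀ + D₀) / (r * N) + 2 * w := by
    calc z = κ ^ 2 * L ^ 2 / (r * N) * (r * SZ) := by rw [hz]; field_simp
      _ ≤ κ ^ 2 * L ^ 2 / (r * N) * (Z₀ + 2 / r * (ηy ^ 2 * SD)) := by gcongr
      _ = κ ^ 2 * (L ^ 2 * Z₀) / (r * N) + 2 * w := by rw [hw]; field_simp
      _ ≤ _ := by
        gcongr
        exact le_add_of_nonneg_right hD₀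
  have f3 : a ≤ 8 * z + 4 * w + 4 * (1 / 10000 * SB) + 4 * (1 / 10000 * (2 * y + 4 * (E + z))) := by
    have g1 : r ^ 2 * w ≤ w := mul_le_of_le_one_left hw0 (pow_le_one₀ hr.le hr1)
    calc a = κ ^ 2 * L ^ 2 / N * SA := by rw [ha]; ring
      _ ≤ κ ^ 2 * L ^ 2 / N * _ := mul_le_mul_of_nonneg_left h3 (by positivity)
      _ = 8 * z + 4 * (r ^ 2 * w) + 4 * (κ ^ 2 * L ^ 2 * ηx ^ 2 * SB) +
          4 * (κ ^ 2 * L ^ 2 * ηy ^ 2 * (2 * y + 4 * ((E + z) / κ ^ 2))) := by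
        rw [hz, hw, hy']; field_simp; ring
      _ ≤ _ := by
        have hy0 : 0 ≤ 2 * y + 4 * ((E + z) / κ ^ 2) := by rw [hy']; positivity
        gcongr
  have f4 : y ≤ 2 * (L * κ * δ₀ / ηy) + 24 * (E + z) + 12 / 256 * SB := by
    -- Time scale separation: `x` moves slowly enough (`ηx ≤ ηy / (16 κ²)`) for the drift of `y*` to
    -- be absorbed by the primal descent.
    have g1 : κ ^ 4 * ηx ^ 2 / ηy ^ 2 ≤ 1 / 256 := by
      rw [div_le_iff₀ (by positivity)]
      calc κ ^ 4 * ηx ^ 2 = (ηx * κ ^ 2) ^ 2 := by ring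
        _ ≤ (ηy / 16) ^ 2 := by gcongr
        _ = _ := by ring
    calc y = 2 * L * κ / ηy * (L / κ * ηy / 2 * Sδ) := by rw [hy']; field_simp
      _ ≤ 2 * L * κ / ηy * _ := mul_le_mul_of_nonneg_left h4 (by positivity)
      _ = 2 * (L * κ * δ₀ / ηy) + 24 * (E + z) + 12 * (κ ^ 4 * ηx ^ 2 / ηy ^ 2) * SB := by
        field_simp; ring
      _ ≤ 2 * (L * κ * δ₀ / ηy) + 24 * (E + z) + 12 * (1 / 256) * SB := by gcongr
      _ = _ := by ring
  have f5 : SG + SB / 2 ≤ 2 * (ΔΦ / ηx) + 2 * y + 4 * (E + z) := by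
    have := mul_le_mul_of_nonneg_left h5 (by positivity : 0 ≤ 2 / ηx)
    have e1 : 2 / ηx * (ηx / 2 * SG + ηx / 4 * SB) = SG + SB / 2 := by field_simp; ring
    have e2 : 2 / ηx * (ΔΦ + ηx / 2 * (2 * L ^ 2 * Sδ + 4 * ((E + z) / κ ^ 2))) =
      2 * (ΔΦ / ηx) + 2 * y + 4 * ((E + z) / κ ^ 2) := by rw [hy']; field_simp; ring
    linarith
  have f6 : E ≤ κ ^ 2 * s + a := by
    calc E = κ ^ 2 / N * Se := by rw [hE]; ring
      _ ≤ κ ^ 2 / N * (N * s + L ^ 2 * SA) := by gcongr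
      _ = _ := by rw [ha]; field_simp
  rw [← hz, ← hy']
  have hκs : 0 ≤ κ ^ 2 * s := by positivity
  have hK0 : 0 ≤ K := le_trans (by positivity) hK1
  exact bounds_of_linear_system hE0 hz0 hSG hSB hκs hK0
    (div_nonneg hΔ hx.le) (by positivity) (by positivity) f1 f2 f3 f4 f5 f6 hK1 hK2 hK3

/-- Sums each recursion over `t < T`. The contractions produce forcing sums over `t < T - 1` only,
which nonnegativity enlarges to full sums. -/
lemma MeanRecursion.sum_bounds (h : MeanRecursion N L μ r ηx ηy s q Z D e A δ G B Φ) (hN : 0 < N)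
    (hL : 0 < L) (hμ : 0 < μ) (hμL : μ ≤ L) (hr : 0 < r) (hr1 : r ≤ 1) (hx : 0 < ηx) (hy : 0 < ηy)
    (hy1 : L * ηy ≤ r ^ 2 / 100) (hy2 : L * (L / μ) * ηy ≤ 1 / 100)
    (hxy : ηx * (L / μ) ^ 2 ≤ ηy / 16) (hq : 0 < q) (hs : 0 ≤ s) {Φmin : ℝ}
    (hΦ : ∀ t, Φmin ≤ Φ t) {K : ℝ} (hK1 : (Φ 0 - Φmin) / ηx ≤ K)
    (hK2 : L * (L / μ) * δ 0 / ηy ≤ K)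
    (hK3 : (L / μ) ^ 2 * (L ^ 2 * Z 0 + D 0) / (r * N) ≤ 2 * K) {T : ℕ} (hT : 0 < T) :
    ∑ t ∈ Finset.range T, G t ≤ 2000 * K + 100 * ((L / μ) ^ 2 * (T * s)) ∧
    (L / μ) ^ 2 * L ^ 2 * (∑ t ∈ Finset.range T, Z t) / N ≤
      2000 * K + 100 * ((L / μ) ^ 2 * (T * s)) ∧
    L ^ 2 * ∑ t ∈ Finset.range T, δ t ≤ 2000 * K + 100 * ((L / μ) ^ 2 * (T * s)) := by
  have hκ : 1 ≤ L / μ := (one_le_div hμ).2 hμL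
  have hμ' : L / (L / μ) = μ := by field_simp
  have hμy : μ * ηy / 2 ≤ 1 := by
    have : μ * ηy ≤ 1 / 100 := by
      calc μ * ηy ≤ L * (L / μ) * ηy := by
            gcongr
            exact hμL.trans (le_mul_of_one_le_right hL.le hκ)
        _ ≤ _ := hy2
    linarith
  have hle : ∀ {u : ℕ → ℝ}, (∀ t, 0 ≤ u t) →
      ∑ t ∈ Finset.range (T - 1), u t ≤ ∑ t ∈ Finset.range T, u t := fun hu =>
    Finset.sum_le_sum_of_subset_of_nonneg (Finset.range_mono (Nat.sub_le T 1)) fun t _ _ => hu t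
  have hle' : ∑ t ∈ Finset.range (T - 1), e (t + 1) ≤ ∑ t ∈ Finset.range T, e t := by
    have h1 := Finset.sum_range_succ' e (T - 1)
    rw [Nat.sub_add_cancel hT] at h1
    linarith [h.e_nonneg 0]
  refine bounds_of_coupled_sums (SD := ∑ t ∈ Finset.range T, D t)
    (Se := ∑ t ∈ Finset.range T, e t) (SA := ∑ t ∈ Finset.range T, A t)
    (SB := ∑ t ∈ Finset.range T, B t) (Z₀ := Z 0) (D₀ := D 0) (δ₀ := δ 0) hN hL hκ hr hr1 hx hy hy1
    hy2 hxy (h.Z_nonneg 0) (h.D_nonneg 0) (h.δ_nonneg 0) (sub_nonneg.2 (hΦ 0))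
    (Finset.sum_nonneg fun t _ => h.Z_nonneg t) (Finset.sum_nonneg fun t _ => h.D_nonneg t)
    (Finset.sum_nonneg fun t _ => h.e_nonneg t)
    (Finset.sum_nonneg fun t _ => h.δ_nonneg t) (Finset.sum_nonneg fun t _ => h.G_nonneg t)
    (Finset.sum_nonneg fun t _ => h.B_nonneg t) (by positivity) ?_ ?_ ?_ ?_ ?_ ?_ hK1 hK2 hK3
  · have h1 := sum_le_of_contraction hr1 h.D_nonneg h.D_succ (T - 1)
    rw [Nat.sub_add_cancel hT] at h1
    refine h1.trans ?_
    rw [← Finset.mul_sum, ← Finset.mul_sum, Finset.sum_add_distrib, Finset.sum_add_distrib,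
      ← Finset.mul_sum]
    have h2 := hle h.e_nonneg
    have h3 := mul_le_mul_of_nonneg_left (hle h.A_nonneg) (sq_nonneg L)
    refine add_le_add_right (mul_le_mul_of_nonneg_left ?_ (by positivity)) _
    linarith
  · have h1 := sum_le_of_contraction hr1 h.Z_nonneg h.Z_succ (T - 1)
    rw [Nat.sub_add_cancel hT] at h1
    refine h1.trans ?_
    rw [← Finset.mul_sum, ← Finset.mul_sum]
    have h2 := hle h.D_nonneg
    refine add_le_add_right (mul_le_mul_of_nonneg_left ?_ (by positivity)) _
    exact mul_le_mul_of_nonneg_left h2 (sq_nonneg _)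
  · have h1 := Finset.sum_le_sum fun t (_ : t ∈ Finset.range T) => h.A_le t
    simpa only [Finset.sum_add_distrib, ← Finset.mul_sum] using h1
  · have h1 := sum_le_of_contraction hμy h.δ_nonneg (b := fun t => 6 / (μ * ηy) *
      (ηy ^ 2 * (2 * (N⁻¹ * (e t + L ^ 2 * Z t))) + (L / μ) ^ 2 * (ηx ^ 2 * B t)))
      h.δ_succ (T - 1)
    rw [Nat.sub_add_cancel hT] at h1
    rw [hμ']
    refine h1.trans ?_
    have h2 : ∑ t ∈ Finset.range T, 6 / (μ * ηy) *
      (ηy ^ 2 * (2 * (N⁻¹ * (e t + L ^ 2 * Z t))) + (L / μ) ^ 2 * (ηx ^ 2 * B t)) =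
      6 / (μ * ηy) * (ηy ^ 2 * (2 * (N⁻¹ * (∑ t ∈ Finset.range T, e t +
        L ^ 2 * ∑ t ∈ Finset.range T, Z t))) + (L / μ) ^ 2 * (ηx ^ 2 * ∑ t ∈ Finset.range T, B t)) := by
      simp only [Finset.sum_add_distrib, ← Finset.mul_sum]
    rw [← h2]
    refine add_le_add_right (hle fun t => ?_) _
    have := h.e_nonneg t
    have := h.Z_nonneg t
    have := h.B_nonneg t
    positivity
  · have key : ∀ T, ∑ t ∈ Finset.range T, (ηx / 2 * G t + ηx / 4 * B t) ≤ Φ 0 - Φ T +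
        ∑ t ∈ Finset.range T, ηx / 2 * (2 * L ^ 2 * δ t + 4 * (N⁻¹ * (e t + L ^ 2 * Z t))) := by
      intro T
      induction T with
      | zero => simp
      | succ T ih =>
        rw [Finset.sum_range_succ, Finset.sum_range_succ]
        linarith [h.Φ_succ T]
    have h1 := key T
    simp only [Finset.sum_add_distrib, ← Finset.mul_sum] at h1
    linarith [hΦ T]
  · have hq' : (0 : ℝ) < q := by exact_mod_cast hq
    have h1 := sum_le_of_periodic_refresh (c := (q : ℝ)⁻¹) hq
      (fun t => mul_nonneg (sq_nonneg L) (h.A_nonneg t)) (by field_simp; rfl) (by positivity)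
      h.e_zero h.e_succ T
    rw [← Finset.mul_sum] at h1
    linarith

end Recursions

/-! ### The mean errors along the run -/

section MeanErrors

variable {M d m : ℕ} {L μ : ℝ} {f : Fin M → PDPoint d m → ℝ}

namespace IsNCSCProblem

/-- Used to make `∇Φ(x̄)` square integrable; the descent step relies on `abs_primalFun_sub_le`
instead. -/
lemma norm_gradient_primalFun_sub_le (hf : IsNCSCProblem L μ f) (hM : 0 < M) (hm : 0 < m)
    (hL : 0 < L) (hμ : 0 < μ) (x x' : EuclideanSpace ℝ (Fin d)) :
    ‖gradient (primalFun f) x - gradient (primalFun f) x'‖ ≤ L * (1 + L / μ) * ‖x - x'‖ := by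
  have hs := hf.isSmoothStronglyConcave hM hL.le
  rw [hf.gradient_primalFun hM hm hL hμ, hf.gradient_primalFun hM hm hL hμ]
  refine (norm_pd_fst_le (gradient (meanObj f) (pdPoint x (bestResponse f x)) -
    gradient (meanObj f) (pdPoint x' (bestResponse f x')))).trans ?_
  refine (hs.gradient_lipschitz _ _).trans ?_
  rw [mul_assoc]
  refine mul_le_mul_of_nonneg_left ?_ hL.le
  have h1 : pdPoint x (bestResponse f x) - pdPoint x' (bestResponse f x') =
      pdPoint (x - x') 0 + pdPoint 0 (bestResponse f x - bestResponse f x') := by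
    rw [← pdPoint_sub_left x x' (bestResponse f x), ← pdPoint_sub_right x', sub_add_sub_cancel]
  rw [h1]
  refine (norm_add_le _ _).trans ?_
  rw [norm_pdPoint_left, norm_pdPoint_right]
  linarith [hf.norm_bestResponse_sub_le hM hL hμ x x']

lemma norm_rowAvg_snd_sub_bestResponse_sub_le (hf : IsNCSCProblem L μ f) (hM : 0 < M)
    (hL : 0 < L) (hμ : 0 < μ) (z z' : PDPoint d m) :
    ‖(z.snd - bestResponse f z.fst) - (z'.snd - bestResponse f z'.fst)‖ ≤
      (1 + L / μ) * ‖z - z'‖ := by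
  have h1 := hf.norm_bestResponse_sub_le hM hL hμ z.fst z'.fst
  have h2 : ‖z.fst - z'.fst‖ ≤ ‖z - z'‖ := norm_pd_fst_le (z - z')
  have h3 : ‖z.snd - z'.snd‖ ≤ ‖z - z'‖ := norm_pd_snd_le (z - z')
  have h4 : L / μ * ‖z.fst - z'.fst‖ ≤ L / μ * ‖z - z'‖ := by gcongr
  rw [sub_sub_sub_comm]
  refine (norm_sub_le _ _).trans ?_
  linarith

end IsNCSCProblem

variable {Ω : Type*} {mΩ : MeasurableSpace Ω} {P : Measure Ω}

section Integrability

/-- Transfers pointwise recursions to expectations. Six terms suffice for the longest one, the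
primal descent; shorter ones fill the spare slots with coefficient `0`. -/
lemma integral_le_of_le_linear {X A₁ A₂ A₃ A₄ A₅ A₆ : Ω → ℝ} (hX : Integrable X P)
    (h₁ : Integrable A₁ P) (h₂ : Integrable A₂ P) (h₃ : Integrable A₃ P) (h₄ : Integrable A₄ P)
    (h₅ : Integrable A₅ P) (h₆ : Integrable A₆ P) (c₁ c₂ c₃ c₄ c₅ c₆ : ℝ)
    (h : ∀ ω, X ω ≤ c₁ * A₁ ω + (c₂ * A₂ ω + (c₃ * A₃ ω + (c₄ * A₄ ω +
      (c₅ * A₅ ω + c₆ * A₆ ω))))) :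
    ∫ ω, X ω ∂P ≤ c₁ * ∫ ω, A₁ ω ∂P + (c₂ * ∫ ω, A₂ ω ∂P + (c₃ * ∫ ω, A₃ ω ∂P +
      (c₄ * ∫ ω, A₄ ω ∂P + (c₅ * ∫ ω, A₅ ω ∂P + c₆ * ∫ ω, A₆ ω ∂P)))) := by
  have k₁ := h₁.const_mul c₁
  have k₂ := h₂.const_mul c₂
  have k₃ := h₃.const_mul c₃
  have k₄ := h₄.const_mul c₄
  have k₅ := h₅.const_mul c₅
  have k₆ := h₆.const_mul c₆
  have l₅ : Integrable (fun ω => c₅ * A₅ ω + c₆ * A₆ ω) P := k₅.add k₆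
  have l₄ : Integrable (fun ω => c₄ * A₄ ω + (c₅ * A₅ ω + c₆ * A₆ ω)) P := k₄.add l₅
  have l₃ : Integrable (fun ω => c₃ * A₃ ω + (c₄ * A₄ ω + (c₅ * A₅ ω + c₆ * A₆ ω))) P := k₃.add l₄
  have l₂ : Integrable (fun ω => c₂ * A₂ ω + (c₃ * A₃ ω + (c₄ * A₄ ω +
    (c₅ * A₅ ω + c₆ * A₆ ω)))) P := k₂.add l₃
  refine (integral_mono hX (k₁.add l₂) h).trans (le_of_eq ?_)
  simp only [← integral_const_mul]
  rw [← integral_add k₅ k₆, ← integral_add k₄ l₅, ← integral_add k₃ l₄, ← integral_add k₂ l₃,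
    ← integral_add k₁ l₂]
  rfl

variable {U V : Ω → Fin M → PDPoint d m}

lemma memLp_rowAvg (hU : ∀ i, MemLp (fun ω => U ω i) 2 P) :
    MemLp (fun ω => rowAvg (U ω)) 2 P :=
  (memLp_finsetSum _ fun i _ => hU i).const_smul (M : ℝ)⁻¹

variable [IsProbabilityMeasure P]

lemma integrable_frobSq (hU : ∀ i, MemLp (fun ω => U ω i) 2 P) :
    Integrable (fun ω => frobSq (U ω)) P :=
  integrable_finsetSum _ fun i _ => (hU i).integrable_norm_pow'

lemma integrable_perpSq (hU : ∀ i, MemLp (fun ω => U ω i) 2 P) :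
    Integrable (fun ω => perpSq (U ω)) P :=
  integrable_frobSq fun i => (hU i).sub (memLp_rowAvg hU)

lemma memLp_fst {X : Ω → PDPoint d m} (hX : MemLp X 2 P) : MemLp (fun ω => (X ω).fst) 2 P :=
  MemLp.comp_of_norm_sub_le (G := fun z : PDPoint d m => z.fst) (C := 1)
    (fun z z' => by rw [one_mul]; exact norm_pd_fst_le (z - z')) hX

lemma integrable_gradErrSq (hf : IsNCSCProblem L μ f) (hU : ∀ i, MemLp (fun ω => U ω i) 2 P)
    (hV : ∀ i, MemLp (fun ω => V ω i) 2 P) :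
    Integrable (fun ω => gradErrSq f (U ω) (V ω)) P :=
  integrable_frobSq (U := fun ω i => V ω i - gradient (f i) (U ω i)) fun i =>
    (hV i).sub (MemLp.comp_of_norm_sub_le (hf.gradient_lipschitz i) (hU i))

lemma integrable_dualGapSq (hf : IsNCSCProblem L μ f) (hM : 0 < M) (hL : 0 < L) (hμ : 0 < μ)
    (hU : ∀ i, MemLp (fun ω => U ω i) 2 P) : Integrable (fun ω => dualGapSq f (U ω)) P :=
  (MemLp.comp_of_norm_sub_le (hf.norm_rowAvg_snd_sub_bestResponse_sub_le hM hL hμ)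
    (memLp_rowAvg hU)).integrable_norm_pow'

lemma memLp_gradient_primalFun (hf : IsNCSCProblem L μ f) (hM : 0 < M) (hm : 0 < m) (hL : 0 < L)
    (hμ : 0 < μ) (hU : ∀ i, MemLp (fun ω => U ω i) 2 P) :
    MemLp (fun ω => gradient (primalFun f) (rowAvg (U ω)).fst) 2 P :=
  MemLp.comp_of_norm_sub_le (hf.norm_gradient_primalFun_sub_le hM hm hL hμ)
    (memLp_fst (memLp_rowAvg hU))

lemma integrable_primalFun (hf : IsNCSCProblem L μ f) (hM : 0 < M) (hm : 0 < m) (hL : 0 < L)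
    (hμ : 0 < μ) (hU : ∀ i, MemLp (fun ω => U ω i) 2 P) :
    Integrable (fun ω => primalFun f (rowAvg (U ω)).fst) P := by
  have hX := memLp_fst (memLp_rowAvg hU)
  have hc : Continuous (primalFun f) := continuous_iff_continuousAt.2 fun x =>
    (hasGradientAt_of_abs_sub_le (hf.abs_primalFun_sub_le hM hm hL hμ x)).continuousAt
  set g := (gradient (meanObj f) (pdPoint (0 : EuclideanSpace ℝ (Fin d)) (bestResponse f 0))).fst
  have hb : Integrable (fun ω => |primalFun f 0| + ‖g‖ * ‖(rowAvg (U ω)).fst‖ +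
      2 * L * (L / μ) * ‖(rowAvg (U ω)).fst‖ ^ 2) P :=
    ((integrable_const _).add ((hX.integrable one_le_two).norm.const_mul _)).add
      (hX.integrable_norm_pow'.const_mul _)
  refine hb.mono' (hc.comp_aestronglyMeasurable hX.1) (Filter.Eventually.of_forall fun ω => ?_)
  have h1 := abs_le.1 (hf.abs_primalFun_sub_le hM hm hL hμ 0 (rowAvg (U ω)).fst)
  rw [sub_zero] at h1
  have h2 := abs_le.1 (abs_real_inner_le_norm g (rowAvg (U ω)).fst)
  have h3 := abs_le.1 (le_refl |primalFun f 0|)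
  rw [Real.norm_eq_abs, abs_le]
  constructor <;> linarith

end Integrability

variable [IsProbabilityMeasure P] {Ξ : Type*} [MeasurableSpace Ξ]
  {𝒟 : Fin M → Measure Ξ} [∀ i, IsProbabilityMeasure (𝒟 i)]
  {ξ : ℕ → Fin M → ℕ → Ω → Ξ} {σ : ℝ} {g : Fin M → PDPoint d m → Ξ → PDPoint d m}
  {Edge : Fin M → Fin M → Prop} {W : Matrix (Fin M) (Fin M) ℝ} {p : DGDAParams}
  {Z₀ : Fin M → PDPoint d m} {D₀ : Ω → Fin M → PDPoint d m}

/-- The mean errors of the algorithm satisfy the system of recursions. -/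
lemma meanRecursion_dgdaRun (hf : IsNCSCProblem L μ f) (hM : 0 < M) (hm : 0 < m) (hL : 0 < L)
    (hμ : 0 < μ) (hW : IsMixingMatrix Edge W) (hg : IsStochasticOracle L σ f 𝒟 g)
    (hξ : IsSampling P 𝒟 ξ) (hx : 0 < p.ηx) (hy : 0 < p.ηy) (hxy : p.ηx ≤ p.ηy)
    (hy1 : L ^ 2 * p.ηy ≤ μ) (hy2 : μ * p.ηy ≤ 1) (hx1 : 2 * L * (L / μ) * p.ηx ≤ 1 / 4)
    (hS₁ : 0 < p.S₁) (hq : 0 < p.q) (hS₂ : p.q ≤ p.S₂) (hD₀ : Measurable[initialSigma ξ] D₀)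
    (hD₀' : ∀ i, MemLp (fun ω => D₀ ω i) 2 P)
    (hDV : ∀ ω, rowAvg (D₀ ω) = rowAvg (dgdaInitV g p Z₀ fun i k => ξ 0 i k ω))
    {S : ℕ → Ω → DGDAState M d m} (hS : S = dgdaRun W g p Z₀ D₀ ξ) :
    MeanRecursion M L μ (1 - mixingRho W) p.ηx p.ηy ((p.S₁ : ℝ)⁻¹ * σ ^ 2) p.q
      (fun t => ∫ ω, perpSq (S t ω).Z ∂P) (fun t => ∫ ω, perpSq (S t ω).D ∂P)
      (fun t => ∫ ω, gradErrSq f (S t ω).Z (S t ω).V ∂P)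
      (fun t => ∫ ω, frobSq (fun i => (S (t + 1) ω).Z i - (S t ω).Z i) ∂P)
      (fun t => ∫ ω, dualGapSq f (S t ω).Z ∂P)
      (fun t => ∫ ω, ‖gradient (primalFun f) (rowAvg (S t ω).Z).fst‖ ^ 2 ∂P)
      (fun t => ∫ ω, ‖(rowAvg (S t ω).V).fst‖ ^ 2 ∂P)
      (fun t => ∫ ω, primalFun f (rowAvg (S t ω).Z).fst ∂P) := by
  have hS₂' : 0 < p.S₂ := hq.trans_le hS₂
  have hmem : ∀ t, (∀ i, MemLp (fun ω => (S t ω).Z i) 2 P) ∧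
      (∀ i, MemLp (fun ω => (S t ω).V i) 2 P) ∧ (∀ i, MemLp (fun ω => (S t ω).D i) 2 P) := by
    rw [hS]
    exact memLp_dgdaRun hf hg hξ hS₁ hS₂' hD₀ hD₀'
  have hSZ : ∀ t ω, (S (t + 1) ω).Z = dgdaNextZ W p (S t ω) := by rw [hS]; exact dgdaRun_succ_Z
  have hSD : ∀ t ω, (S (t + 1) ω).D =
      fun i => ∑ j, W i j • ((S t ω).D j + (S (t + 1) ω).V j - (S t ω).V j) := by
    rw [hS]; exact fun t ω => rfl
  have havg : ∀ t ω, rowAvg (S t ω).D = rowAvg (S t ω).V := by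
    rw [hS]; exact rowAvg_dgdaRun_D hW hDV
  have hnext : ∀ t ω, rowAvg (S (t + 1) ω).Z =
      rowAvg (S t ω).Z + descentAscent p.ηx p.ηy (rowAvg (S t ω).V) := fun t ω => by
    rw [hSZ, hW.rowAvg_dgdaNextZ, havg]
  have iZ := fun t => integrable_perpSq (hmem t).1
  have iD := fun t => integrable_perpSq (hmem t).2.2
  have ie := fun t => integrable_gradErrSq hf (hmem t).1 (hmem t).2.1
  have iA : ∀ t, Integrable (fun ω => frobSq fun i => (S (t + 1) ω).Z i - (S t ω).Z i) P :=
    fun t => integrable_frobSq fun i => ((hmem (t + 1)).1 i).sub ((hmem t).1 i)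
  have iδ := fun t => integrable_dualGapSq hf hM hL hμ (hmem t).1
  have iG : ∀ t, Integrable (fun ω => ‖gradient (primalFun f) (rowAvg (S t ω).Z).fst‖ ^ 2) P :=
    fun t => (memLp_gradient_primalFun hf hM hm hL hμ (hmem t).1).integrable_norm_pow'
  have iB : ∀ t, Integrable (fun ω => ‖(rowAvg (S t ω).V).fst‖ ^ 2) P :=
    fun t => (memLp_fst (memLp_rowAvg (hmem t).2.1)).integrable_norm_pow'
  have iΦ := fun t => integrable_primalFun hf hM hm hL hμ (hmem t).1
  have hA0 : ∀ t, 0 ≤ ∫ ω, frobSq (fun i => (S (t + 1) ω).Z i - (S t ω).Z i) ∂P :=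
    fun t => integral_nonneg fun ω => frobSq_nonneg _
  refine
    { Z_nonneg := fun t => integral_nonneg fun ω => perpSq_nonneg _
      D_nonneg := fun t => integral_nonneg fun ω => perpSq_nonneg _
      e_nonneg := fun t => integral_nonneg fun ω => gradErrSq_nonneg _ _ _
      A_nonneg := hA0
      δ_nonneg := fun t => integral_nonneg fun ω => sq_nonneg _
      G_nonneg := fun t => integral_nonneg fun ω => sq_nonneg _
      B_nonneg := fun t => integral_nonneg fun ω => sq_nonneg _
      Z_succ := fun t => ?_
      D_succ := fun t => ?_
      A_le := fun t => ?_
      δ_succ := fun t => ?_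
      Φ_succ := fun t => ?_
      e_zero := ?_
      e_succ := fun t => ?_ }
  · refine (integral_le_of_le_linear (iZ (t + 1)) (iZ t) (iD t) (iD t) (iD t) (iD t) (iD t)
      (1 - (1 - mixingRho W)) (2 / (1 - mixingRho W) * p.ηy ^ 2) 0 0 0 0 fun ω => ?_).trans
      (le_of_eq (by ring))
    rw [hSZ]
    refine (hW.perpSq_dgdaNextZ_le hM hx.le hxy _).trans (le_of_eq (by ring))
  · refine (integral_le_of_le_linear (iD (t + 1)) (iD t) (ie (t + 1)) (ie t) (iA t) (iD t) (iD t)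
      (1 - (1 - mixingRho W)) (2 / (1 - mixingRho W) * 3) (2 / (1 - mixingRho W) * 3)
      (2 / (1 - mixingRho W) * 3 * L ^ 2) 0 0 fun ω => ?_).trans
      (le_of_eq (by ring))
    have hr : 0 < 1 - mixingRho W := sub_pos.2 hW.rho_lt_one
    have h1 := hW.perpSq_nextD_le hM (S t ω).D (S t ω).V (S (t + 1) ω).V
    have h2 := mul_le_mul_of_nonneg_left (hf.frobSq_estimate_sub_le (S t ω).Z (S (t + 1) ω).Z
      (S t ω).V (S (t + 1) ω).V) (div_pos two_pos hr).le
    rw [hSD]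
    linarith
  · refine (integral_le_of_le_linear (iA t) (iZ t) (iD t) (iB t) (iδ t) (ie t) (ie t)
      (8 + 16 * (M * p.ηy ^ 2 * ((M : ℝ)⁻¹ * L ^ 2))) (4 * p.ηy ^ 2) (4 * (M * p.ηx ^ 2))
      (8 * (M * p.ηy ^ 2 * L ^ 2)) (16 * (M * p.ηy ^ 2 * (M : ℝ)⁻¹)) 0 fun ω => ?_).trans
      (le_of_eq (by ring))
    have h1 := hW.frobSq_dgdaNextZ_sub_le hM hx.le hxy (S t ω)
    have h2 := mul_le_mul_of_nonneg_left
      (hf.norm_rowAvg_snd_sq_le hM hL hμ (S t ω).Z (S t ω).V)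
      (by positivity : (0 : ℝ) ≤ M * p.ηy ^ 2)
    rw [havg] at h1
    rw [hSZ]
    linarith
  · refine (integral_le_of_le_linear (iδ (t + 1)) (iδ t) (ie t) (iZ t) (iB t) (ie t) (ie t)
      (1 - μ * p.ηy / 2) (6 / (μ * p.ηy) * (p.ηy ^ 2 * (2 * (M : ℝ)⁻¹)))
      (6 / (μ * p.ηy) * (p.ηy ^ 2 * (2 * (M : ℝ)⁻¹)) * L ^ 2)
      (6 / (μ * p.ηy) * ((L / μ) ^ 2 * p.ηx ^ 2)) 0 0 fun ω => ?_).trans (le_of_eq (by ring))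
    exact (hf.dualGapSq_step_le hM hL hμ hy hy1 hy2 (hnext t ω)).trans (le_of_eq (by ring))
  · refine (integral_le_of_le_linear (iΦ (t + 1)) (iΦ t) (iG t) (iB t) (iδ t) (ie t) (iZ t)
      1 (-(p.ηx / 2)) (-(p.ηx / 4)) (p.ηx / 2 * (2 * L ^ 2)) (p.ηx / 2 * (4 * (M : ℝ)⁻¹))
      (p.ηx / 2 * (4 * (M : ℝ)⁻¹) * L ^ 2) fun ω => ?_).trans (le_of_eq (by ring))
    exact (hf.primalFun_step_le hM hm hL hμ hx hx1 (hnext t ω)).trans (le_of_eq (by ring))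
  · rw [hS]
    exact integral_gradErrSq_zero_le hf hg hξ hS₁
  · have h := integral_gradErrSq_succ_le (W := W) (Z₀ := Z₀) hf hg hξ hS₁ hS₂' hD₀ hD₀' t
    rw [← hS] at h
    refine h.trans ?_
    split_ifs
    · exact le_rfl
    · have hq' : (0 : ℝ) < p.q := by exact_mod_cast hq
      have h1 : (p.S₂ : ℝ)⁻¹ ≤ (p.q : ℝ)⁻¹ := inv_anti₀ hq' (by exact_mod_cast hS₂)
      exact add_le_add_right (mul_le_mul_of_nonneg_right h1
        (mul_nonneg (sq_nonneg L) (hA0 t))) _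

end MeanErrors

/-! ### Averages over the iterations -/

section Averages

variable {Ω : Type*} {𝓕 mΩ : MeasurableSpace Ω} {P : Measure Ω} [IsProbabilityMeasure P]

lemma integrable_sqrt {X : Ω → ℝ} (hX : Integrable X P) (h0 : ∀ ω, 0 ≤ X ω) :
    Integrable (fun ω => √(X ω)) P := by
  refine ((integrable_const (1 : ℝ)).add hX).mono'
    (Real.continuous_sqrt.comp_aestronglyMeasurable hX.1) (Filter.Eventually.of_forall fun ω => ?_)
  rw [Real.norm_eq_abs, abs_of_nonneg (Real.sqrt_nonneg _)]
  change √(X ω) ≤ 1 + X ω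
  nlinarith [Real.sq_sqrt (h0 ω), sq_nonneg (√(X ω) - 1), Real.sqrt_nonneg (X ω)]

/-- Jensen's inequality for the square root of an average. -/
lemma average_integral_sqrt_le {X : ℕ → Ω → ℝ} (hX : ∀ t, Integrable (X t) P)
    (h0 : ∀ t ω, 0 ≤ X t ω) {A : ℝ} (hA : 0 < A) {T : ℕ} (hT : 0 < T)
    (h : 1 / (T : ℝ) * ∑ t ∈ Finset.range T, ∫ ω, X t ω ∂P ≤ A ^ 2) :
    1 / (T : ℝ) * ∑ t ∈ Finset.range T, ∫ ω, √(X t ω) ∂P ≤ A := by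
  have hT' : (0 : ℝ) < T := by exact_mod_cast hT
  -- The tangent to the square root at `A²`: `√x ≤ A / 2 + x / (2 A)`. The average of the right side
  -- is at most `A`.
  have h1 : ∀ t, ∫ ω, √(X t ω) ∂P ≤ A / 2 + (2 * A)⁻¹ * ∫ ω, X t ω ∂P := fun t => by
    have h2 : ∫ ω, √(X t ω) ∂P ≤ ∫ ω, (A / 2 + (2 * A)⁻¹ * X t ω) ∂P := by
      refine integral_mono (integrable_sqrt (hX t) (h0 t))
        ((integrable_const _).add ((hX t).const_mul _)) fun ω => ?_
      have h3 : A / 2 + (2 * A)⁻¹ * X t ω - √(X t ω) = (2 * A)⁻¹ * (√(X t ω) - A) ^ 2 := by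
        rw [sub_sq, Real.sq_sqrt (h0 t ω)]
        field_simp
        ring
      have h4 : 0 ≤ (2 * A)⁻¹ * (√(X t ω) - A) ^ 2 := by positivity
      dsimp only
      linarith
    rwa [integral_add (integrable_const _) ((hX t).const_mul _), integral_const_mul,
      integral_const, probReal_univ, one_smul] at h2
  calc 1 / (T : ℝ) * ∑ t ∈ Finset.range T, ∫ ω, √(X t ω) ∂P
      ≤ 1 / (T : ℝ) * ∑ t ∈ Finset.range T, (A / 2 + (2 * A)⁻¹ * ∫ ω, X t ω ∂P) := by
        gcongr with t
        exact h1 t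
    _ = A / 2 + (2 * A)⁻¹ * (1 / (T : ℝ) * ∑ t ∈ Finset.range T, ∫ ω, X t ω ∂P) := by
        rw [Finset.sum_add_distrib, ← Finset.mul_sum, Finset.sum_const, Finset.card_range,
          nsmul_eq_mul]
        field_simp
    _ ≤ A / 2 + (2 * A)⁻¹ * A ^ 2 := by gcongr
    _ = A := by field_simp; norm_num

/-- Evaluation of a process at an independent index that is uniform on `{0, …, T - 1}`. -/
lemma integral_comp_uniform_index {τ : Ω → ℕ} (hτ : Measurable[mΩ] τ) {T : ℕ}
    (hT : 0 < T) (hu : ∀ t < T, P (τ ⁻¹' {t}) = (T : ENNReal)⁻¹)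
    (hind : Indep (MeasurableSpace.comap τ inferInstance) 𝓕 P) {X : ℕ → Ω → ℝ}
    (hm : ∀ t, Measurable[𝓕] (X t)) (hX : ∀ t, Integrable (X t) P) :
    Integrable (fun ω => X (τ ω) ω) P ∧
      ∫ ω, X (τ ω) ω ∂P = 1 / (T : ℝ) * ∑ t ∈ Finset.range T, ∫ ω, X t ω ∂P := by
  have hms : ∀ t, MeasurableSet[mΩ] (τ ⁻¹' {t}) := fun t => hτ (measurableSet_singleton t)
  -- The prescribed probabilities for `t < T` already add up to `1`.
  have hlt : ∀ᵐ ω ∂P, τ ω < T := by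
    have h1 : P (⋃ t ∈ Finset.range T, τ ⁻¹' {t}) = 1 := by
      rw [measure_biUnion_finset (fun a _ b _ hab => ?_) fun t _ => hms t]
      · rw [Finset.sum_congr rfl fun t ht => hu t (Finset.mem_range.1 ht), Finset.sum_const,
          Finset.card_range, nsmul_eq_mul]
        exact ENNReal.mul_inv_cancel (by exact_mod_cast hT.ne') (ENNReal.natCast_ne_top T)
      · exact Disjoint.preimage τ (Set.disjoint_singleton.2 hab)
    have h2 := (prob_compl_eq_zero_iff
      (Finset.measurableSet_biUnion (Finset.range T) fun t _ => hms t)).2 h1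
    filter_upwards [compl_mem_ae_iff.2 h2] with ω hω
    simpa using hω
  -- Almost surely `X (τ ω) ω` is the sum of the `φ t ω * X t ω`, and independence factors each
  -- expectation into `1 / T` times that of `X t`.
  let φ : ℕ → Ω → ℝ := fun t => (τ ⁻¹' {t}).indicator fun _ => 1
  have hφ : ∀ t, Measurable[MeasurableSpace.comap τ inferInstance] (φ t) := fun t =>
    Measurable.indicator measurable_const ⟨{t}, measurableSet_singleton t, rfl⟩
  have hφi : ∀ t, Integrable (φ t) P := fun t => (integrable_const 1).indicator (hms t)
  have hφint : ∀ t < T, ∫ ω, φ t ω ∂P = 1 / (T : ℝ) := fun t ht => by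
    simp only [φ]
    rw [integral_indicator_const _ (hms t), measureReal_def, hu t ht]
    simp
  have hindep : ∀ t, IndepFun (φ t) (X t) P := fun t =>
    (IndepFun_iff_Indep _ _ _).2
      (indep_of_indep_of_le hind (hφ t).comap_le (hm t).comap_le)
  have hprod : ∀ t, Integrable (fun ω => φ t ω * X t ω) P := fun t =>
    (hindep t).integrable_mul (hφi t) (hX t)
  have hae : (fun ω => X (τ ω) ω) =ᵐ[P] fun ω => ∑ t ∈ Finset.range T, φ t ω * X t ω := by
    filter_upwards [hlt] with ω hω
    rw [Finset.sum_eq_single (τ ω)]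
    · simp [φ]
    · intro t _ ht
      simp [φ, Ne.symm ht]
    · exact fun h => absurd (Finset.mem_range.2 hω) h
  refine ⟨(integrable_finsetSum _ fun t _ => hprod t).congr hae.symm, ?_⟩
  rw [integral_congr_ae hae, integral_finsetSum _ fun t _ => hprod t, Finset.mul_sum]
  refine Finset.sum_congr rfl fun t ht => ?_
  rw [(hindep t).integral_fun_mul_eq_mul_integral (hφi t).1 (hX t).1,
    hφint t (Finset.mem_range.1 ht)]

end Averages

section RandomIndex

variable {M d m : ℕ} {Ω Ξ : Type*} [MeasurableSpace Ξ] {ξ : ℕ → Fin M → ℕ → Ω → Ξ}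

lemma sampleSigma_le_comap (S : Set (ℕ × Fin M × ℕ)) :
    sampleSigma ξ S ≤ MeasurableSpace.comap
      (fun ω (a : ℕ × Fin M × ℕ) => ξ a.1 a.2.1 a.2.2 ω) inferInstance := by
  refine iSup₂_le fun a _ => ?_
  have h : ξ a.1 a.2.1 a.2.2 = (fun s : ℕ × Fin M × ℕ → Ξ => s a) ∘
    fun ω (a : ℕ × Fin M × ℕ) => ξ a.1 a.2.1 a.2.2 ω := rfl
  rw [h, ← MeasurableSpace.comap_comp]
  exact MeasurableSpace.comap_mono (measurable_pi_apply a).comap_le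

variable {mΩ : MeasurableSpace Ω} {U : Ω → Fin M → PDPoint d m}

lemma measurable_rowAvg (hU : ∀ i, Measurable fun ω => U ω i) :
    Measurable fun ω => rowAvg (U ω) :=
  (Finset.measurable_fun_sum _ fun i _ => hU i).const_smul (M : ℝ)⁻¹

lemma measurable_perpSq (hU : ∀ i, Measurable fun ω => U ω i) :
    Measurable fun ω => perpSq (U ω) :=
  Finset.measurable_fun_sum _ fun i _ => ((hU i).sub (measurable_rowAvg hU)).norm.pow_const 2

lemma measurable_dualGapSq {L μ : ℝ} {f : Fin M → PDPoint d m → ℝ} (hf : IsNCSCProblem L μ f)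
    (hM : 0 < M) (hL : 0 < L) (hμ : 0 < μ) (hU : ∀ i, Measurable fun ω => U ω i) :
    Measurable fun ω => dualGapSq f (U ω) :=
  ((continuous_of_norm_sub_le (hf.norm_rowAvg_snd_sub_bestResponse_sub_le hM hL hμ)).measurable.comp
    (measurable_rowAvg hU)).norm.pow_const 2

end RandomIndex

theorem theorem2 :
    -- absolute constants: for the step sizes, the batch size, the iteration count and the rates
    ∃ cx cy cS CT CZ Cδ : ℝ, 0 < cx ∧ 0 < cy ∧ 0 < cS ∧ 0 < CT ∧ 0 < CZ ∧ 0 < Cδ ∧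
    ∀ (M d m : ℕ) (_hM : 0 < M) (_hm : 0 < m)
      (L μ σ ε : ℝ) (_hL : 0 < L) (_hμ : 0 < μ) (_hσ : 0 < σ) (_hε : 0 < ε)
      (f : Fin M → PDPoint d m → ℝ) (_hf : IsNCSCProblem L μ f)
      (Edge : Fin M → Fin M → Prop) (W : Matrix (Fin M) (Fin M) ℝ) (_hW : IsMixingMatrix Edge W)
      (Ω : Type*) [MeasurableSpace Ω] (P : Measure Ω) [IsProbabilityMeasure P]
      (Ξ : Type*) [MeasurableSpace Ξ] (𝒟 : Fin M → Measure Ξ) [∀ i, IsProbabilityMeasure (𝒟 i)]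
      (g : Fin M → PDPoint d m → Ξ → PDPoint d m) (_hg : IsStochasticOracle L σ f 𝒟 g)
      (ξ : ℕ → Fin M → ℕ → Ω → Ξ) (_hξ : IsSampling P 𝒟 ξ)
      -- the parameters, with `κ = L / μ` and `ρ = mixingRho W`
      (p : DGDAParams)
      (_hηy : 0 < p.ηy) (_hηy' : p.ηy ≤ cy * (L⁻¹ * min ((1 - mixingRho W) ^ 2) (L / μ)⁻¹))
      (_hηx : 0 < p.ηx) (_hηx' : p.ηx ≤ cx * (p.ηy / (L / μ) ^ 2))
      (_hS₁ : cS * ((L / μ) ^ 2 * σ ^ 2 / ε ^ 2) ≤ p.S₁)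
      (_hq : 1 ≤ p.q) (_hS₂ : p.q ≤ p.S₂)
      -- the initialization, with `d̄⁰ = v̄⁰`
      (Z₀ : Fin M → PDPoint d m) (D₀ : Ω → Fin M → PDPoint d m)
      (_hD₀ : Measurable[initialSigma ξ] D₀) (_hD₀' : ∀ i, MemLp (fun ω => D₀ ω i) 2 P)
      (_hD₀V₀ : ∀ ω, rowAvg (D₀ ω) = rowAvg (dgdaInitV g p Z₀ fun i k => ξ 0 i k ω))
      (Z : ℕ → Ω → Fin M → PDPoint d m)
      (_hZ : ∀ t ω, Z t ω = (dgdaIter W g p Z₀ (D₀ ω) (fun t i k => ξ t i k ω) t).Z)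
      (Λ₀ : ℝ) (_hΛ₀ : Λ₀ = max (perpSq Z₀) (∫ ω, perpSq (D₀ ω) ∂P)),
      ∃ Tε : ℕ, 1 ≤ Tε ∧
        (Tε : ℝ) ≤ 1 + CT *
          max (max ((primalFun f (rowAvg Z₀).fst - ⨅ x, primalFun f x) / p.ηx)
              (L * (L / μ) * dualGapSq f Z₀ / p.ηy))
            ((max 1 L) ^ 2 * (L / μ) ^ 2 * Λ₀ / ((1 - mixingRho W) * M)) / ε ^ 2 ∧
        (∀ t, Integrable (fun ω => primalGradNorm f (Z t ω)) P ∧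
          Integrable (fun ω => perpSq (Z t ω)) P ∧
          Integrable (fun ω => dualGapSq f (Z t ω)) P) ∧
        ∀ T : ℕ, Tε ≤ T →
          (1 / (T : ℝ)) * ∑ t ∈ Finset.range T, ∫ ω, primalGradNorm f (Z t ω) ∂P ≤ ε ∧
          (1 / (T : ℝ)) * ∑ t ∈ Finset.range T, ∫ ω, perpSq (Z t ω) ∂P
            ≤ CZ * (M * ε ^ 2 / (L ^ 2 * (L / μ) ^ 2)) ∧
          (1 / (T : ℝ)) * ∑ t ∈ Finset.range T, ∫ ω, dualGapSq f (Z t ω) ∂P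
            ≤ Cδ * (ε ^ 2 / L ^ 2) ∧
          -- the output at an index `τ` uniform on `{0, …, T - 1}`, independent of the samples
          ∀ τ : Ω → ℕ, Measurable τ →
            (∀ t < T, P (τ ⁻¹' {t}) = (T : ENNReal)⁻¹) →
            IndepFun τ (fun ω (a : ℕ × Fin M × ℕ) => ξ a.1 a.2.1 a.2.2 ω) P →
            (Integrable (fun ω => √(perpSq (Z (τ ω) ω))) P ∧
              ∫ ω, √(perpSq (Z (τ ω) ω)) ∂P ≤ CZ * (√M * ε / (L * (L / μ)))) ∧
            (Integrable (fun ω => √(dualGapSq f (Z (τ ω) ω))) P ∧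
              ∫ ω, √(dualGapSq f (Z (τ ω) ω)) ∂P ≤ Cδ * (ε / L)) := by
  -- `1 / 16` and `1 / 100` are the step-size thresholds of `bounds_of_coupled_sums`. The values
  -- `4000` and `200` are twice its constants `2000` and `100`, so that initial errors and noise
  -- each take half of `T ε²`.
  refine ⟨1 / 16, 1 / 100, 200, 4000, 1, 1, by norm_num, by norm_num, by norm_num, by norm_num,
    by norm_num, by norm_num, ?_⟩
  intro M d m hM hm L μ σ ε hL hμ hσ hε f hf Edge W hW Ω _ P _ Ξ _ 𝒟 _ g hg ξ hξ p hηy hηy' hηx hηx'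
    hS₁ hq hS₂ Z₀ D₀ hD₀ hD₀' hDV Z hZ Λ₀ hΛ₀
  have hM' : (0 : ℝ) < M := by exact_mod_cast hM
  have hr : 0 < 1 - mixingRho W := sub_pos.2 hW.rho_lt_one
  have hr1 : 1 - mixingRho W ≤ 1 := sub_le_self _ (mixingRho_nonneg W)
  have hμL : μ ≤ L := hf.smoothness_ge hM hm hL.le
  have hκ : 1 ≤ L / μ := (one_le_div hμ).2 hμL
  have hκ0 : 0 < L / μ := by positivity
  have hy1 : L * p.ηy ≤ (1 - mixingRho W) ^ 2 / 100 := by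
    calc L * p.ηy ≤ L * (1 / 100 * (L⁻¹ * (1 - mixingRho W) ^ 2)) := by
          gcongr
          exact hηy'.trans (by gcongr; exact min_le_left _ _)
      _ = _ := by field_simp
  have hy2 : L * (L / μ) * p.ηy ≤ 1 / 100 := by
    calc L * (L / μ) * p.ηy ≤ L * (L / μ) * (1 / 100 * (L⁻¹ * (L / μ)⁻¹)) := by
          gcongr
          exact hηy'.trans (by gcongr; exact min_le_right _ _)
      _ = _ := by field_simp
  have hx1 : p.ηx * (L / μ) ^ 2 ≤ p.ηy / 16 := by
    calc p.ηx * (L / μ) ^ 2 ≤ 1 / 16 * (p.ηy / (L / μ) ^ 2) * (L / μ) ^ 2 := by gcongr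
      _ = _ := by field_simp
  have hx2 : p.ηx ≤ p.ηy / 16 :=
    (le_mul_of_one_le_right hηx.le (one_le_pow₀ hκ)).trans hx1
  have hxy : p.ηx ≤ p.ηy := by linarith
  have hy3 : L ^ 2 * p.ηy ≤ μ := by
    calc L ^ 2 * p.ηy = μ * (L * (L / μ) * p.ηy) := by field_simp
      _ ≤ μ * (1 / 100) := by gcongr
      _ ≤ μ := by linarith
  have hy4 : μ * p.ηy ≤ 1 := by
    calc μ * p.ηy ≤ L * (L / μ) * p.ηy := by
          gcongr
          exact hμL.trans (le_mul_of_one_le_right hL.le hκ)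
      _ ≤ 1 / 100 := hy2
      _ ≤ 1 := by norm_num
  have hx3 : 2 * L * (L / μ) * p.ηx ≤ 1 / 4 := by
    calc 2 * L * (L / μ) * p.ηx ≤ 2 * L * (L / μ) * p.ηy := by gcongr
      _ = 2 * (L * (L / μ) * p.ηy) := by ring
      _ ≤ 1 / 4 := by linarith
  -- As `σ > 0`, the lower bound on `S₁` is positive and the large batches are nonempty.
  have hS₁' : (0 : ℝ) < p.S₁ := lt_of_lt_of_le (by positivity) hS₁
  have hS₁0 : 0 < p.S₁ := by exact_mod_cast hS₁'
  have hnoise : (L / μ) ^ 2 * ((p.S₁ : ℝ)⁻¹ * σ ^ 2) ≤ ε ^ 2 / 200 := by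
    rw [inv_mul_eq_div, mul_div_assoc', div_le_iff₀ hS₁']
    calc (L / μ) ^ 2 * σ ^ 2 = ε ^ 2 / 200 * (200 * ((L / μ) ^ 2 * σ ^ 2 / ε ^ 2)) := by field_simp
      _ ≤ _ := by gcongr
  obtain rfl : Z = fun t ω => (dgdaRun W g p Z₀ D₀ ξ t ω).Z := funext fun t => funext (hZ t)
  have hmem := fun t => (memLp_dgdaRun (W := W) (Z₀ := Z₀) hf hg hξ hS₁0 (hq.trans hS₂) hD₀ hD₀' t).1
  have hmeas := fun t => (measurable_dgdaRun (W := W) (p := p) (Z₀ := Z₀) hg hD₀ t).1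
  have iZ := fun t => integrable_perpSq (hmem t)
  have iδ := fun t => integrable_dualGapSq hf hM hL hμ (hmem t)
  have iG := fun t => memLp_gradient_primalFun hf hM hm hL hμ (hmem t)
  have hrec := meanRecursion_dgdaRun hf hM hm hL hμ hW hg hξ hηx hηy hxy hy3 hy4 hx3 hS₁0 hq hS₂ hD₀
    hD₀' hDV rfl
  set K : ℝ := max (max ((primalFun f (rowAvg Z₀).fst - ⨅ x, primalFun f x) / p.ηx)
              (L * (L / μ) * dualGapSq f Z₀ / p.ηy))
            ((max 1 L) ^ 2 * (L / μ) ^ 2 * Λ₀ / ((1 - mixingRho W) * M)) with hK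
  have hδ0 : 0 ≤ dualGapSq f Z₀ := sq_nonneg _
  have hK0 : 0 ≤ K := le_max_of_le_left (le_max_of_le_right (by positivity))
  -- The floor plus one exceeds `4000 K / ε²`, is at least `1`, and costs only the additive `1` in
  -- the bound.
  refine ⟨⌊4000 * K / ε ^ 2⌋₊ + 1, Nat.le_add_left 1 _, ?_, fun t =>
    ⟨((iG t).integrable one_le_two).norm, iZ t, iδ t⟩, ?_⟩
  · push_cast
    linarith [Nat.floor_le (by positivity : 0 ≤ 4000 * K / ε ^ 2)]
  intro T hT
  have hT0 : 0 < T := lt_of_lt_of_le (Nat.succ_pos _) hT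
  have hT' : (0 : ℝ) < T := by exact_mod_cast hT0
  have hKT : K ≤ T * ε ^ 2 / 4000 := by
    have h1 : 4000 * K / ε ^ 2 ≤ T := (Nat.lt_floor_add_one _).le.trans (by exact_mod_cast hT)
    rw [div_le_iff₀ (by positivity)] at h1
    linarith
  have hbound := hrec.sum_bounds hM' hL hμ hμL hr hr1 hηx hηy hy1 hy2 hx1 hq (by positivity)
    (Φmin := ⨅ x, primalFun f x) (K := K) ?_ ?_ ?_ ?_ hT0
  rotate_left
  · intro t
    have h1 := integral_mono (integrable_const (⨅ x, primalFun f x))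
      (integrable_primalFun hf hM hm hL hμ (hmem t)) fun ω => ciInf_le hf.primal_bddBelow _
    simpa using h1
  · have e : ∫ ω, primalFun f (rowAvg (dgdaRun W g p Z₀ D₀ ξ 0 ω).Z).fst ∂P =
        primalFun f (rowAvg Z₀).fst := by simp [dgdaRun, dgdaIter]
    rw [e]
    exact (le_max_left _ _).trans (le_max_left _ _)
  · have e : ∫ ω, dualGapSq f (dgdaRun W g p Z₀ D₀ ξ 0 ω).Z ∂P = dualGapSq f Z₀ := by
      simp [dgdaRun, dgdaIter]
    rw [e]
    exact (le_max_right _ _).trans (le_max_left _ _)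
  · have e1 : ∫ ω, perpSq (dgdaRun W g p Z₀ D₀ ξ 0 ω).Z ∂P = perpSq Z₀ := by
      simp [dgdaRun, dgdaIter]
    have e2 : ∫ ω, perpSq (dgdaRun W g p Z₀ D₀ ξ 0 ω).D ∂P = ∫ ω, perpSq (D₀ ω) ∂P := rfl
    rw [e1, e2]
    have hZ1 : perpSq Z₀ ≤ Λ₀ := hΛ₀ ▸ le_max_left _ _
    have hD1 : ∫ ω, perpSq (D₀ ω) ∂P ≤ Λ₀ := hΛ₀ ▸ le_max_right _ _
    have hΛ0 : 0 ≤ Λ₀ := (perpSq_nonneg _).trans hZ1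
    -- `max 1 L` serves both initial errors: its square dominates the weight `L²` of the iterates
    -- and the weight `1` of the trackers. Adding the two gives the factor `2` in front of `K`.
    have hm1 : L ^ 2 * perpSq Z₀ ≤ (max 1 L) ^ 2 * Λ₀ := by
      exact mul_le_mul (pow_le_pow_left₀ hL.le (le_max_right 1 L) 2) hZ1 (perpSq_nonneg _)
        (sq_nonneg _)
    have hm2 : ∫ ω, perpSq (D₀ ω) ∂P ≤ (max 1 L) ^ 2 * Λ₀ :=
      hD1.trans (le_mul_of_one_le_left hΛ0 (one_le_pow₀ (le_max_left _ _)))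
    calc (L / μ) ^ 2 * (L ^ 2 * perpSq Z₀ + ∫ ω, perpSq (D₀ ω) ∂P) / ((1 - mixingRho W) * M)
        ≤ (L / μ) ^ 2 * ((max 1 L) ^ 2 * Λ₀ + (max 1 L) ^ 2 * Λ₀) / ((1 - mixingRho W) * M) := by
          gcongr
      _ = 2 * ((max 1 L) ^ 2 * (L / μ) ^ 2 * Λ₀ / ((1 - mixingRho W) * M)) := by ring
      _ ≤ 2 * K := by
          gcongr
          exact le_max_right _ _
  have hrhs : 2000 * K + 100 * ((L / μ) ^ 2 * (T * ((p.S₁ : ℝ)⁻¹ * σ ^ 2))) ≤ T * ε ^ 2 := by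
    have h1 := mul_le_mul_of_nonneg_left hnoise hT'.le
    linarith
  obtain ⟨bG, bZ, bδ⟩ := hbound
  have avgG : 1 / (T : ℝ) * ∑ t ∈ Finset.range T,
      ∫ ω, ‖gradient (primalFun f) (rowAvg (dgdaRun W g p Z₀ D₀ ξ t ω).Z).fst‖ ^ 2 ∂P ≤ ε ^ 2 := by
    rw [one_div, inv_mul_le_iff₀ hT']
    exact bG.trans hrhs
  have avgZ : 1 / (T : ℝ) * ∑ t ∈ Finset.range T,
      ∫ ω, perpSq (dgdaRun W g p Z₀ D₀ ξ t ω).Z ∂P ≤ M * ε ^ 2 / (L ^ 2 * (L / μ) ^ 2) := by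
    have h1 := bZ.trans hrhs
    rw [div_le_iff₀ hM'] at h1
    rw [one_div, inv_mul_le_iff₀ hT', mul_div_assoc', le_div_iff₀ (by positivity)]
    linarith
  have avgδ : 1 / (T : ℝ) * ∑ t ∈ Finset.range T,
      ∫ ω, dualGapSq f (dgdaRun W g p Z₀ D₀ ξ t ω).Z ∂P ≤ ε ^ 2 / L ^ 2 := by
    have h1 := bδ.trans hrhs
    rw [one_div, inv_mul_le_iff₀ hT', mul_div_assoc', le_div_iff₀ (by positivity)]
    linarith
  refine ⟨?_, by rw [one_mul]; exact avgZ, by rw [one_mul]; exact avgδ, ?_⟩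
  · have h1 := average_integral_sqrt_le (fun t => (iG t).integrable_norm_pow')
      (fun t ω => sq_nonneg _) hε hT0 avgG
    simpa only [Real.sqrt_sq (norm_nonneg _), primalGradNorm] using h1
  intro τ hτ hu hind
  have hind' : Indep (MeasurableSpace.comap τ inferInstance) (sampleSigma ξ Set.univ) P :=
    indep_of_indep_of_le_right ((IndepFun_iff_Indep _ _ _).1 hind) (sampleSigma_le_comap _)
  have hle : ∀ t, pastSigma ξ t ≤ sampleSigma ξ Set.univ := fun t =>
    sampleSigma_mono ξ (Set.subset_univ _)
  have mZ : ∀ t, Measurable[sampleSigma ξ Set.univ]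
      fun ω => √(perpSq (dgdaRun W g p Z₀ D₀ ξ t ω).Z) := fun t =>
    (measurable_perpSq fun i => (hmeas t i).mono (hle t) le_rfl).sqrt
  have mδ : ∀ t, Measurable[sampleSigma ξ Set.univ]
      fun ω => √(dualGapSq f (dgdaRun W g p Z₀ D₀ ξ t ω).Z) := fun t =>
    (measurable_dualGapSq hf hM hL hμ fun i => (hmeas t i).mono (hle t) le_rfl).sqrt
  have uZ := integral_comp_uniform_index hτ hT0 hu hind' mZ
    fun t => integrable_sqrt (iZ t) fun ω => perpSq_nonneg _
  have uδ := integral_comp_uniform_index hτ hT0 hu hind' mδ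
    fun t => integrable_sqrt (iδ t) fun ω => sq_nonneg _
  refine ⟨⟨uZ.1, ?_⟩, ⟨uδ.1, ?_⟩⟩
  · rw [one_mul]
    refine uZ.2.trans_le (average_integral_sqrt_le iZ (fun t ω => perpSq_nonneg _)
      (by positivity) hT0 (avgZ.trans (le_of_eq ?_)))
    rw [div_pow (√(M : ℝ) * ε), mul_pow (√(M : ℝ)), mul_pow L, Real.sq_sqrt hM'.le]
  · rw [one_mul]
    refine uδ.2.trans_le (average_integral_sqrt_le iδ (fun t ω => sq_nonneg _)
      (by positivity) hT0 (avgδ.trans (le_of_eq ?_)))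
    rw [div_pow]
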